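/- Let $K$ be a number field with ring of integers $\mathcal O_K$, let $\mathfrak I(K)$ be the set of nonzero ideals of $\mathcal O_K$, and let $\mathcal N(\mathfrak u)=[\mathcal O_K:\mathfrak u]$. Let $g\colon\mathfrak I(K)\to\{z\in\mathbb C:|z|\le 1\}$ be multiplicative, i.e. $g(\mathfrak u\mathfrak v)=g(\mathfrak u)g(\mathfrak v)$ whenever $\mathfrak u+\mathfrak v=(1)$. For $f_1,f_2\colon\mathfrak I(K)\to\{z\in\mathbb C:|z|\le 1\}$ put $$\mathbb D(f_1,f_2)=\sum_{\mathfrak p}\frac{1}{\mathcal N(\mathfrak p)}\bigl(1-\operatorname{Re} f_1(\mathfrak p)\overline{f_2(\mathfrak p)}\bigr)\in[0,\infty],$$ where $\mathfrak p$ runs over the nonzero prime ideals of $\mathcal O_K$, and for $\tau\in\mathbb R$ let $\mathcal N^{i\tau}$ denote the function $\mathfrak u\mapsto\mathcal N(\mathfrak u)^{i\tau}$. 1. If $\inf_{\tau\in\mathbb R}\mathbb D(g,\mathcal N^{i\tau})=\infty$, then $$\lim_{x\to\infty}\frac{1}{|\{\mathfrak u\in\mathfrak I(K):\mathcal N(\mathfrak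 u)\le x\}|}\sum_{\mathcal N(\mathfrak u)\le x}g(\mathfrak u)=0.$$ 2. If $\tau\in\mathbb R$ satisfies $\mathbb D(g,\mathcal N^{i\tau})<\infty$, then, as $x\to\infty$, $$\sum_{\mathcal N(\mathfrak u)\le x}g(\mathfrak u)=R_1\cdot\frac{x^{1+i\tau}}{1+i\tau}\prod_{\mathcal N(\mathfrak p)\le x}\Bigl(1-\frac1{\mathcal N(\mathfrak p)}\Bigr)\bigl(1+h_{1+i\tau}(\mathfrak p)\bigr)+o(x),$$ where $h_s(\mathfrak p)=\sum_{k=1}^{\infty}g(\mathfrak p^k)\mathcal N(\mathfrak p^k)^{-s}$ and $R_1$ is the residue at $s=1$ of the Dedekind zeta function of $K$. -/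

import Mathlib

open Filter Topology Asymptotics NumberField nonZeroDivisors

noncomputable section

namespace NumberFieldHalasz

variable (K : Type*) [Field K] [NumberField K]

/-- The set `𝔍(K)` of (nonzero) ideals of the ring of integers of `K`. -/
abbrev Ideals : Type _ := (Ideal (𝓞 K))⁰

/-- The nonzero prime ideals of the ring of integers of `K`. -/
abbrev Primes : Type _ := IsDedekindDomain.HeightOneSpectrum (𝓞 K)

variable {K}

/-- The absolute norm `𝒩(𝔲) = [𝓞 K : 𝔲]`. -/
def norm (u : Ideals K) : ℕ := Ideal.absNorm (u : Ideal (𝓞 K))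

/-- A prime ideal, regarded as a nonzero ideal. -/
def Primes.toIdeals (p : Primes K) : Ideals K :=
  ⟨p.asIdeal, mem_nonZeroDivisors_of_ne_zero p.ne_bot⟩

/-- `g(𝔲𝔳) = g(𝔲) g(𝔳)` for all coprime ideals `𝔲`, `𝔳` (coprime: `𝔲 + 𝔳 = (1)`). -/
def IsMultiplicative (g : Ideals K → ℂ) : Prop :=
  ∀ u v : Ideals K, (u : Ideal (𝓞 K)) + (v : Ideal (𝓞 K)) = 1 → g (u * v) = g u * g v

/-- The function `𝔲 ↦ 𝒩(𝔲)^{iτ}`. -/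
def normPow (τ : ℝ) (u : Ideals K) : ℂ := (norm u : ℂ) ^ (τ * Complex.I)

/-- The pretentious distance `𝔻(f, g) = ∑_𝔭 (1 - Re (f(𝔭) conj g(𝔭))) / 𝒩(𝔭) ∈ [0, ∞]` of two
functions with values in the closed unit disc (so that every term is nonnegative). -/
def dist (f g : Ideals K → ℂ) : ENNReal :=
  ∑' p : Primes K, ENNReal.ofReal
    ((1 - (f p.toIdeals * starRingEnd ℂ (g p.toIdeals)).re) / (norm p.toIdeals : ℝ))

/-- `h_s(𝔭) = ∑_{k ≥ 1} g(𝔭^k) 𝒩(𝔭^k)^{-s}`. -/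
def h (g : Ideals K → ℂ) (s : ℂ) (p : Primes K) : ℂ :=
  ∑' k : ℕ, g (p.toIdeals ^ (k + 1)) * (norm (p.toIdeals ^ (k + 1)) : ℂ) ^ (-s)

variable (K)

theorem finite_ideals_norm_le (x : ℝ) : {u : Ideals K | (norm u : ℝ) ≤ x}.Finite :=
  (Ideal.finite_setOfPred_absNorm_le₀ (S := 𝓞 K) ⌊x⌋₊).subset fun _ hu => Nat.le_floor hu

theorem finite_primes_norm_le (x : ℝ) : {p : Primes K | (norm p.toIdeals : ℝ) ≤ x}.Finite :=
  (finite_ideals_norm_le K x).preimage (f := Primes.toIdeals) fun _ _ _ _ hpq =>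
    IsDedekindDomain.HeightOneSpectrum.ext (congrArg Subtype.val hpq)

/-- The finite set of nonzero ideals of norm at most `x`. -/
def idealsLE (x : ℝ) : Finset (Ideals K) := (finite_ideals_norm_le K x).toFinset

/-- The finite set of nonzero prime ideals of norm at most `x`. -/
def primesLE (x : ℝ) : Finset (Primes K) := (finite_primes_norm_le K x).toFinset

variable {K}

/-- The average `𝔼_{𝒩(𝔲) ≤ x} g(𝔲)`. -/
def mean (g : Ideals K → ℂ) (x : ℝ) : ℂ :=
  (∑ u ∈ idealsLE K x, g u) / ((idealsLE K x).card : ℂ)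

end NumberFieldHalasz

end

/-!
The mean value theorem of Halász over the ideals of a number field.

The sums of `g` are compared with those of `L(X) e`, where `e` is a function whose sums are known and
`L(X)` is a bounded factor. If `g` is far from every `𝒩^(iτ)`, then `L = 0`. If `g` is at finite
distance from `𝒩^(iτ)`, then `e = 𝒩^(iτ)` and `L(X)` is the Euler product of the statement, truncated
at `X`. What is used about the pair is collected in `IsComparison`: `g` and `e` are close at the primes
in the sense that `∑ η(p)² / 𝒩(p)` converges for a majorant `η` of `‖L‖ ‖g - e‖`, and, on the lines
`Re s = 1 + β` with `β` comparable to `1 / log X`, the Dirichlet series of `c = g - L(X) e` is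
`o(1 / β)`, with polynomial uniformity in the height. The conclusion `IsComparison.isLittleO` is that
the sums of `c` over `𝒩(u) ≤ X` are `o(X)`.

This transfer from Dirichlet series to sums uses no analytic continuation. By multiplicativity,
`c log` is the convolution of `g log`, restricted to the primes, with `c`, plus a similar convolution
involving `g - e` at the primes, up to an error bounded on average (`norm_sub_mul_log_sub_le`). Hence
`log x` times a smoothed sum of `c` becomes a sum over pairs of a prime `p` and an ideal `u`
(`log_mul_norm_smoothSum_le`). Perron's formula and Cauchy–Schwarz bound the latter by mean squares of
two Dirichlet series on the line `Re s = 1 + 1 / log X` (`norm_tsum_ker_le_mean`). The mean square of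
the series over primes is controlled by Chebyshev's bound `sum_log_norm_primesLE_le` alone
(`integral_sq_dser_le`). For the series over ideals, inserting `1 = n⁻¹ + ∫₀¹ (log n) n^(-α) dα`
replaces it by its derivative on all lines further to the right (`norm_sum_pairs_ker_le`), and by the
convolution identity again the derivative is small in mean square where the series itself is small
(`integral_sq_mulLog_le`). A second difference removes the smoothing (`norm_sum_idealsLE_le`), as the
ideals have a positive density.

It remains to verify that the Dirichlet series are close. If `g` is far from every `𝒩^(it)`, the Euler
product shows that its series is small compared with `ζ(1 + β)` at each height; compactness gives
uniformity at bounded height, and above that the trivial bound suffices (`isComparison_zero`). If `g`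
is close to `𝒩^(iτ)`, one may take `τ = 0` by twisting. Within `O(1 / log X)` of the point one, the
quotient of the Euler products of `g` and of the zeta function differs by `o(1)` from its value at one
truncated at `X` (`eventually_norm_prod_sub_eulerQuotient_le`). Elsewhere at bounded height the zeta
function is `o(1 / β)` because `ζ(s)` is approximated by `R s / (s - 1)` (`exists_norm_zeta_sub_le`),
and the series of `g` inherits this from the triangle inequality for the distance
(`norm_sq_dser_le`). The second part then follows from the asymptotics of the sums of `𝒩^(iτ)`
(`sum_normPow_isLittleO`), obtained by partial summation from the density of the ideals.
-/

namespace NumberFieldHalasz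

section

variable {K : Type*} [Field K] [NumberField K]

/-! ### Norms and factorizations of ideals -/

theorem idealNorm_mul (u v : Ideals K) : norm (u * v) = norm u * norm v := by
  simp [norm]

theorem idealNorm_one : norm (1 : Ideals K) = 1 := by
  simp [norm]

theorem idealNorm_pow (u : Ideals K) (k : ℕ) : norm (u ^ k) = norm u ^ k := by
  simp [norm]

theorem idealNorm_pos (u : Ideals K) : 0 < norm u :=
  Ideal.absNorm_pos_of_nonZeroDivisors u

theorem one_le_norm (u : Ideals K) : (1 : ℝ) ≤ norm u := by
  exact_mod_cast idealNorm_pos u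

theorem idealNorm_ne_zero (u : Ideals K) : (norm u : ℂ) ≠ 0 := by
  exact_mod_cast (idealNorm_pos u).ne'

theorem log_norm_nonneg (u : Ideals K) : 0 ≤ Real.log (norm u) :=
  Real.log_nonneg (one_le_norm u)

theorem two_le_norm_toIdeals (p : Primes K) : (2 : ℝ) ≤ norm p.toIdeals := by
  have h1 : norm p.toIdeals ≠ 1 := fun h1 =>
    p.isPrime.ne_top (Ideal.absNorm_eq_one_iff.1 h1)
  have h2 := idealNorm_pos p.toIdeals
  exact_mod_cast (by omega : 2 ≤ norm p.toIdeals)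

omit [NumberField K] in
theorem toIdeals_injective : Function.Injective (Primes.toIdeals (K := K)) := fun _ _ hpq =>
  IsDedekindDomain.HeightOneSpectrum.ext (congrArg Subtype.val hpq)

theorem mem_idealsLE {x : ℝ} {u : Ideals K} : u ∈ idealsLE K x ↔ (norm u : ℝ) ≤ x := by
  simp [idealsLE]

theorem mem_primesLE {x : ℝ} {p : Primes K} :
    p ∈ primesLE K x ↔ (norm p.toIdeals : ℝ) ≤ x := by
  simp [primesLE]

instance countable_ideals : Countable (Ideals K) := by
  have h1 : (⋃ n : ℕ, {u : Ideals K | (norm u : ℝ) ≤ n}) = Set.univ :=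
    Set.eq_univ_of_forall fun u => Set.mem_iUnion.2 ⟨norm u, by simp⟩
  rw [← Set.countable_univ_iff, ← h1]
  exact Set.countable_iUnion fun n => (finite_ideals_norm_le K n).countable

instance countable_primes : Countable (Primes K) :=
  (toIdeals_injective (K := K)).countable

omit [NumberField K] in
theorem dvd_iff_coe {u v : Ideals K} : u ∣ v ↔ (u : Ideal (𝓞 K)) ∣ (v : Ideal (𝓞 K)) := by
  refine ⟨fun ⟨c, hc⟩ => ⟨c, by rw [hc]; rfl⟩, fun ⟨c, hc⟩ => ?_⟩
  have hc0 : c ≠ 0 := by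
    rintro rfl
    exact nonZeroDivisors.ne_zero v.2 (by rw [hc, mul_zero])
  exact ⟨⟨c, mem_nonZeroDivisors_of_ne_zero hc0⟩, Subtype.ext hc⟩

/-- The exponent of the prime `p` in the factorization of `u`. -/
noncomputable def val (p : Primes K) (u : Ideals K) : ℕ :=
  open Classical in
  (UniqueFactorizationMonoid.normalizedFactors (u : Ideal (𝓞 K))).count p.asIdeal

theorem val_eq_of_dvd {p : Primes K} {u : Ideals K} {n : ℕ} (h1 : p.toIdeals ^ n ∣ u)
    (h2 : ¬ p.toIdeals ^ (n + 1) ∣ u) : val p u = n := by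
  rw [dvd_iff_coe] at h1 h2
  exact UniqueFactorizationMonoid.count_normalizedFactors_eq p.irreducible
    (normalize_eq _) h1 h2

theorem exists_eq_pow_mul (p : Primes K) (u : Ideals K) :
    ∃ k w, u = p.toIdeals ^ k * w ∧ ¬ p.toIdeals ∣ w := by
  have hfin : FiniteMultiplicity p.toIdeals u := by
    refine ⟨norm u, fun hd => ?_⟩
    obtain ⟨c, hc⟩ := hd
    have h1 : norm u = norm p.toIdeals ^ (norm u + 1) * norm c := by
      rw [← idealNorm_pow, ← idealNorm_mul, ← hc]
    have h2 : 2 ≤ norm p.toIdeals := by exact_mod_cast two_le_norm_toIdeals p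
    have h3 : 2 ^ (norm u + 1) ≤ norm p.toIdeals ^ (norm u + 1) := Nat.pow_le_pow_left h2 _
    have h4 : norm u + 1 < 2 ^ (norm u + 1) := Nat.lt_two_pow_self
    have h5 := Nat.le_mul_of_pos_right (norm p.toIdeals ^ (norm u + 1)) (idealNorm_pos c)
    omega
  obtain ⟨c, hc, hc'⟩ := hfin.exists_eq_pow_mul_and_not_dvd
  exact ⟨_, c, hc, hc'⟩

theorem val_pow_mul {p : Primes K} {w : Ideals K} (hw : ¬ p.toIdeals ∣ w) (k : ℕ) :
    val p (p.toIdeals ^ k * w) = k := by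
  refine val_eq_of_dvd (Dvd.intro _ rfl) fun hd => hw ?_
  rw [pow_succ] at hd
  exact (mul_dvd_mul_iff_left' _).1 hd
where
  mul_dvd_mul_iff_left' (a : Ideals K) {b c : Ideals K} : a * b ∣ a * c ↔ b ∣ c := by
    refine ⟨fun ⟨d, hd⟩ => ⟨d, ?_⟩, fun h1 => mul_dvd_mul_left a h1⟩
    rw [mul_assoc] at hd
    exact mul_left_cancel hd

theorem eq_pow_val_mul (p : Primes K) (u : Ideals K) :
    ∃ w, u = p.toIdeals ^ val p u * w ∧ ¬ p.toIdeals ∣ w := by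
  obtain ⟨k, w, rfl, hw⟩ := exists_eq_pow_mul p u
  exact ⟨w, by rw [val_pow_mul hw], hw⟩

theorem pow_dvd_iff_le_val {p : Primes K} {u : Ideals K} {k : ℕ} :
    p.toIdeals ^ k ∣ u ↔ k ≤ val p u := by
  obtain ⟨w, hu, hw⟩ := eq_pow_val_mul p u
  constructor
  · intro hk
    by_contra! hlt
    have h1 : p.toIdeals ^ (val p u + 1) ∣ u := (pow_dvd_pow _ hlt).trans hk
    conv at h1 => rhs; rw [hu]
    rw [pow_succ] at h1
    exact hw ((val_pow_mul.mul_dvd_mul_iff_left' _).1 h1)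
  · intro hk
    exact (pow_dvd_pow _ hk).trans ⟨w, hu⟩

/-- The prime divisors of a nonzero ideal. -/
noncomputable def primeDivs (u : Ideals K) : Finset (Primes K) :=
  (Ideal.finite_factors (nonZeroDivisors.ne_zero u.2)).toFinset

theorem mem_primeDivs {u : Ideals K} {p : Primes K} : p ∈ primeDivs u ↔ p.toIdeals ∣ u := by
  rw [dvd_iff_coe]
  simp [primeDivs, Primes.toIdeals]

theorem log_norm_eq_sum (u : Ideals K) :
    Real.log (norm u) = ∑ p ∈ primeDivs u, val p u * Real.log (norm p.toIdeals) := by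
  classical
  have h0 : (u : Ideal (𝓞 K)) ≠ 0 := nonZeroDivisors.ne_zero u.2
  have h1 := Ideal.finprod_heightOneSpectrum_factorization h0
  have h2 : ∀ p : Primes K, p.maxPowDividing (u : Ideal (𝓞 K)) = p.asIdeal ^ val p u := fun p => by
    rw [p.maxPowDividing_eq_pow_multiset_count h0, val]
  rw [finprod_eq_prod_of_mulSupport_subset (s := primeDivs u)] at h1
  · have h3 : norm u = ∏ p ∈ primeDivs u, norm p.toIdeals ^ val p u := by
      rw [norm, ← h1, map_prod]
      refine Finset.prod_congr rfl fun p _ => ?_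
      rw [h2, map_pow]
      rfl
    rw [h3]
    push_cast
    rw [Real.log_prod (fun p _ => by have := idealNorm_pos p.toIdeals; positivity)]
    refine Finset.sum_congr rfl fun p _ => ?_
    rw [Real.log_pow]
  · intro p hp
    rw [Function.mem_mulSupport, h2] at hp
    rw [Finset.mem_coe, mem_primeDivs]
    have : 1 ≤ val p u := by
      by_contra! hv
      exact hp (by rw [Nat.lt_one_iff.1 hv, pow_zero])
    simpa using pow_dvd_iff_le_val.2 this

theorem add_eq_one_of_not_dvd {p : Primes K} {w : Ideals K} (hw : ¬ p.toIdeals ∣ w) (k : ℕ) :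
    ((p.toIdeals ^ k : Ideals K) : Ideal (𝓞 K)) + (w : Ideal (𝓞 K)) = 1 := by
  have h1 : p.asIdeal ⊔ (w : Ideal (𝓞 K)) = ⊤ := by
    refine p.isMaximal.out.2 _ (left_lt_sup.2 fun hle => ?_)
    exact hw (dvd_iff_coe.2 (Ideal.dvd_iff_le.2 hle))
  have h2 := Ideal.pow_sup_eq_top (n := k) h1
  simpa [Primes.toIdeals] using h2

theorem IsMultiplicative.pow_mul {g : Ideals K → ℂ} (hg : IsMultiplicative g) {p : Primes K}
    {w : Ideals K} (hw : ¬ p.toIdeals ∣ w) (k : ℕ) :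
    g (p.toIdeals ^ k * w) = g (p.toIdeals ^ k) * g w :=
  hg _ _ (add_eq_one_of_not_dvd hw k)

theorem prime_dvd_mul {p : Primes K} {u v : Ideals K} (h1 : p.toIdeals ∣ u * v) :
    p.toIdeals ∣ u ∨ p.toIdeals ∣ v := by
  simp only [dvd_iff_coe] at *
  exact p.prime.dvd_or_dvd h1

theorem prime_dvd_pow {p q : Primes K} {k : ℕ} (h1 : p.toIdeals ∣ q.toIdeals ^ k) : p = q := by
  rw [dvd_iff_coe] at h1
  have h2 : p.asIdeal ∣ q.asIdeal := p.prime.dvd_of_dvd_pow h1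
  have h3 := (Ideal.dvd_iff_le.1 h2)
  exact IsDedekindDomain.HeightOneSpectrum.ext
    (q.isMaximal.eq_of_le p.isPrime.ne_top h3).symm

/-- Chebyshev's bound for prime ideals: the prime ideals of norm at most `x` are pairwise coprime
divisors of the ideal generated by the primorial of `⌊x⌋`. -/
theorem sum_log_norm_primesLE_le {x : ℝ} (hx : 0 ≤ x) :
    ∑ p ∈ primesLE K x, Real.log (norm p.toIdeals) ≤
      Module.finrank ℤ (𝓞 K) * Real.log 4 * x := by
  classical
  have h1 : ∏ p ∈ primesLE K x, p.asIdeal ∣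
      Ideal.span {((primorial ⌊x⌋₊ : ℕ) : 𝓞 K)} := by
    refine Finset.prod_dvd_of_coprime (fun p _ q _ hpq => p.isCoprime_of_ne q hpq) fun p hp => ?_
    obtain ⟨l, n, hn, hl, hlp, hN⟩ := Ideal.exists_prime_and_absNorm_eq_pow p.asIdeal
    rw [Ideal.dvd_span_singleton]
    have hle : l ≤ ⌊x⌋₊ := by
      refine Nat.le_floor (le_trans ?_ (mem_primesLE.1 hp))
      have : norm p.toIdeals = l ^ n := hN
      rw [this]
      exact_mod_cast Nat.le_self_pow hn.ne' l
    obtain ⟨c, hc⟩ := (hlp.dvd_primorial_iff).2 hle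
    rw [hc]
    push_cast
    exact Ideal.mul_mem_right _ _ hl
  have h2 : ∏ p ∈ primesLE K x, norm p.toIdeals ∣ primorial ⌊x⌋₊ ^ Module.finrank ℤ (𝓞 K) := by
    have := map_dvd (Ideal.absNorm (S := 𝓞 K)) h1
    rw [map_prod, Ideal.absNorm_span_natCast] at this
    exact this
  have h3 := Nat.le_of_dvd (pow_pos (primorial_pos _) _) h2
  have h4 : ∑ p ∈ primesLE K x, Real.log (norm p.toIdeals) =
      Real.log ((∏ p ∈ primesLE K x, norm p.toIdeals : ℕ) : ℝ) := by
    push_cast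
    rw [Real.log_prod (fun p _ => by have := idealNorm_pos p.toIdeals; positivity)]
  rw [h4]
  have h5 : (0 : ℝ) < ((∏ p ∈ primesLE K x, norm p.toIdeals : ℕ) : ℝ) := by
    exact_mod_cast Finset.prod_pos fun p _ => idealNorm_pos _
  calc _ ≤ Real.log ((primorial ⌊x⌋₊ ^ Module.finrank ℤ (𝓞 K) : ℕ) : ℝ) :=
        Real.log_le_log h5 (by exact_mod_cast h3)
    _ = Module.finrank ℤ (𝓞 K) * Chebyshev.theta x := by
        rw [Chebyshev.theta_eq_log_primorial]
        push_cast
        rw [Real.log_pow]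
    _ ≤ _ := by
        rw [mul_assoc]
        gcongr
        exact Chebyshev.theta_le_log4_mul_x hx

end

section

open MeasureTheory Set

/-! ### Weighted families of linear growth -/

/-- The weights `b i`, placed at the points `N i`, have total mass at most `C * x` on `[0, x]`.
Only finite subfamilies are summed, so that no summability has to be assumed. -/
def LinearGrowth {ι : Type*} (N b : ι → ℝ) (C : ℝ) : Prop :=
  ∀ (S : Finset ι) (x : ℝ), 0 ≤ x → (∀ i ∈ S, N i ≤ x) → ∑ i ∈ S, b i ≤ C * x

section family

variable {ι : Type*} {N b : ι → ℝ} {C : ℝ}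

theorem LinearGrowth.sum_filter_lt_le (hC : LinearGrowth N b C) (S : Finset ι) {t : ℝ}
    (ht : 0 ≤ t) : ∑ i ∈ S, (if N i < t then b i else 0) ≤ C * t := by
  classical
  rw [← Finset.sum_filter]
  exact hC _ _ ht fun i hi => (Finset.mem_filter.1 hi).2.le

/-- Partial summation: write `N ^ (-ρ)` as the integral of `ρ * t ^ (-ρ - 1)` over `t > N`. -/
theorem LinearGrowth.sum_rpow_le (hC : LinearGrowth N b C) {y ρ : ℝ} (hy : 0 < y) (hρ : 1 < ρ)
    {S : Finset ι} (hS : ∀ i ∈ S, y ≤ N i) :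
    ∑ i ∈ S, b i * N i ^ (-ρ) ≤ C * (ρ / (ρ - 1)) * y ^ (1 - ρ) := by
  have hint : IntegrableOn (fun t : ℝ => ρ * t ^ (-ρ - 1)) (Ioi y) :=
    (integrableOn_Ioi_rpow_of_lt (by linarith) hy).const_mul _
  have h1 : ∀ i ∈ S, b i * N i ^ (-ρ) =
      ∫ t in Ioi y, (Ioi (N i)).indicator (fun t : ℝ => b i * (ρ * t ^ (-ρ - 1))) t := by
    intro i hi
    have hNi : 0 < N i := hy.trans_le (hS i hi)
    rw [setIntegral_indicator measurableSet_Ioi, inter_eq_right.2 (Ioi_subset_Ioi (hS i hi)),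
      integral_const_mul, integral_const_mul, integral_Ioi_rpow_of_lt (by linarith) hNi]
    have : -ρ - 1 + 1 = -ρ := by ring
    rw [this]
    field_simp
  rw [Finset.sum_congr rfl h1, ← integral_finsetSum]
  swap
  · exact fun i _ => (hint.const_mul _).indicator measurableSet_Ioi
  have hint2 : IntegrableOn (fun t : ℝ => C * ρ * t ^ (-ρ)) (Ioi y) :=
    (integrableOn_Ioi_rpow_of_lt (by linarith) hy).const_mul _
  calc _ ≤ ∫ t in Ioi y, C * ρ * t ^ (-ρ) := by
        refine setIntegral_mono_on (integrable_finsetSum _ fun i _ =>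
          (hint.const_mul _).indicator measurableSet_Ioi) hint2 measurableSet_Ioi fun t ht => ?_
        have ht0 : 0 < t := hy.trans ht
        have h2 : ∑ i ∈ S, (Ioi (N i)).indicator (fun t : ℝ => b i * (ρ * t ^ (-ρ - 1))) t =
            (∑ i ∈ S, if N i < t then b i else 0) * (ρ * t ^ (-ρ - 1)) := by
          rw [Finset.sum_mul]
          refine Finset.sum_congr rfl fun i _ => ?_
          simp only [indicator, mem_Ioi]
          split_ifs <;> simp
        rw [h2]
        have h3 : t ^ (-ρ) = t * t ^ (-ρ - 1) := by
          rw [Real.rpow_sub_one ht0.ne']; field_simp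
        rw [h3]
        have := mul_le_mul_of_nonneg_right (hC.sum_filter_lt_le S ht0.le)
          (show 0 ≤ ρ * t ^ (-ρ - 1) by positivity)
        nlinarith
    _ = _ := by
        rw [integral_const_mul, integral_Ioi_rpow_of_lt (by linarith) hy]
        have h4 : -ρ + 1 = 1 - ρ := by ring
        rw [h4]
        have h5 : ρ - 1 ≠ 0 := by linarith
        have h6 : 1 - ρ ≠ 0 := by linarith
        field_simp
        ring

theorem LinearGrowth.sum_rpow_le_one (hC : LinearGrowth N b C) (hN : ∀ i, 1 ≤ N i) {ρ : ℝ}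
    (hρ : 1 < ρ) (S : Finset ι) : ∑ i ∈ S, b i * N i ^ (-ρ) ≤ C * (ρ / (ρ - 1)) := by
  simpa using hC.sum_rpow_le one_pos hρ (fun i _ => hN i)

theorem LinearGrowth.summable (hC : LinearGrowth N b C) (hN : ∀ i, 1 ≤ N i) (hb : ∀ i, 0 ≤ b i)
    {ρ : ℝ} (hρ : 1 < ρ) : Summable fun i => b i * N i ^ (-ρ) :=
  summable_of_sum_le (fun i => mul_nonneg (hb i) (Real.rpow_nonneg (by linarith [hN i]) _))
    (hC.sum_rpow_le_one hN hρ)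

theorem LinearGrowth.tsum_le (hC : LinearGrowth N b C) (hN : ∀ i, 1 ≤ N i) (hb : ∀ i, 0 ≤ b i)
    {ρ : ℝ} (hρ : 1 < ρ) : ∑' i, b i * N i ^ (-ρ) ≤ C * (ρ / (ρ - 1)) :=
  (hC.summable hN hb hρ).tsum_le_of_sum_le (hC.sum_rpow_le_one hN hρ)

/-- Partial summation: write `log (x / N)` as the integral of `1 / t` over `N < t ≤ x`. -/
theorem LinearGrowth.sum_log_le (hC : LinearGrowth N b C) {x : ℝ} {S : Finset ι}
    (hS0 : ∀ i ∈ S, 0 < N i) (hS : ∀ i ∈ S, N i ≤ x) (hx : 0 ≤ x) :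
    ∑ i ∈ S, b i * Real.log (x / N i) ≤ C * x := by
  have hint : ∀ i ∈ S, IntegrableOn ((Ioi (N i)).indicator (fun t : ℝ => b i * t⁻¹)) (Ioc 0 x) := by
    intro i hi
    rw [IntegrableOn, integrable_indicator_iff measurableSet_Ioi, IntegrableOn,
      Measure.restrict_restrict measurableSet_Ioi]
    refine Integrable.const_mul ?_ _
    have h1 : IntervalIntegrable (fun t : ℝ => t⁻¹) volume (N i) x :=
      intervalIntegral.intervalIntegrable_inv
        (fun t ht => by
          rw [uIcc_of_le (hS i hi)] at ht
          exact ((hS0 i hi).trans_le ht.1).ne') continuousOn_id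
    rw [intervalIntegrable_iff_integrableOn_Ioc_of_le (hS i hi)] at h1
    refine h1.mono_set fun t ht => ⟨ht.1, ht.2.2⟩
  have h1 : ∀ i ∈ S, b i * Real.log (x / N i) =
      ∫ t in Ioc 0 x, (Ioi (N i)).indicator (fun t : ℝ => b i * t⁻¹) t := by
    intro i hi
    have hx0 : 0 < x := (hS0 i hi).trans_le (hS i hi)
    have h2 : Ioc 0 x ∩ Ioi (N i) = Ioc (N i) x := by
      ext t
      simp only [mem_inter_iff, mem_Ioc, mem_Ioi]
      exact ⟨fun h3 => ⟨h3.2, h3.1.2⟩, fun h3 => ⟨⟨(hS0 i hi).trans h3.1, h3.2⟩, h3.1⟩⟩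
    rw [setIntegral_indicator measurableSet_Ioi, h2, integral_const_mul,
      ← intervalIntegral.integral_of_le (hS i hi), integral_inv_of_pos (hS0 i hi) hx0]
  rw [Finset.sum_congr rfl h1, ← integral_finsetSum _ hint]
  have hconst : IntegrableOn (fun _ : ℝ => C) (Ioc 0 x) := by
    simp
  calc _ ≤ ∫ t in Ioc 0 x, C := by
        refine setIntegral_mono_on (integrable_finsetSum _ hint) hconst measurableSet_Ioc
          fun t ht => ?_
        have ht0 : 0 < t := ht.1
        have h2 : ∑ i ∈ S, (Ioi (N i)).indicator (fun t : ℝ => b i * t⁻¹) t =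
            (∑ i ∈ S, if N i < t then b i else 0) * t⁻¹ := by
          rw [Finset.sum_mul]
          refine Finset.sum_congr rfl fun i _ => ?_
          simp only [indicator, mem_Ioi]
          split_ifs <;> simp
        rw [h2, ← div_eq_mul_inv, div_le_iff₀ ht0]
        exact hC.sum_filter_lt_le S ht0.le
    _ = _ := by
        simp [hx, mul_comm]

end family

/-! ### Two Mellin transforms -/

theorem norm_ofReal_cpow_add_mul_I {y : ℝ} (hy : 0 < y) (σ t : ℝ) :
    ‖(y : ℂ) ^ (-(σ + t * Complex.I))‖ = y ^ (-σ) := by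
  rw [Complex.norm_cpow_eq_rpow_re_of_pos hy]
  simp

/-- On the imaginary axis `s = i t` this Mellin transform is twice the Cauchy weight
`1 / (1 + t²)`. -/
theorem hasMellin_min_inv {s : ℂ} (hs1 : -1 < s.re) (hs2 : s.re < 1) :
    HasMellin (fun y : ℝ => ((min y y⁻¹ : ℝ) : ℂ)) s (1 / (s + 1) + 1 / (1 - s)) := by
  have hsplit : Ioi (0 : ℝ) = Ioc 0 1 ∪ Ioi 1 := (Ioc_union_Ioi_eq_Ioi zero_le_one).symm
  have e1 : ∀ y ∈ Ioc (0 : ℝ) 1, (y : ℂ) ^ (s - 1) • ((min y y⁻¹ : ℝ) : ℂ) = (y : ℂ) ^ s := by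
    intro y hy
    have h1 : min y y⁻¹ = y := min_eq_left (hy.2.trans ((one_le_inv₀ hy.1).2 hy.2))
    have hy0 : (y : ℂ) ≠ 0 := by exact_mod_cast hy.1.ne'
    rw [h1, smul_eq_mul, Complex.cpow_sub _ _ hy0, Complex.cpow_one]
    field_simp
  have e2 : ∀ y ∈ Ioi (1 : ℝ), (y : ℂ) ^ (s - 1) • ((min y y⁻¹ : ℝ) : ℂ) = (y : ℂ) ^ (s - 2) := by
    intro y hy
    have hy1 : (1 : ℝ) < y := hy
    have h1 : min y y⁻¹ = y⁻¹ := min_eq_right ((inv_le_one_of_one_le₀ hy1.le).trans hy1.le)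
    have hy0 : (y : ℂ) ≠ 0 := by exact_mod_cast (by linarith : y ≠ 0)
    rw [h1, smul_eq_mul, show s - 2 = s - 1 - 1 by ring, Complex.cpow_sub (s - 1) 1 hy0,
      Complex.cpow_one]
    push_cast
    rfl
  have i1 : IntegrableOn (fun y : ℝ => (y : ℂ) ^ s) (Ioc 0 1) := by
    rw [← intervalIntegrable_iff_integrableOn_Ioc_of_le zero_le_one]
    exact intervalIntegral.intervalIntegrable_cpow' hs1
  have i2 : IntegrableOn (fun y : ℝ => (y : ℂ) ^ (s - 2)) (Ioi 1) :=
    integrableOn_Ioi_cpow_of_lt (by simp; linarith) one_pos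
  have j1 := i1.congr_fun (fun y hy => (e1 y hy).symm) measurableSet_Ioc
  have j2 := i2.congr_fun (fun y hy => (e2 y hy).symm) measurableSet_Ioi
  refine ⟨by rw [MellinConvergent, hsplit]; exact j1.union j2, ?_⟩
  rw [mellin, hsplit, setIntegral_union Ioc_disjoint_Ioi_same measurableSet_Ioi j1 j2,
    setIntegral_congr_fun measurableSet_Ioc e1, setIntegral_congr_fun measurableSet_Ioi e2,
    ← intervalIntegral.integral_of_le zero_le_one, integral_cpow (Or.inl hs1),
    integral_Ioi_cpow_of_lt (by simp; linarith) one_pos]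
  have h1 : s + 1 ≠ 0 := by
    intro h0; have := congrArg Complex.re h0; simp at this; linarith
  have h2 : 1 - s ≠ 0 := by
    intro h0; have := congrArg Complex.re h0; simp at this; linarith
  have h3 : s - 2 + 1 = -(1 - s) := by ring
  rw [h3]
  rw [Complex.ofReal_one, Complex.one_cpow, neg_div_neg_eq]
  simp [Complex.zero_cpow h1]

/-- The Fourier transform of the Cauchy weight. -/
theorem integral_cpow_mul_inv_one_add_sq {y : ℝ} (hy : 0 < y) :
    ∫ t : ℝ, (y : ℂ) ^ (-(t * Complex.I)) * ((1 + t ^ 2)⁻¹ : ℝ) = (Real.pi * min y y⁻¹ : ℝ) := by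
  have hm : ∀ t : ℝ, mellin (fun y : ℝ => ((min y y⁻¹ : ℝ) : ℂ)) ((0 : ℝ) + t * Complex.I) =
      2 * ((1 + t ^ 2)⁻¹ : ℝ) := by
    intro t
    rw [(hasMellin_min_inv (s := ((0 : ℝ) + t * Complex.I)) (by simp) (by simp)).2]
    have h1 : (t * Complex.I + 1 : ℂ) ≠ 0 := by
      intro h0; have := congrArg Complex.re h0; simp at this
    have h2 : (1 - t * Complex.I : ℂ) ≠ 0 := by
      intro h0; have := congrArg Complex.re h0; simp at this
    have h3 : (1 + (t : ℂ) ^ 2) ≠ 0 := by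
      have : (0 : ℝ) < 1 + t ^ 2 := by positivity
      exact_mod_cast this.ne'
    push_cast
    rw [zero_add]
    field_simp
    ring_nf
    rw [Complex.I_sq]
    ring
  have hc : ContinuousAt (fun y : ℝ => ((min y y⁻¹ : ℝ) : ℂ)) y := by
    have : ContinuousAt (fun y : ℝ => y⁻¹) y := continuousAt_inv₀ hy.ne'
    fun_prop
  have hv : Complex.VerticalIntegrable (mellin fun y : ℝ => ((min y y⁻¹ : ℝ) : ℂ)) 0 := by
    have h1 : Integrable fun t : ℝ => (2 * ((1 + t ^ 2)⁻¹ : ℝ) : ℂ) :=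
      (integrable_inv_one_add_sq.ofReal).const_mul _
    exact h1.congr (ae_of_all _ fun t => (hm t).symm)
  have := mellinInv_mellin_eq 0 _ hy
    (hasMellin_min_inv (s := (0 : ℝ)) (by simp) (by simp)).1 hv hc
  rw [mellinInv] at this
  simp_rw [hm] at this
  have h4 : (∫ t : ℝ, (y : ℂ) ^ (-(((0 : ℝ) : ℂ) + t * Complex.I)) • (2 * ((1 + t ^ 2)⁻¹ : ℝ) : ℂ)) =
      2 * ∫ t : ℝ, (y : ℂ) ^ (-(t * Complex.I)) * ((1 + t ^ 2)⁻¹ : ℝ) := by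
    rw [← integral_const_mul]
    congr 1
    ext t
    simp only [Complex.ofReal_zero, zero_add, smul_eq_mul]
    ring
  rw [h4] at this
  have hpi : (Real.pi : ℂ) ≠ 0 := by exact_mod_cast Real.pi_ne_zero
  rw [Complex.real_smul] at this
  push_cast at this ⊢
  rw [← this]
  generalize (∫ t : ℝ, (y : ℂ) ^ (-(t * Complex.I)) * (1 + (t : ℂ) ^ 2)⁻¹) = J
  field_simp

/-- The smoothing kernel `(1 - y)²` on `[0, 1]`, extended by zero. -/
noncomputable def ker (y : ℝ) : ℝ := max (1 - y) 0 ^ 2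

theorem ker_nonneg (y : ℝ) : 0 ≤ ker y := by unfold ker; positivity

theorem ker_eq_zero {y : ℝ} (hy : 1 ≤ y) : ker y = 0 := by
  rw [ker, max_eq_right (by linarith)]; norm_num

theorem ker_le_one {y : ℝ} (hy : 0 ≤ y) : ker y ≤ 1 := by
  unfold ker
  have h1 : max (1 - y) 0 ≤ 1 := max_le (by linarith) zero_le_one
  exact pow_le_one₀ (le_max_right _ _) h1

theorem continuous_ker : Continuous ker := by unfold ker; fun_prop

/-- The kernel is quadratic at its endpoint, so that its Mellin transform decays like `|s|⁻³`. -/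
theorem hasMellin_ker {s : ℂ} (hs : 0 < s.re) :
    HasMellin (fun y : ℝ => (ker y : ℂ)) s (2 / (s * (s + 1) * (s + 2))) := by
  have h0 := hasMellin_one_Ioc hs
  have h1 := hasMellin_cpow_Ioc 1 (s := s) (by simp; linarith)
  have h2 := hasMellin_cpow_Ioc 2 (s := s) (by simp; linarith)
  have h3 := hasMellin_const_smul h1.1 (2 : ℂ)
  have h4 := hasMellin_sub h0.1 h3.1
  have h5 := hasMellin_add h4.1 h2.1
  have heq : ∀ y ∈ Ioi (0 : ℝ), (((Ioc (0 : ℝ) 1).indicator (fun _ => (1 : ℂ)) y -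
      (2 : ℂ) • (Ioc (0 : ℝ) 1).indicator (fun t : ℝ => (t : ℂ) ^ (1 : ℂ)) y) +
      (Ioc (0 : ℝ) 1).indicator (fun t : ℝ => (t : ℂ) ^ (2 : ℂ)) y) = (ker y : ℂ) := by
    intro y hy
    by_cases hy1 : y ≤ 1
    · have hm : y ∈ Ioc (0 : ℝ) 1 := ⟨hy, hy1⟩
      simp only [indicator_of_mem hm, ker, max_eq_left (sub_nonneg.2 hy1), Complex.cpow_one,
        smul_eq_mul, Complex.cpow_ofNat]
      push_cast
      ring
    · have hm : y ∉ Ioc (0 : ℝ) 1 := fun h6 => hy1 h6.2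
      simp [indicator_of_notMem hm, ker_eq_zero (not_le.1 hy1).le]
  refine ⟨h5.1.congr_fun (fun y hy => by simp only [heq y hy]) measurableSet_Ioi, ?_⟩
  have h6 : mellin (fun y : ℝ => (ker y : ℂ)) s = 1 / s - (2 : ℂ) • (1 / (s + 1)) + 1 / (s + 2) := by
    rw [← h0.2, ← h1.2, ← h2.2, ← h3.2, ← h4.2, ← h5.2]
    exact setIntegral_congr_fun measurableSet_Ioi fun y hy => by simp only [heq y hy]
  rw [h6]
  have g0 : s ≠ 0 := by rintro rfl; simp at hs
  have g1 : s + 1 ≠ 0 := by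
    intro h0; have := congrArg Complex.re h0; simp at this; linarith
  have g2 : s + 2 ≠ 0 := by
    intro h0; have := congrArg Complex.re h0; simp at this; linarith
  rw [smul_eq_mul]
  field_simp
  ring

theorem one_add_sq_le_norm_sq {σ t a : ℝ} (hσ : 1 ≤ σ) (ha : 0 ≤ a) :
    1 + t ^ 2 ≤ ‖(σ + t * Complex.I + a : ℂ)‖ ^ 2 := by
  rw [← Complex.normSq_eq_norm_sq, Complex.normSq_apply]
  simp
  nlinarith

theorem norm_mellin_ker_le {σ t : ℝ} (hσ : 1 ≤ σ) :
    ‖2 / ((σ + t * Complex.I : ℂ) * ((σ + t * Complex.I) + 1) * ((σ + t * Complex.I) + 2))‖ ≤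
      2 * (Real.sqrt (1 + t ^ 2) ^ 3)⁻¹ := by
  have h0 := one_add_sq_le_norm_sq (t := t) hσ le_rfl
  have h1 := one_add_sq_le_norm_sq (t := t) hσ zero_le_one
  have h2 := one_add_sq_le_norm_sq (t := t) hσ zero_le_two
  have hp : 0 < Real.sqrt (1 + t ^ 2) := Real.sqrt_pos.2 (by positivity)
  have k : ∀ z : ℂ, 1 + t ^ 2 ≤ ‖z‖ ^ 2 → Real.sqrt (1 + t ^ 2) ≤ ‖z‖ := fun z hz =>
    Real.sqrt_le_iff.2 ⟨norm_nonneg _, hz⟩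
  simp only [Complex.ofReal_zero, add_zero, Complex.ofReal_one, Complex.ofReal_ofNat] at h0 h1 h2
  rw [norm_div, norm_mul, norm_mul, Complex.norm_ofNat, div_eq_mul_inv]
  have : Real.sqrt (1 + t ^ 2) ^ 3 ≤ ‖(σ + t * Complex.I : ℂ)‖ * ‖((σ + t * Complex.I) + 1 : ℂ)‖ *
      ‖((σ + t * Complex.I) + 2 : ℂ)‖ := by
    rw [pow_succ, sq]
    gcongr
    exacts [k _ h0, k _ h1, k _ h2]
  gcongr

theorem inv_sqrt_cube_le (t : ℝ) : (Real.sqrt (1 + t ^ 2) ^ 3)⁻¹ ≤ (1 + t ^ 2)⁻¹ := by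
  have h1 : (1 : ℝ) ≤ Real.sqrt (1 + t ^ 2) := Real.one_le_sqrt.2 (by nlinarith)
  have h2 : Real.sqrt (1 + t ^ 2) ^ 2 = 1 + t ^ 2 := Real.sq_sqrt (by positivity)
  have h3 : (Real.sqrt (1 + t ^ 2) ^ 3)⁻¹ ≤ (Real.sqrt (1 + t ^ 2) ^ 2)⁻¹ :=
    inv_anti₀ (by positivity) (pow_le_pow_right₀ h1 (by norm_num))
  rwa [h2] at h3

theorem verticalIntegrable_mellin_ker {σ : ℝ} (hσ : 1 ≤ σ) :
    Integrable fun t : ℝ => (2 / ((σ + t * Complex.I : ℂ) * ((σ + t * Complex.I) + 1) *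
      ((σ + t * Complex.I) + 2))) := by
  refine (integrable_inv_one_add_sq.const_mul 2).mono' ?_ (ae_of_all _ fun t =>
    (norm_mellin_ker_le hσ).trans ?_)
  · exact Measurable.aestronglyMeasurable (by fun_prop)
  · have := inv_sqrt_cube_le t
    simpa using by linarith

/-- Perron's formula for the kernel `ker`. -/
theorem ker_eq_integral {y σ : ℝ} (hy : 0 < y) (hσ : 1 ≤ σ) :
    (ker y : ℂ) = 1 / (2 * Real.pi) * ∫ t : ℝ, (y : ℂ) ^ (-(σ + t * Complex.I)) *
      (2 / ((σ + t * Complex.I : ℂ) * ((σ + t * Complex.I) + 1) * ((σ + t * Complex.I) + 2))) := by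
  have hm : ∀ t : ℝ, mellin (fun y : ℝ => (ker y : ℂ)) (σ + t * Complex.I) =
      (2 / ((σ + t * Complex.I : ℂ) * ((σ + t * Complex.I) + 1) * ((σ + t * Complex.I) + 2))) :=
    fun t => (hasMellin_ker (by simp; linarith)).2
  have := mellinInv_mellin_eq σ _ hy (hasMellin_ker (s := (σ : ℂ)) (by simp; linarith)).1
    ((verticalIntegrable_mellin_ker hσ).congr (ae_of_all _ fun t => (hm t).symm))
    (Complex.continuous_ofReal.comp continuous_ker).continuousAt
  rw [← this, mellinInv]
  simp_rw [hm]
  rw [Complex.real_smul]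
  push_cast
  rfl

/-! ### Dirichlet series: mean squares and Perron's formula -/

section dser

variable {ι κ : Type*} {N b : ι → ℝ} {C : ℝ}

/-- The generalized Dirichlet series `∑ a i * (N i) ^ (-s)`. -/
noncomputable def dser (N : ι → ℝ) (a : ι → ℂ) (s : ℂ) : ℂ := ∑' i, a i * (N i : ℂ) ^ (-s)

theorem norm_dser_term (hN : ∀ i, 1 ≤ N i) (a : ι → ℂ) (σ t : ℝ) (i : ι) :
    ‖a i * (N i : ℂ) ^ (-(σ + t * Complex.I))‖ = ‖a i‖ * N i ^ (-σ) := by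
  rw [norm_mul, norm_ofReal_cpow_add_mul_I (by linarith [hN i])]

theorem continuous_dser (hN : ∀ i, 1 ≤ N i) {a : ι → ℂ} {σ : ℝ}
    (ha : Summable fun i => ‖a i‖ * N i ^ (-σ)) :
    Continuous fun t : ℝ => dser N a (σ + t * Complex.I) := by
  refine continuous_tsum (fun i => ?_) ha fun i t => (norm_dser_term hN a σ t i).le
  refine continuous_const.mul (Continuous.const_cpow (by fun_prop) (Or.inl ?_))
  have := hN i
  exact_mod_cast (by linarith : N i ≠ 0)

theorem summable_dser (hN : ∀ i, 1 ≤ N i) {a : ι → ℂ} {σ : ℝ}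
    (ha : Summable fun i => ‖a i‖ * N i ^ (-σ)) (t : ℝ) :
    Summable fun i => a i * (N i : ℂ) ^ (-(σ + t * Complex.I)) :=
  Summable.of_norm (ha.congr fun i => (norm_dser_term hN a σ t i).symm)

theorem norm_dser_le (hN : ∀ i, 1 ≤ N i) {a : ι → ℂ} {σ : ℝ}
    (ha : Summable fun i => ‖a i‖ * N i ^ (-σ)) (t : ℝ) :
    ‖dser N a (σ + t * Complex.I)‖ ≤ ∑' i, ‖a i‖ * N i ^ (-σ) := by
  refine (norm_tsum_le_tsum_norm ?_).trans_eq (tsum_congr fun i => norm_dser_term hN a σ t i)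
  exact ha.congr fun i => (norm_dser_term hN a σ t i).symm

theorem norm_dser_le_of_linearGrowth (hC : LinearGrowth N b C) (hN : ∀ i, 1 ≤ N i) {a : ι → ℂ}
    (hab : ∀ i, ‖a i‖ ≤ b i) {σ : ℝ} (hσ : 1 < σ) (t : ℝ) :
    ‖dser N a (σ + t * Complex.I)‖ ≤ C * (σ / (σ - 1)) := by
  have hb : ∀ i, 0 ≤ b i := fun i => (norm_nonneg _).trans (hab i)
  have h1 : ∀ i, ‖a i‖ * N i ^ (-σ) ≤ b i * N i ^ (-σ) := fun i =>
    mul_le_mul_of_nonneg_right (hab i) (Real.rpow_nonneg (by linarith [hN i]) _)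
  have h2 : Summable fun i => ‖a i‖ * N i ^ (-σ) :=
    (hC.summable hN hb hσ).of_nonneg_of_le
      (fun i => mul_nonneg (norm_nonneg _) (Real.rpow_nonneg (by linarith [hN i]) _)) h1
  exact (norm_dser_le hN h2 t).trans
    ((h2.tsum_le_tsum h1 (hC.summable hN hb hσ)).trans (hC.tsum_le hN hb hσ))

theorem integrable_sq_dser (hN : ∀ i, 1 ≤ N i) {a : ι → ℂ} {σ : ℝ}
    (ha : Summable fun i => ‖a i‖ * N i ^ (-σ)) :
    Integrable fun t : ℝ => ‖dser N a (σ + t * Complex.I)‖ ^ 2 * (1 + t ^ 2)⁻¹ := by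
  refine integrable_inv_one_add_sq.bdd_mul (c := (∑' i, ‖a i‖ * N i ^ (-σ)) ^ 2) ?_ ?_
  · exact ((continuous_dser hN ha).norm.pow 2).aestronglyMeasurable
  · refine ae_of_all _ fun t => ?_
    rw [norm_pow, norm_norm]
    exact pow_le_pow_left₀ (norm_nonneg _) (norm_dser_le hN ha t) 2

/-- The inner sum of the double sum bounding a mean square. -/
theorem LinearGrowth.sum_mul_min_le (hC : LinearGrowth N b C) (hN : ∀ i, 1 ≤ N i)
    (hC0 : 0 ≤ C) (hb : ∀ i, 0 ≤ b i) {σ : ℝ} (hσ : 1 < σ) {y : ℝ} (hy : 1 ≤ y) (T : Finset ι) :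
    ∑ j ∈ T, b j * N j ^ (-σ) * min (N j / y) (y / N j) ≤ 3 * C := by
  classical
  have hy0 : 0 < y := by linarith
  rw [← Finset.sum_filter_add_sum_filter_not T (fun j => N j ≤ y)]
  have h1 : ∑ j ∈ T with N j ≤ y, b j * N j ^ (-σ) * min (N j / y) (y / N j) ≤ C := by
    calc _ ≤ ∑ j ∈ T with N j ≤ y, b j * y⁻¹ := by
          refine Finset.sum_le_sum fun j _ => ?_
          have hNj : 0 < N j := by linarith [hN j]
          rw [mul_assoc]
          refine mul_le_mul_of_nonneg_left ?_ (hb j)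
          have h2 : N j ^ (-σ) ≤ N j ^ (-1 : ℝ) :=
            Real.rpow_le_rpow_of_exponent_le (hN j) (by linarith)
          rw [Real.rpow_neg_one] at h2
          calc N j ^ (-σ) * min (N j / y) (y / N j) ≤ (N j)⁻¹ * (N j / y) := by
                gcongr
                exact min_le_left _ _
            _ = y⁻¹ := by field_simp
      _ = (∑ j ∈ T with N j ≤ y, b j) * y⁻¹ := by rw [Finset.sum_mul]
      _ ≤ C * y * y⁻¹ := by
          gcongr
          exact hC _ _ hy0.le fun i hi => (Finset.mem_filter.1 hi).2
      _ = C := by field_simp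
  have h2 : ∑ j ∈ T with ¬ N j ≤ y, b j * N j ^ (-σ) * min (N j / y) (y / N j) ≤ 2 * C := by
    calc _ ≤ ∑ j ∈ T with ¬ N j ≤ y, b j * N j ^ (-(σ + 1)) * y := by
          refine Finset.sum_le_sum fun j _ => ?_
          have hNj : 0 < N j := by linarith [hN j]
          rw [mul_assoc, mul_assoc]
          refine mul_le_mul_of_nonneg_left ?_ (hb j)
          rw [neg_add, Real.rpow_add hNj, Real.rpow_neg_one, mul_assoc]
          refine mul_le_mul_of_nonneg_left ((min_le_right _ _).trans_eq ?_)
            (Real.rpow_nonneg hNj.le _)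
          field_simp
      _ = (∑ j ∈ T with ¬ N j ≤ y, b j * N j ^ (-(σ + 1))) * y := by rw [Finset.sum_mul]
      _ ≤ C * ((σ + 1) / (σ + 1 - 1)) * y ^ (1 - (σ + 1)) * y := by
          gcongr
          exact hC.sum_rpow_le hy0 (by linarith) fun i hi =>
            (not_le.1 (Finset.mem_filter.1 hi).2).le
      _ ≤ C * 2 * y ^ (-1 : ℝ) * y := by
          gcongr ?_ * ?_ * _
          · refine mul_le_mul_of_nonneg_left ?_ hC0
            rw [div_le_iff₀ (by linarith)]
            linarith
          · exact Real.rpow_le_rpow_of_exponent_le hy (by linarith)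
      _ = 2 * C := by
          rw [Real.rpow_neg_one]
          field_simp
  linarith

/-- Mean square bound for a Dirichlet series on a vertical line. Expanding the square, the Fourier
transform of the Cauchy weight makes the contribution of a pair of terms decay with their ratio, so
that only the linear growth of the majorant is needed. -/
theorem integral_sq_dser_le [Countable ι] (hC : LinearGrowth N b C) (hN : ∀ i, 1 ≤ N i)
    (hC0 : 0 ≤ C) (hb : ∀ i, 0 ≤ b i) {σ : ℝ} (hσ : 1 < σ) {a : ι → ℂ} {η : ι → ℝ}
    (hη : ∀ i, 0 ≤ η i) (ha : ∀ i, ‖a i‖ ≤ η i * b i)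
    (has : Summable fun i => ‖a i‖ * N i ^ (-σ))
    (hηs : Summable fun i => η i ^ 2 * (b i * N i ^ (-σ))) :
    ∫ t : ℝ, ‖dser N a (σ + t * Complex.I)‖ ^ 2 * (1 + t ^ 2)⁻¹ ≤
      3 * Real.pi * C * ∑' i, η i ^ 2 * (b i * N i ^ (-σ)) := by
  have hN0 : ∀ i, 0 < N i := fun i => by linarith [hN i]
  set c : ι → ℝ → ℂ := fun i t => a i * (N i : ℂ) ^ (-(σ + t * Complex.I)) with hc
  set F : ι × ι → ℝ → ℂ := fun z t =>
    (c z.1 t * starRingEnd ℂ (c z.2 t)) * ((1 + t ^ 2)⁻¹ : ℝ) with hF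
  set w : ι → ℝ := fun i => ‖a i‖ * N i ^ (-σ) with hw
  have hw0 : ∀ i, 0 ≤ w i := fun i => mul_nonneg (norm_nonneg _) (Real.rpow_nonneg (hN0 i).le _)
  have hcn : ∀ i t, ‖c i t‖ = w i := fun i t => norm_dser_term hN a σ t i
  have hFn : ∀ z t, ‖F z t‖ = w z.1 * w z.2 * (1 + t ^ 2)⁻¹ := by
    intro z t
    have : (0 : ℝ) ≤ (1 + t ^ 2)⁻¹ := by positivity
    simp only [hF]
    rw [norm_mul, norm_mul, RCLike.norm_conj, hcn, hcn, Complex.norm_real,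
      Real.norm_of_nonneg this]
  have hcc : ∀ i, Continuous (c i) := fun i => continuous_const.mul
    (Continuous.const_cpow (by fun_prop) (Or.inl (by exact_mod_cast (hN0 i).ne')))
  have hFint : ∀ z, Integrable (F z) := by
    intro z
    refine (integrable_inv_one_add_sq.const_mul (w z.1 * w z.2)).mono' ?_
      (ae_of_all _ fun t => (hFn z t).le)
    refine Continuous.aestronglyMeasurable ?_
    refine ((hcc _).mul (Complex.continuous_conj.comp (hcc _))).mul ?_
    exact Complex.continuous_ofReal.comp
      (Continuous.inv₀ (by fun_prop) fun t => by positivity)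
  have hww : Summable fun z : ι × ι => w z.1 * w z.2 :=
    has.mul_of_nonneg has hw0 hw0
  have hFs : Summable fun z => ∫ t, ‖F z t‖ := by
    simp_rw [hFn, integral_const_mul]
    exact hww.mul_right _
  have hsum := hasSum_integral_of_summable_integral_norm hFint hFs
  -- the sum of the terms is the square of the Dirichlet series
  have hsq : ∀ t : ℝ, ∑' z, F z t =
      ((‖dser N a (σ + t * Complex.I)‖ ^ 2 * (1 + t ^ 2)⁻¹ : ℝ) : ℂ) := by
    intro t
    have s1 : Summable fun i => ‖c i t‖ := has.congr fun i => (hcn i t).symm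
    have s2 : Summable fun i => ‖starRingEnd ℂ (c i t)‖ := by simpa using s1
    simp only [hF]
    rw [tsum_mul_right, ← tsum_mul_tsum_of_summable_norm s1 s2, ← Complex.conj_tsum,
      Complex.mul_conj, Complex.normSq_eq_norm_sq]
    push_cast
    rfl
  -- the diagonalized terms
  have hint : ∀ z : ι × ι, ‖∫ t, F z t‖ =
      Real.pi * (w z.1 * w z.2 * min (N z.2 / N z.1) (N z.1 / N z.2)) := by
    rintro ⟨i, j⟩
    have h1 : ∀ t : ℝ, F (i, j) t = (a i * starRingEnd ℂ (a j) * ((N i ^ (-σ) * N j ^ (-σ) : ℝ) : ℂ)) *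
        (((N i / N j : ℝ) : ℂ) ^ (-(t * Complex.I)) * ((1 + t ^ 2)⁻¹ : ℝ)) := by
      intro t
      have hi0 : (N i : ℂ) ≠ 0 := by exact_mod_cast (hN0 i).ne'
      have hj0 : (N j : ℂ) ≠ 0 := by exact_mod_cast (hN0 j).ne'
      have e1 : starRingEnd ℂ ((N j : ℂ) ^ (-(σ + t * Complex.I))) =
          ((N j ^ (-σ) : ℝ) : ℂ) * (N j : ℂ) ^ (t * Complex.I) := by
        have e0 := Complex.cpow_conj (N j : ℂ) (-(σ + t * Complex.I))
          (by rw [Complex.arg_ofReal_of_nonneg (hN0 j).le]; exact Real.pi_pos.ne)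
        rw [Complex.conj_ofReal] at e0
        rw [← e0]
        simp only [map_neg, map_add, Complex.conj_ofReal, map_mul, Complex.conj_I]
        rw [show -((σ : ℂ) + t * -Complex.I) = -σ + t * Complex.I by ring, Complex.cpow_add _ _ hj0,
          Complex.ofReal_cpow (hN0 j).le]
        push_cast
        rfl
      have e2 : ((N i / N j : ℝ) : ℂ) ^ (-(t * Complex.I)) =
          (N i : ℂ) ^ (-(t * Complex.I)) * (N j : ℂ) ^ (t * Complex.I) := by
        rw [div_eq_mul_inv, Complex.ofReal_mul, Complex.mul_cpow_ofReal_nonneg (hN0 i).le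
          (inv_nonneg.2 (hN0 j).le), Complex.ofReal_inv, Complex.inv_cpow, Complex.cpow_neg _ (t * Complex.I),
          Complex.cpow_neg _ (t * Complex.I), inv_inv]
        rw [Complex.arg_ofReal_of_nonneg (hN0 j).le]; exact Real.pi_pos.ne
      simp only [hF, hc]
      rw [map_mul, e1, e2, neg_add, Complex.cpow_add _ _ hi0]
      push_cast
      rw [Complex.ofReal_cpow (hN0 i).le]
      push_cast
      ring
    simp_rw [h1]
    rw [integral_const_mul, integral_cpow_mul_inv_one_add_sq (div_pos (hN0 i) (hN0 j))]
    have h2 : 0 ≤ N i ^ (-σ) * N j ^ (-σ) :=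
      mul_nonneg (Real.rpow_nonneg (hN0 i).le _) (Real.rpow_nonneg (hN0 j).le _)
    have h3 : 0 ≤ Real.pi * min (N i / N j) (N i / N j)⁻¹ :=
      mul_nonneg Real.pi_pos.le (le_min (div_pos (hN0 i) (hN0 j)).le
        (inv_nonneg.2 (div_pos (hN0 i) (hN0 j)).le))
    rw [norm_mul, norm_mul, norm_mul, RCLike.norm_conj, Complex.norm_real, Complex.norm_real,
      Real.norm_of_nonneg h2, Real.norm_of_nonneg h3, inv_div, min_comm (N j / N i)]
    simp only [hw]
    ring
  have hreal : ((∫ t : ℝ, ‖dser N a (σ + t * Complex.I)‖ ^ 2 * (1 + t ^ 2)⁻¹ : ℝ) : ℂ) =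
      ∑' z, ∫ t, F z t := by
    rw [hsum.tsum_eq]
    exact (integral_ofReal (𝕜 := ℂ)).symm.trans
      (integral_congr_ae (ae_of_all _ fun t => (hsq t).symm))
  have hnn : 0 ≤ ∫ t : ℝ, ‖dser N a (σ + t * Complex.I)‖ ^ 2 * (1 + t ^ 2)⁻¹ :=
    integral_nonneg fun t => by positivity
  rw [← Real.norm_of_nonneg hnn, ← Complex.norm_real, hreal]
  have hnS : Summable fun z => ‖∫ t, F z t‖ :=
    hFs.of_nonneg_of_le (fun _ => norm_nonneg _) fun z => norm_integral_le_integral_norm _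
  refine (norm_tsum_le_tsum_norm hnS).trans (hnS.tsum_le_of_sum_le fun S => ?_)
  classical
  set T : Finset ι := S.image Prod.fst ∪ S.image Prod.snd with hT
  have hST : S ⊆ T ×ˢ T := fun z hz => Finset.mem_product.2
    ⟨Finset.mem_union_left _ (Finset.mem_image_of_mem _ hz),
      Finset.mem_union_right _ (Finset.mem_image_of_mem _ hz)⟩
  set m : ι → ι → ℝ := fun i j => min (N j / N i) (N i / N j) with hm
  have hm0 : ∀ i j, 0 ≤ m i j := fun i j =>
    le_min (div_pos (hN0 j) (hN0 i)).le (div_pos (hN0 i) (hN0 j)).le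
  have hms : ∀ i j, m i j = m j i := fun i j => min_comm _ _
  set v : ι → ℝ := fun i => b i * N i ^ (-σ) with hv
  have hv0 : ∀ i, 0 ≤ v i := fun i => mul_nonneg (hb i) (Real.rpow_nonneg (hN0 i).le _)
  have hwv : ∀ i, w i ≤ η i * v i := fun i => by
    simp only [hw, hv]
    rw [← mul_assoc]
    exact mul_le_mul_of_nonneg_right (ha i) (Real.rpow_nonneg (hN0 i).le _)
  calc ∑ z ∈ S, ‖∫ t, F z t‖ ≤ ∑ z ∈ T ×ˢ T, ‖∫ t, F z t‖ :=
        Finset.sum_le_sum_of_subset_of_nonneg hST fun _ _ _ => norm_nonneg _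
    _ = ∑ i ∈ T, ∑ j ∈ T, Real.pi * (w i * w j * m i j) := by
        rw [Finset.sum_product]
        exact Finset.sum_congr rfl fun i _ => Finset.sum_congr rfl fun j _ => hint (i, j)
    _ ≤ ∑ i ∈ T, ∑ j ∈ T, (Real.pi / 2 * (η i ^ 2 * v i * (v j * m i j)) +
          Real.pi / 2 * (η j ^ 2 * v j * (v i * m j i))) := by
        refine Finset.sum_le_sum fun i _ => Finset.sum_le_sum fun j _ => ?_
        have h1 : w i * w j ≤ (η i * v i) * (η j * v j) :=
          mul_le_mul (hwv i) (hwv j) (hw0 j) (mul_nonneg (hη i) (hv0 i))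
        have h2 : η i * η j ≤ (η i ^ 2 + η j ^ 2) / 2 := by nlinarith [sq_nonneg (η i - η j)]
        have h3 : w i * w j * m i j ≤ (η i ^ 2 + η j ^ 2) / 2 * (v i * v j) * m i j := by
          refine mul_le_mul_of_nonneg_right (h1.trans ?_) (hm0 i j)
          have := mul_le_mul_of_nonneg_right h2 (mul_nonneg (hv0 i) (hv0 j))
          linarith
        have h4 := mul_le_mul_of_nonneg_left h3 Real.pi_pos.le
        rw [hms j i]
        linarith
    _ = Real.pi * ∑ i ∈ T, η i ^ 2 * v i * ∑ j ∈ T, v j * m i j := by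
        simp_rw [Finset.sum_add_distrib]
        rw [Finset.sum_comm (f := fun i j => Real.pi / 2 * (η j ^ 2 * v j * (v i * m j i))),
          ← two_mul]
        simp_rw [Finset.mul_sum]
        refine Finset.sum_congr rfl fun i _ => Finset.sum_congr rfl fun j _ => ?_
        ring
    _ ≤ Real.pi * ∑ i ∈ T, η i ^ 2 * v i * (3 * C) := by
        refine mul_le_mul_of_nonneg_left (Finset.sum_le_sum fun i _ => ?_) Real.pi_pos.le
        exact mul_le_mul_of_nonneg_left (hC.sum_mul_min_le hN hC0 hb hσ (hN i) T)
          (mul_nonneg (sq_nonneg _) (hv0 i))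
    _ = 3 * Real.pi * C * ∑ i ∈ T, η i ^ 2 * v i := by
        rw [← Finset.sum_mul]; ring
    _ ≤ _ := by
        refine mul_le_mul_of_nonneg_left ?_ (by positivity)
        exact hηs.sum_le_tsum T fun i _ => mul_nonneg (sq_nonneg _) (hv0 i)

/-- Perron's formula for a product of two Dirichlet series, as an upper bound. -/
theorem norm_tsum_ker_le [Countable ι] [Countable κ] {M : κ → ℝ} (hN : ∀ i, 1 ≤ N i)
    (hM : ∀ j, 1 ≤ M j) {a : ι → ℂ} {c : κ → ℂ} {σ x : ℝ} (hσ : 1 ≤ σ) (hx : 0 < x)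
    (ha : Summable fun i => ‖a i‖ * N i ^ (-σ)) (hc : Summable fun j => ‖c j‖ * M j ^ (-σ)) :
    ‖∑' z : ι × κ, a z.1 * c z.2 * (ker (N z.1 * M z.2 / x) : ℂ)‖ ≤
      x ^ σ * ∫ t : ℝ, ‖dser N a (σ + t * Complex.I)‖ * ‖dser M c (σ + t * Complex.I)‖ *
        (Real.sqrt (1 + t ^ 2) ^ 3)⁻¹ := by
  have hN0 : ∀ i, 0 < N i := fun i => by linarith [hN i]
  have hM0 : ∀ i, 0 < M i := fun i => by linarith [hM i]
  set kh : ℝ → ℂ := fun t => (2 / ((σ + t * Complex.I : ℂ) * ((σ + t * Complex.I) + 1) *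
      ((σ + t * Complex.I) + 2))) with hkh
  set F : ι × κ → ℝ → ℂ := fun z t => (a z.1 * (N z.1 : ℂ) ^ (-(σ + t * Complex.I))) *
    (c z.2 * (M z.2 : ℂ) ^ (-(σ + t * Complex.I))) * ((x : ℂ) ^ (σ + t * Complex.I : ℂ) * kh t)
    with hF
  have hxn : ∀ t : ℝ, ‖(x : ℂ) ^ (σ + t * Complex.I : ℂ)‖ = x ^ σ := fun t => by
    rw [Complex.norm_cpow_eq_rpow_re_of_pos hx]; simp
  have hFn : ∀ z t, ‖F z t‖ =
      (‖a z.1‖ * N z.1 ^ (-σ)) * (‖c z.2‖ * M z.2 ^ (-σ)) * (x ^ σ * ‖kh t‖) := by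
    intro z t
    simp only [hF]
    rw [norm_mul, norm_mul, norm_dser_term hN, norm_dser_term hM, norm_mul, hxn]
  have hki : Integrable kh := verticalIntegrable_mellin_ker hσ
  have hcont : ∀ {y : ℝ}, 0 < y → Continuous fun t : ℝ => (y : ℂ) ^ (-(σ + t * Complex.I)) :=
    fun hy => Continuous.const_cpow (by fun_prop) (Or.inl (by exact_mod_cast hy.ne'))
  have hcontx : Continuous fun t : ℝ => (x : ℂ) ^ (σ + t * Complex.I : ℂ) :=
    Continuous.const_cpow (by fun_prop) (Or.inl (by exact_mod_cast hx.ne'))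
  have hFint : ∀ z, Integrable (F z) := by
    intro z
    refine ((hki.norm.const_mul (x ^ σ)).const_mul _).mono' ?_ (ae_of_all _ fun t => (hFn z t).le)
    refine AEStronglyMeasurable.mul ?_ (hcontx.aestronglyMeasurable.mul hki.aestronglyMeasurable)
    exact ((continuous_const.mul (hcont (hN0 _))).mul
      (continuous_const.mul (hcont (hM0 _)))).aestronglyMeasurable
  have hFs : Summable fun z => ∫ t, ‖F z t‖ := by
    simp_rw [hFn, integral_const_mul]
    refine Summable.mul_right _ (Summable.mul_of_nonneg ha hc ?_ ?_)
    · exact fun i => mul_nonneg (norm_nonneg _) (Real.rpow_nonneg (hN0 i).le _)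
    · exact fun i => mul_nonneg (norm_nonneg _) (Real.rpow_nonneg (hM0 i).le _)
  have hsum := hasSum_integral_of_summable_integral_norm hFint hFs
  have hpi0 : (Real.pi : ℂ) ≠ 0 := by exact_mod_cast Real.pi_ne_zero
  have hterm : ∀ z : ι × κ, a z.1 * c z.2 * (ker (N z.1 * M z.2 / x) : ℂ) =
      1 / (2 * Real.pi) * ∫ t, F z t := by
    rintro ⟨i, j⟩
    rw [ker_eq_integral (div_pos (mul_pos (hN0 i) (hM0 j)) hx) hσ, mul_left_comm,
      ← integral_const_mul]
    congr 2
    ext t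
    have e1 : (((N i * M j / x : ℝ)) : ℂ) ^ (-(σ + t * Complex.I)) =
        (N i : ℂ) ^ (-(σ + t * Complex.I)) * (M j : ℂ) ^ (-(σ + t * Complex.I)) *
          (x : ℂ) ^ (σ + t * Complex.I : ℂ) := by
      rw [div_eq_mul_inv, Complex.ofReal_mul, Complex.mul_cpow_ofReal_nonneg
        (mul_pos (hN0 i) (hM0 j)).le (inv_nonneg.2 hx.le), Complex.ofReal_mul,
        Complex.mul_cpow_ofReal_nonneg (hN0 i).le (hM0 j).le, Complex.ofReal_inv,
        Complex.inv_cpow, Complex.cpow_neg (x : ℂ), inv_inv]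
      rw [Complex.arg_ofReal_of_nonneg hx.le]; exact Real.pi_pos.ne
    simp only [hF, hkh]
    rw [e1]
    ring
  simp_rw [hterm]
  rw [tsum_mul_left, hsum.tsum_eq]
  have hdser : ∀ t : ℝ, ∑' z, F z t = dser N a (σ + t * Complex.I) *
      dser M c (σ + t * Complex.I) * ((x : ℂ) ^ (σ + t * Complex.I : ℂ) * kh t) := by
    intro t
    simp only [hF]
    rw [tsum_mul_right, dser, dser, tsum_mul_tsum_of_summable_norm]
    · exact ha.congr fun i => (norm_dser_term hN a σ t i).symm
    · exact hc.congr fun i => (norm_dser_term hM c σ t i).symm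
  simp_rw [hdser]
  have hbd : ∀ t : ℝ, ‖dser N a (σ + t * Complex.I) *
      dser M c (σ + t * Complex.I) * ((x : ℂ) ^ (σ + t * Complex.I : ℂ) * kh t)‖ ≤
      2 * x ^ σ * (‖dser N a (σ + t * Complex.I)‖ * ‖dser M c (σ + t * Complex.I)‖ *
        (Real.sqrt (1 + t ^ 2) ^ 3)⁻¹) := by
    intro t
    rw [norm_mul, norm_mul, norm_mul, hxn]
    have := mul_le_mul_of_nonneg_left (norm_mellin_ker_le (t := t) hσ)
      (show 0 ≤ ‖dser N a (σ + t * Complex.I)‖ * ‖dser M c (σ + t * Complex.I)‖ * x ^ σ by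
        positivity)
    simp only [hkh]
    linarith
  have hI : Integrable fun t : ℝ => ‖dser N a (σ + t * Complex.I)‖ *
      ‖dser M c (σ + t * Complex.I)‖ * (Real.sqrt (1 + t ^ 2) ^ 3)⁻¹ := by
    refine (integrable_inv_one_add_sq.const_mul ((∑' i, ‖a i‖ * N i ^ (-σ)) *
      ∑' i, ‖c i‖ * M i ^ (-σ))).mono' ?_ (ae_of_all _ fun t => ?_)
    · refine Continuous.aestronglyMeasurable
        (((continuous_dser hN ha).norm.mul (continuous_dser hM hc).norm).mul ?_)
      refine Continuous.inv₀ (by fun_prop) fun t => ?_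
      have : 0 < Real.sqrt (1 + t ^ 2) := Real.sqrt_pos.2 (by positivity)
      positivity
    · rw [Real.norm_of_nonneg (by positivity)]
      have h1 := norm_dser_le hN ha t
      have h2 := norm_dser_le hM hc t
      have h3 := inv_sqrt_cube_le t
      exact mul_le_mul (mul_le_mul h1 h2 (norm_nonneg _) ((norm_nonneg _).trans h1)) h3
        (by positivity) (mul_nonneg ((norm_nonneg _).trans h1) ((norm_nonneg _).trans h2))
  have hle := (norm_integral_le_of_norm_le (hI.const_mul (2 * x ^ σ)) (ae_of_all _ hbd))
  rw [integral_const_mul] at hle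
  have hnn : 0 ≤ ∫ t : ℝ, ‖dser N a (σ + t * Complex.I)‖ *
      ‖dser M c (σ + t * Complex.I)‖ * (Real.sqrt (1 + t ^ 2) ^ 3)⁻¹ :=
    integral_nonneg fun t => by positivity
  have h2pi : ‖(1 / (2 * Real.pi) : ℂ)‖ = 1 / (2 * Real.pi) := by
    rw [norm_div, norm_mul, Complex.norm_real, Real.norm_of_nonneg Real.pi_pos.le]
    simp
  rw [norm_mul, h2pi]
  have hpi : 1 / (2 * Real.pi) ≤ 1 / 2 := by
    have := Real.pi_gt_three
    gcongr
    linarith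
  have hxs : 0 ≤ x ^ σ := Real.rpow_nonneg hx.le _
  calc _ ≤ 1 / 2 * (2 * x ^ σ * ∫ t : ℝ, ‖dser N a (σ + t * Complex.I)‖ *
      ‖dser M c (σ + t * Complex.I)‖ * (Real.sqrt (1 + t ^ 2) ^ 3)⁻¹) := by
        gcongr
    _ = _ := by ring

end dser

end

section

open MeasureTheory

variable {K : Type*} [Field K] [NumberField K]

/-! ### Growth of the number of ideals and of prime ideals -/

/-- The norm of an ideal as a real number. -/
noncomputable abbrev rnorm (u : Ideals K) : ℝ := (norm u : ℝ)

/-- The norm of a prime ideal as a real number. -/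
noncomputable abbrev pnorm (p : Primes K) : ℝ := (norm p.toIdeals : ℝ)

theorem one_le_pnorm (p : Primes K) : 1 ≤ pnorm p := one_le_norm _

theorem rnorm_pos (u : Ideals K) : 0 < rnorm u := by linarith [one_le_norm u]

theorem pnorm_pos (p : Primes K) : 0 < pnorm p := rnorm_pos _

theorem rnorm_toIdeals_mul (p : Primes K) (v : Ideals K) :
    rnorm (p.toIdeals * v) = pnorm p * rnorm v := by
  simp [rnorm, pnorm, idealNorm_mul]

variable (K) in
theorem tendsto_card_idealsLE_div :
    Tendsto (fun x : ℝ => ((idealsLE K x).card : ℝ) / x) atTop (𝓝 (dedekindZeta_residue K)) := by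
  refine (NumberField.Ideal.tendsto_norm_le_div_atTop₀ K).congr fun x => ?_
  congr 2
  rw [idealsLE, ← Set.ncard_eq_toFinset_card _ (finite_ideals_norm_le K x)]
  rfl

theorem idealsLE_eq_empty {x : ℝ} (hx : x < 1) : idealsLE K x = ∅ :=
  Finset.eq_empty_of_forall_notMem fun u hu => by
    have := mem_idealsLE.1 hu
    linarith [one_le_norm u]

theorem idealsLE_subset {x y : ℝ} (hxy : x ≤ y) : idealsLE K x ⊆ idealsLE K y := fun _ hu =>
  mem_idealsLE.2 ((mem_idealsLE.1 hu).trans hxy)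

theorem LinearGrowth.mono {ι : Type*} {N b : ι → ℝ} {C D : ℝ} (hC : LinearGrowth N b C)
    (hCD : C ≤ D) : LinearGrowth N b D := fun S x hx hS =>
  (hC S x hx hS).trans (mul_le_mul_of_nonneg_right hCD hx)

variable (K) in
theorem exists_linearGrowth_ideals :
    ∃ C, LinearGrowth (rnorm (K := K)) (fun _ => 1) C := by
  have h1 := (tendsto_card_idealsLE_div K).eventually_lt_const
    (lt_add_one (dedekindZeta_residue K))
  obtain ⟨x₀, hx₀⟩ := eventually_atTop.1 (h1.and (eventually_gt_atTop 0))
  have hR := dedekindZeta_residue_pos K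
  have key : ∀ x : ℝ, 0 ≤ x → ((idealsLE K x).card : ℝ) ≤
      (dedekindZeta_residue K + 1 + (idealsLE K x₀).card) * x := by
    intro x hx
    rcases lt_or_ge x 1 with hx1 | hx1
    · rw [idealsLE_eq_empty hx1]
      simp only [Finset.card_empty, Nat.cast_zero]
      positivity
    rcases le_total x₀ x with hxx | hxx
    · obtain ⟨h2, h3⟩ := hx₀ x hxx
      rw [div_lt_iff₀ h3] at h2
      have : 0 ≤ ((idealsLE K x₀).card : ℝ) * x := by positivity
      linarith
    · have h2 : ((idealsLE K x).card : ℝ) ≤ (idealsLE K x₀).card := by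
        exact_mod_cast Finset.card_le_card (idealsLE_subset hxx)
      have h3 : ((idealsLE K x₀).card : ℝ) * 1 ≤ (idealsLE K x₀).card * x := by gcongr
      have h4 : 0 ≤ (dedekindZeta_residue K + 1) * x := by positivity
      linarith
  refine ⟨_, fun S x hx hS => le_trans ?_ (key x hx)⟩
  simp only [Finset.sum_const, nsmul_eq_mul, mul_one]
  exact_mod_cast Finset.card_le_card fun u hu => mem_idealsLE.2 (hS u hu)

variable (K) in
theorem exists_linearGrowth_primes :
    ∃ C, LinearGrowth (pnorm (K := K)) (fun p => Real.log (pnorm p)) C := by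
  refine ⟨_, fun S x hx hS => le_trans ?_ (sum_log_norm_primesLE_le (K := K) hx)⟩
  exact Finset.sum_le_sum_of_subset_of_nonneg (fun p hp => mem_primesLE.2 (hS p hp))
    fun p _ _ => log_norm_nonneg _

/-- An upper bound for the failure of `log * g = (g Λ) * g` at the ideals divisible by the square
of a prime, for multiplicative functions `g` with values in the unit disc. -/
noncomputable def defect (u : Ideals K) : ℝ :=
  ∑ p ∈ primeDivs u with 2 ≤ val p u, (val p u + 1 : ℝ) * Real.log (pnorm p)

theorem defect_nonneg (u : Ideals K) : 0 ≤ defect u :=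
  Finset.sum_nonneg fun _ _ => mul_nonneg (by positivity) (log_norm_nonneg _)

theorem card_filter_dvd_le {C : ℝ} (hC : LinearGrowth (rnorm (K := K)) (fun _ => 1) C)
    (S : Finset (Ideals K)) {x : ℝ} (hx : 0 ≤ x) (hS : ∀ u ∈ S, rnorm u ≤ x) (d : Ideals K)
    [DecidablePred fun u : Ideals K => d ∣ u] :
    ((S.filter fun u => d ∣ u).card : ℝ) ≤ C * (x / rnorm d) := by
  classical
  have h1 : (S.filter fun u => d ∣ u) ⊆ (idealsLE K (x / rnorm d)).image fun w => d * w := by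
    intro u hu
    obtain ⟨huS, w, rfl⟩ := Finset.mem_filter.1 hu
    refine Finset.mem_image_of_mem _ (mem_idealsLE.2 ?_)
    rw [le_div_iff₀ (rnorm_pos d), mul_comm]
    have := hS _ huS
    rwa [rnorm, idealNorm_mul, Nat.cast_mul] at this
  have h2 := hC (idealsLE K (x / rnorm d)) _ (div_nonneg hx (rnorm_pos d).le)
    fun i hi => mem_idealsLE.1 hi
  simp only [Finset.sum_const, nsmul_eq_mul, mul_one] at h2
  refine le_trans ?_ h2
  exact_mod_cast (Finset.card_le_card h1).trans Finset.card_image_le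

theorem sum_range_pow_add_two_le {r : ℝ} (hr : 0 ≤ r) (hr2 : r ≤ 1 / 2) (m : ℕ) :
    ∑ k ∈ Finset.range m, r ^ (k + 2) ≤ 2 * r ^ 2 := by
  have h1 : Summable fun k : ℕ => r ^ k := summable_geometric_of_lt_one hr (by linarith)
  have h2 : ∑ k ∈ Finset.range m, r ^ k ≤ 2 := by
    refine (h1.sum_le_tsum _ fun _ _ => pow_nonneg hr _).trans ?_
    rw [tsum_geometric_of_lt_one hr (by linarith), inv_le_comm₀ (by linarith) (by norm_num)]
    linarith
  calc _ = (∑ k ∈ Finset.range m, r ^ k) * r ^ 2 := by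
        rw [Finset.sum_mul]
        exact Finset.sum_congr rfl fun k _ => pow_add _ _ _
    _ ≤ _ := by gcongr

variable (K) in
/-- The powers `p ^ k` with `k ≥ 2` contribute a bounded amount on average, since
`∑ log 𝒩(p) / 𝒩(p)²` is finite. -/
theorem exists_linearGrowth_defect :
    ∃ C, LinearGrowth (rnorm (K := K)) defect C := by
  classical
  obtain ⟨C₁, hC₁⟩ := exists_linearGrowth_ideals K
  obtain ⟨C₂, hC₂⟩ := exists_linearGrowth_primes K
  refine ⟨3 * (|C₁| * (2 * (C₂ * (2 / (2 - 1))))), fun S x hx hS => ?_⟩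
  replace hC₁ := hC₁.mono (le_abs_self C₁)
  set P : Finset (Primes K) := S.biUnion primeDivs with hP
  set m : ℕ := S.sup fun u => (primeDivs u).sup fun p => val p u with hm
  have h1 : ∀ u ∈ S, defect u ≤ 3 * ∑ p ∈ P, ∑ k ∈ Finset.range m,
      if p.toIdeals ^ (k + 2) ∣ u then Real.log (pnorm p) else 0 := by
    intro u hu
    rw [defect, Finset.mul_sum]
    have hsub : (primeDivs u).filter (fun p => 2 ≤ val p u) ⊆ P := fun p hp =>
      Finset.mem_biUnion.2 ⟨u, hu, (Finset.mem_filter.1 hp).1⟩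
    refine le_trans (Finset.sum_le_sum fun p hp => ?_)
      (Finset.sum_le_sum_of_subset_of_nonneg hsub fun p _ _ => mul_nonneg zero_le_three
        (Finset.sum_nonneg fun k _ => ?_))
    · obtain ⟨hpu, hv⟩ := Finset.mem_filter.1 hp
      have hvm : val p u ≤ m :=
        (Finset.le_sup (f := fun p => val p u) hpu).trans
          (Finset.le_sup (f := fun u => (primeDivs u).sup fun p => val p u) hu)
      have h2 : (val p u - 1 : ℕ) * Real.log (pnorm p) ≤ ∑ k ∈ Finset.range m,
          if p.toIdeals ^ (k + 2) ∣ u then Real.log (pnorm p) else 0 := by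
        rw [← Finset.sum_filter, Finset.sum_const, nsmul_eq_mul]
        refine mul_le_mul_of_nonneg_right ?_ (log_norm_nonneg _)
        have : Finset.range (val p u - 1) ⊆
            (Finset.range m).filter fun k => p.toIdeals ^ (k + 2) ∣ u := by
          intro k hk
          rw [Finset.mem_range] at hk
          exact Finset.mem_filter.2 ⟨Finset.mem_range.2 (by omega),
            pow_dvd_iff_le_val.2 (by omega)⟩
        have := Finset.card_le_card this
        rw [Finset.card_range] at this
        exact_mod_cast this
      have h3 : (val p u + 1 : ℝ) ≤ 3 * (val p u - 1 : ℕ) := by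
        exact_mod_cast (by omega : val p u + 1 ≤ 3 * (val p u - 1))
      have h4 := mul_le_mul_of_nonneg_right h3 (log_norm_nonneg p.toIdeals)
      rw [mul_assoc] at h4
      exact h4.trans (mul_le_mul_of_nonneg_left h2 zero_le_three)
    · split_ifs
      · exact log_norm_nonneg _
      · exact le_rfl
  calc ∑ u ∈ S, defect u ≤ ∑ u ∈ S, 3 * ∑ p ∈ P, ∑ k ∈ Finset.range m,
        (if p.toIdeals ^ (k + 2) ∣ u then Real.log (pnorm p) else 0) := Finset.sum_le_sum h1
    _ = 3 * ∑ p ∈ P, ∑ k ∈ Finset.range m,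
          ((S.filter fun u => p.toIdeals ^ (k + 2) ∣ u).card : ℝ) * Real.log (pnorm p) := by
        rw [← Finset.mul_sum, Finset.sum_comm]
        congr 1
        refine Finset.sum_congr rfl fun p _ => ?_
        rw [Finset.sum_comm]
        refine Finset.sum_congr rfl fun k _ => ?_
        rw [← Finset.sum_filter, Finset.sum_const, nsmul_eq_mul]
    _ ≤ 3 * ∑ p ∈ P, ∑ k ∈ Finset.range m,
          (|C₁| * x * (pnorm p)⁻¹ ^ (k + 2)) * Real.log (pnorm p) := by
        refine mul_le_mul_of_nonneg_left (Finset.sum_le_sum fun p _ => Finset.sum_le_sum fun k _ =>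
          mul_le_mul_of_nonneg_right ?_ (log_norm_nonneg _)) zero_le_three
        · refine (card_filter_dvd_le hC₁ S hx hS _).trans_eq ?_
          rw [rnorm, idealNorm_pow]
          push_cast
          rw [inv_pow]
          ring
    _ = 3 * ∑ p ∈ P, |C₁| * x * Real.log (pnorm p) *
          ∑ k ∈ Finset.range m, (pnorm p)⁻¹ ^ (k + 2) := by
        congr 1
        refine Finset.sum_congr rfl fun p _ => ?_
        rw [Finset.mul_sum]
        exact Finset.sum_congr rfl fun k _ => by ring
    _ ≤ 3 * ∑ p ∈ P, |C₁| * x * Real.log (pnorm p) * (2 * (pnorm p)⁻¹ ^ 2) := by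
        refine mul_le_mul_of_nonneg_left (Finset.sum_le_sum fun p _ =>
          mul_le_mul_of_nonneg_left ?_ (mul_nonneg (by positivity) (log_norm_nonneg _)))
          zero_le_three
        · refine sum_range_pow_add_two_le (inv_nonneg.2 (pnorm_pos p).le) ?_ m
          rw [inv_le_comm₀ (pnorm_pos p) (by norm_num)]
          simpa using two_le_norm_toIdeals p
    _ = 3 * (|C₁| * (2 * ∑ p ∈ P, Real.log (pnorm p) * pnorm p ^ (-2 : ℝ))) * x := by
        simp only [Finset.mul_sum, Finset.sum_mul]
        refine Finset.sum_congr rfl fun p _ => ?_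
        rw [Real.rpow_neg (pnorm_pos p).le, Real.rpow_two, inv_pow]
        ring
    _ ≤ _ := by
        gcongr
        exact hC₂.sum_rpow_le_one one_le_pnorm (by norm_num) P

variable (K) in
theorem exists_growthConst : ∃ C : ℝ, 1 ≤ C ∧ LinearGrowth (rnorm (K := K)) (fun _ => 1) C ∧
    LinearGrowth (pnorm (K := K)) (fun p => Real.log (pnorm p)) C ∧
    LinearGrowth (rnorm (K := K)) defect C := by
  obtain ⟨C₁, h1⟩ := exists_linearGrowth_ideals K
  obtain ⟨C₂, h2⟩ := exists_linearGrowth_primes K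
  obtain ⟨C₃, h3⟩ := exists_linearGrowth_defect K
  refine ⟨max 1 (max C₁ (max C₂ C₃)), le_max_left _ _, h1.mono ?_, h2.mono ?_, h3.mono ?_⟩ <;>
  simp

variable (K) in
/-- A constant `≥ 1` bounding the growth of the ideals, of the prime ideals weighted by the
logarithm of the norm, and of `defect`. -/
noncomputable def growthConst : ℝ := (exists_growthConst K).choose

theorem one_le_growthConst : 1 ≤ growthConst K := (exists_growthConst K).choose_spec.1

theorem growthConst_nonneg : 0 ≤ growthConst K := by linarith [one_le_growthConst (K := K)]

theorem linearGrowth_ideals : LinearGrowth (rnorm (K := K)) (fun _ => 1) (growthConst K) :=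
  (exists_growthConst K).choose_spec.2.1

theorem linearGrowth_primes :
    LinearGrowth (pnorm (K := K)) (fun p => Real.log (pnorm p)) (growthConst K) :=
  (exists_growthConst K).choose_spec.2.2.1

theorem linearGrowth_defect : LinearGrowth (rnorm (K := K)) defect (growthConst K) :=
  (exists_growthConst K).choose_spec.2.2.2

/-! ### The logarithmic convolution identity -/

/-- The cofactor `u / p` of a prime divisor `p` of `u`. -/
noncomputable def cofactor (u : Ideals K) (p : Primes K) : Ideals K :=
  open Classical in if hp : p.toIdeals ∣ u then hp.choose else 1

theorem mul_cofactor {u : Ideals K} {p : Primes K} (hp : p ∈ primeDivs u) :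
    p.toIdeals * cofactor u p = u := by
  rw [mem_primeDivs] at hp
  rw [cofactor, dif_pos hp]
  exact hp.choose_spec.symm

/-- Pairs of a prime and an ideal correspond to ideals with a distinguished prime divisor. -/
noncomputable def pairEquiv : Primes K × Ideals K ≃ Σ u : Ideals K, {p // p ∈ primeDivs u} where
  toFun z := ⟨z.1.toIdeals * z.2, z.1, mem_primeDivs.2 (Dvd.intro _ rfl)⟩
  invFun z := (z.2.1, cofactor z.1 z.2.1)
  left_inv z := Prod.ext rfl
    (mul_left_cancel (mul_cofactor (u := z.1.toIdeals * z.2) (mem_primeDivs.2 (Dvd.intro _ rfl))))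
  right_inv := by
    rintro ⟨u, p, hp⟩
    have h1 := mul_cofactor hp
    refine Sigma.ext h1 ?_
    dsimp only
    congr! 1
    rw [h1]

/-- The Dirichlet convolution of a function supported on the primes with a function on ideals. -/
noncomputable def primeConv (a : Primes K → ℂ) (c : Ideals K → ℂ) (u : Ideals K) : ℂ :=
  ∑ p ∈ primeDivs u, a p * c (cofactor u p)

theorem tsum_primeConv {a : Primes K → ℂ} {c F : Ideals K → ℂ}
    (hs : Summable fun z : Primes K × Ideals K => a z.1 * c z.2 * F (z.1.toIdeals * z.2)) :
    Summable (fun u => primeConv a c u * F u) ∧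
    ∑' u, primeConv a c u * F u =
      ∑' z : Primes K × Ideals K, a z.1 * c z.2 * F (z.1.toIdeals * z.2) := by
  have h1 := (pairEquiv (K := K)).symm.summable_iff.2 hs
  have h2 : ∀ u : Ideals K, ∑' p : {p // p ∈ primeDivs u},
      ((fun z : Primes K × Ideals K => a z.1 * c z.2 * F (z.1.toIdeals * z.2)) ∘ pairEquiv.symm)
        ⟨u, p⟩ = primeConv a c u * F u := by
    intro u
    rw [primeConv, Finset.sum_mul, ← Finset.tsum_subtype]
    refine tsum_congr fun p => ?_
    change a p * c (cofactor u p) * F (p.1.toIdeals * cofactor u p) = _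
    rw [mul_cofactor p.2]
  refine ⟨h1.sigma.congr fun u => h2 u, ?_⟩
  rw [← (pairEquiv (K := K)).symm.tsum_eq]
  refine Eq.trans ?_ (h1.tsum_sigma' fun u => Summable.of_finite).symm
  exact tsum_congr fun u => (h2 u).symm

/-- The function `p ↦ g(p) log 𝒩(p)` on primes. -/
noncomputable def primeLog (g : Ideals K → ℂ) (p : Primes K) : ℂ :=
  g p.toIdeals * Real.log (pnorm p)

theorem norm_primeLog_le {g : Ideals K → ℂ} (hg1 : ∀ u, ‖g u‖ ≤ 1) (p : Primes K) :
    ‖primeLog g p‖ ≤ Real.log (pnorm p) := by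
  rw [primeLog, norm_mul, Complex.norm_real, Real.norm_of_nonneg (log_norm_nonneg _)]
  exact mul_le_of_le_one_left (log_norm_nonneg _) (hg1 _)

/-- `log * g = (g Λ) * g` up to `defect`: at a prime divisor of exponent one multiplicativity gives
equality. -/
theorem norm_mul_log_sub_primeConv_le {g : Ideals K → ℂ} (hg : IsMultiplicative g)
    (hg1 : ∀ u, ‖g u‖ ≤ 1) (u : Ideals K) :
    ‖g u * Real.log (rnorm u) - primeConv (primeLog g) g u‖ ≤ defect u := by
  have h1 : g u * Real.log (rnorm u) - primeConv (primeLog g) g u =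
      ∑ p ∈ primeDivs u, (val p u * g u - g p.toIdeals * g (cofactor u p)) *
        Real.log (pnorm p) := by
    rw [primeConv, log_norm_eq_sum]
    push_cast
    rw [Finset.mul_sum, ← Finset.sum_sub_distrib]
    refine Finset.sum_congr rfl fun p _ => ?_
    rw [primeLog]
    push_cast
    ring
  rw [h1, defect, Finset.sum_filter]
  refine norm_sum_le_of_le _ fun p hp => ?_
  rw [norm_mul, Complex.norm_real, Real.norm_of_nonneg (log_norm_nonneg _)]
  have hv : 1 ≤ val p u := by
    rw [← pow_dvd_iff_le_val, pow_one]
    exact mem_primeDivs.1 hp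
  split_ifs with h2
  · refine mul_le_mul_of_nonneg_right ?_ (log_norm_nonneg _)
    refine (norm_sub_le _ _).trans ?_
    rw [norm_mul, norm_mul, Complex.norm_natCast]
    have := hg1 u
    have := mul_le_one₀ (hg1 p.toIdeals) (norm_nonneg _) (hg1 (cofactor u p))
    have : (val p u : ℝ) * ‖g u‖ ≤ val p u * 1 := by gcongr
    linarith
  · have hv1 : val p u = 1 := by omega
    have hnd : ¬ p.toIdeals ∣ cofactor u p := by
      intro hd
      have : p.toIdeals ^ 2 ∣ u := by
        conv_rhs => rw [← mul_cofactor hp]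
        rw [sq]
        exact mul_dvd_mul_left _ hd
      rw [pow_dvd_iff_le_val] at this
      omega
    have h3 := hg.pow_mul hnd 1
    rw [pow_one, mul_cofactor hp] at h3
    rw [hv1, h3]
    simp

/-- The comparison version of the logarithmic convolution identity, for `c = g - L e`. -/
theorem norm_sub_mul_log_sub_le {g e : Ideals K → ℂ} (hg : IsMultiplicative g)
    (he : IsMultiplicative e) (hg1 : ∀ u, ‖g u‖ ≤ 1) (he1 : ∀ u, ‖e u‖ ≤ 1) (L : ℂ)
    (u : Ideals K) :
    ‖(g u - L * e u) * Real.log (rnorm u) - (primeConv (primeLog g) (fun v => g v - L * e v) u +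
      L * primeConv (primeLog fun v => g v - e v) e u)‖ ≤ (1 + ‖L‖) * defect u := by
  have h1 : (g u - L * e u) * Real.log (rnorm u) -
      (primeConv (primeLog g) (fun v => g v - L * e v) u +
        L * primeConv (primeLog fun v => g v - e v) e u) =
      (g u * Real.log (rnorm u) - primeConv (primeLog g) g u) -
      L * (e u * Real.log (rnorm u) - primeConv (primeLog e) e u) := by
    have h2 : primeConv (primeLog g) (fun v => g v - L * e v) u =
        primeConv (primeLog g) g u - L * primeConv (primeLog g) e u := by
      simp only [primeConv, Finset.mul_sum, ← Finset.sum_sub_distrib]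
      exact Finset.sum_congr rfl fun p _ => by ring
    have h3 : primeConv (primeLog fun v => g v - e v) e u =
        primeConv (primeLog g) e u - primeConv (primeLog e) e u := by
      simp only [primeConv, ← Finset.sum_sub_distrib, primeLog]
      exact Finset.sum_congr rfl fun p _ => by ring
    rw [h2, h3]
    ring
  rw [h1]
  refine (norm_sub_le _ _).trans ?_
  rw [norm_mul]
  have h4 := norm_mul_log_sub_primeConv_le hg hg1 u
  have h5 := mul_le_mul_of_nonneg_left (norm_mul_log_sub_primeConv_le he he1 u) (norm_nonneg L)
  linarith

/-! ### Dirichlet series over ideals and over primes -/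

theorem LinearGrowth.const_mul {ι : Type*} {N b : ι → ℝ} {C B : ℝ} (hC : LinearGrowth N b C)
    (hB : 0 ≤ B) : LinearGrowth N (fun i => B * b i) (B * C) := fun S x hx hS => by
  rw [← Finset.mul_sum, mul_assoc]
  exact mul_le_mul_of_nonneg_left (hC S x hx hS) hB

theorem LinearGrowth.summable_norm {ι : Type*} {N b : ι → ℝ} {C : ℝ} (hC : LinearGrowth N b C)
    (hN : ∀ i, 1 ≤ N i) {a : ι → ℂ} (hab : ∀ i, ‖a i‖ ≤ b i) {σ : ℝ} (hσ : 1 < σ) :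
    Summable fun i => ‖a i‖ * N i ^ (-σ) :=
  (hC.summable hN (fun i => (norm_nonneg _).trans (hab i)) hσ).of_nonneg_of_le
    (fun i => mul_nonneg (norm_nonneg _) (Real.rpow_nonneg (by linarith [hN i]) _))
    fun i => mul_le_mul_of_nonneg_right (hab i) (Real.rpow_nonneg (by linarith [hN i]) _)

theorem linearGrowth_const {B : ℝ} (hB : 0 ≤ B) :
    LinearGrowth (rnorm (K := K)) (fun _ => B) (B * growthConst K) := by
  simpa using linearGrowth_ideals.const_mul hB

theorem summable_ideals {c : Ideals K → ℂ} {B : ℝ} (hc : ∀ u, ‖c u‖ ≤ B) {σ : ℝ} (hσ : 1 < σ) :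
    Summable fun u => ‖c u‖ * rnorm u ^ (-σ) :=
  (linearGrowth_const ((norm_nonneg _).trans (hc 1))).summable_norm one_le_norm hc hσ

theorem norm_dser_ideals_le {c : Ideals K → ℂ} {B : ℝ} (hc : ∀ u, ‖c u‖ ≤ B) {σ : ℝ} (hσ : 1 < σ)
    (t : ℝ) : ‖dser rnorm c (σ + t * Complex.I)‖ ≤ B * growthConst K * (σ / (σ - 1)) :=
  norm_dser_le_of_linearGrowth (linearGrowth_const ((norm_nonneg _).trans (hc 1))) one_le_norm hc
    hσ t

theorem summable_primes {a : Primes K → ℂ} {B : ℝ} (hB : 0 ≤ B)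
    (ha : ∀ p, ‖a p‖ ≤ B * Real.log (pnorm p)) {σ : ℝ} (hσ : 1 < σ) :
    Summable fun p => ‖a p‖ * pnorm p ^ (-σ) :=
  (linearGrowth_primes.const_mul hB).summable_norm one_le_pnorm ha hσ

/-- The coefficients of the negative derivative of a Dirichlet series. -/
noncomputable def mulLog (c : Ideals K → ℂ) (u : Ideals K) : ℂ := c u * Real.log (rnorm u)

theorem summable_mulLog {c : Ideals K → ℂ} {B : ℝ} (hc : ∀ u, ‖c u‖ ≤ B) {σ : ℝ} (hσ : 1 < σ) :
    Summable fun u => ‖mulLog c u‖ * rnorm u ^ (-σ) := by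
  have hB : 0 ≤ B := (norm_nonneg _).trans (hc 1)
  set δ := (σ - 1) / 2 with hδ
  have hδ0 : 0 < δ := by simp only [hδ]; linarith
  have h1 := (linearGrowth_ideals (K := K)).summable one_le_norm (fun _ => zero_le_one)
    (show 1 < σ - δ by simp only [hδ]; linarith)
  refine (h1.mul_left (B / δ)).of_nonneg_of_le
    (fun u => mul_nonneg (norm_nonneg _) (Real.rpow_nonneg (rnorm_pos u).le _)) fun u => ?_
  have h2 : Real.log (rnorm u) ≤ rnorm u ^ δ / δ := Real.log_le_rpow_div (rnorm_pos u).le hδ0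
  have h3 : rnorm u ^ (-(σ - δ)) = rnorm u ^ δ * rnorm u ^ (-σ) := by
    rw [← Real.rpow_add (rnorm_pos u)]; congr 1; ring
  rw [mulLog, norm_mul, Complex.norm_real, Real.norm_of_nonneg (log_norm_nonneg _), h3]
  calc _ ≤ B * (rnorm u ^ δ / δ) * rnorm u ^ (-σ) := by
        exact mul_le_mul_of_nonneg_right (mul_le_mul (hc u) h2 (log_norm_nonneg u) hB)
          (Real.rpow_nonneg (rnorm_pos u).le _)
    _ = _ := by ring

theorem dser_primeConv {a : Primes K → ℂ} {c : Ideals K → ℂ} {σ : ℝ}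
    (ha : Summable fun p => ‖a p‖ * pnorm p ^ (-σ)) (hc : Summable fun u => ‖c u‖ * rnorm u ^ (-σ))
    (t : ℝ) :
    Summable (fun u => primeConv a c u * (rnorm u : ℂ) ^ (-(σ + t * Complex.I))) ∧
    dser rnorm (primeConv a c) (σ + t * Complex.I) =
      dser pnorm a (σ + t * Complex.I) * dser rnorm c (σ + t * Complex.I) := by
  have h1 : ∀ z : Primes K × Ideals K, a z.1 * c z.2 *
      (rnorm (z.1.toIdeals * z.2) : ℂ) ^ (-(σ + t * Complex.I)) =
      (a z.1 * (pnorm z.1 : ℂ) ^ (-(σ + t * Complex.I))) *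
        (c z.2 * (rnorm z.2 : ℂ) ^ (-(σ + t * Complex.I))) := by
    intro z
    rw [rnorm_toIdeals_mul, Complex.ofReal_mul, Complex.mul_cpow_ofReal_nonneg (pnorm_pos _).le
      (rnorm_pos _).le]
    ring
  have s1 : Summable fun p => ‖a p * (pnorm p : ℂ) ^ (-(σ + t * Complex.I))‖ :=
    ha.congr fun p => (norm_dser_term one_le_pnorm a σ t p).symm
  have s2 : Summable fun u => ‖c u * (rnorm u : ℂ) ^ (-(σ + t * Complex.I))‖ :=
    hc.congr fun u => (norm_dser_term one_le_norm c σ t u).symm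
  obtain ⟨h2, h3⟩ := tsum_primeConv (a := a) (c := c)
    (F := fun u => (rnorm u : ℂ) ^ (-(σ + t * Complex.I)))
    ((summable_mul_of_summable_norm s1 s2).congr fun z => (h1 z).symm)
  refine ⟨h2, ?_⟩
  rw [dser, h3, dser, dser, tsum_mul_tsum_of_summable_norm s1 s2]
  exact tsum_congr h1

/-! ### The comparison hypotheses -/

/-- The hypotheses under which the partial sums of `g` are compared with those of `L(X) e`: the
function `g` is close to `e` at the primes, unless `L` is small, and the Dirichlet series of `g`
is close to that of `L(X) e` on the lines `Re s = 1 + β` with `β` comparable to `1 / log X`.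
Closeness at the primes is measured by a majorant `η` of `‖L‖ * ‖g - e‖`, which is allowed to be
zero if `L` is. -/
structure IsComparison (g e : Ideals K → ℂ) (L : ℝ → ℂ) (η : Primes K → ℝ) (D : ℝ) : Prop where
  mult_left : IsMultiplicative g
  mult_right : IsMultiplicative e
  left_le : ∀ u, ‖g u‖ ≤ 1
  right_le : ∀ u, ‖e u‖ ≤ 1
  factor_le : ∀ X, ‖L X‖ ≤ D
  prime_nonneg : ∀ p, 0 ≤ η p
  prime_le : ∀ X p, ‖L X‖ * ‖g p.toIdeals - e p.toIdeals‖ ≤ η p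
  prime_summable : Summable fun p => η p ^ 2 * (pnorm p)⁻¹
  close : ∀ δ > 0, ∀ B : ℝ, ∀ᶠ X in atTop, ∀ β : ℝ, (Real.log X)⁻¹ ≤ β → β ≤ B * (Real.log X)⁻¹ →
    ∀ t : ℝ, ‖dser rnorm g ((1 + β : ℝ) + t * Complex.I) -
      L X * dser rnorm e ((1 + β : ℝ) + t * Complex.I)‖ ≤ δ * Real.sqrt (1 + t ^ 2) / β

/-- The series `∑ η(p)² log 𝒩(p) 𝒩(p)^(-1-β)`. -/
noncomputable def weightSeries (η : Primes K → ℝ) (β : ℝ) : ℝ :=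
  ∑' p, η p ^ 2 * (Real.log (pnorm p) * pnorm p ^ (-(1 + β)))

theorem mul_log_mul_rpow_le (p : Primes K) {β : ℝ} :
    β * (Real.log (pnorm p) * pnorm p ^ (-(1 + β))) ≤ (pnorm p)⁻¹ := by
  have h1 : β * Real.log (pnorm p) ≤ pnorm p ^ β := by
    rw [Real.rpow_def_of_pos (pnorm_pos p), mul_comm]
    linarith [Real.add_one_le_exp (Real.log (pnorm p) * β)]
  have h2 : (pnorm p)⁻¹ = pnorm p ^ β * pnorm p ^ (-(1 + β)) := by
    rw [← Real.rpow_add (pnorm_pos p), ← Real.rpow_neg_one]; congr 1; ring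
  rw [h2, ← mul_assoc]
  exact mul_le_mul_of_nonneg_right h1 (Real.rpow_nonneg (pnorm_pos p).le _)

theorem weight_term_nonneg (η : Primes K → ℝ) (β : ℝ) (p : Primes K) :
    0 ≤ η p ^ 2 * (Real.log (pnorm p) * pnorm p ^ (-(1 + β))) :=
  mul_nonneg (sq_nonneg _) (mul_nonneg (log_norm_nonneg _) (Real.rpow_nonneg (pnorm_pos p).le _))

theorem summable_weight {η : Primes K → ℝ} (hη : Summable fun p => η p ^ 2 * (pnorm p)⁻¹) {β : ℝ}
    (hβ : 0 < β) :
    Summable fun p => η p ^ 2 * (Real.log (pnorm p) * pnorm p ^ (-(1 + β))) := by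
  refine (hη.mul_left β⁻¹).of_nonneg_of_le (weight_term_nonneg η β) fun p => ?_
  have h1 := mul_le_mul_of_nonneg_left (mul_log_mul_rpow_le p (β := β)) (sq_nonneg (η p))
  rw [inv_mul_eq_div, le_div_iff₀ hβ]
  linarith

theorem weightSeries_nonneg (η : Primes K → ℝ) (β : ℝ) : 0 ≤ weightSeries η β :=
  tsum_nonneg (weight_term_nonneg η β)

theorem mul_weightSeries_le {η : Primes K → ℝ} (hη : Summable fun p => η p ^ 2 * (pnorm p)⁻¹)
    {β : ℝ} (hβ : 0 < β) : β * weightSeries η β ≤ ∑' p, η p ^ 2 * (pnorm p)⁻¹ := by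
  rw [weightSeries, ← tsum_mul_left]
  refine ((summable_weight hη hβ).mul_left β).tsum_le_tsum (fun p => ?_) hη
  have h1 := mul_le_mul_of_nonneg_left (mul_log_mul_rpow_le p (β := β)) (sq_nonneg (η p))
  linarith

/-- Each term `β log 𝒩(p) 𝒩(p)^(-β)` is bounded by one and tends to zero with `β`, so dominated
convergence applies. -/
theorem tendsto_mul_weightSeries {η : Primes K → ℝ}
    (hη : Summable fun p => η p ^ 2 * (pnorm p)⁻¹) :
    Tendsto (fun β : ℝ => β * weightSeries η β) (𝓝[>] 0) (𝓝 0) := by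
  have h1 : Tendsto (fun β : ℝ => ∑' p, β * (η p ^ 2 * (Real.log (pnorm p) *
      pnorm p ^ (-(1 + β))))) (𝓝[>] 0) (𝓝 (∑' _ : Primes K, 0)) := by
    refine tendsto_tsum_of_dominated_convergence hη (fun p => ?_) ?_
    · have hc : Continuous fun β : ℝ => β * (η p ^ 2 * (Real.log (pnorm p) *
          pnorm p ^ (-(1 + β)))) := by
        refine continuous_id.mul (continuous_const.mul (continuous_const.mul ?_))
        exact Continuous.rpow continuous_const (by fun_prop) fun _ => Or.inl (pnorm_pos p).ne'
      have := hc.tendsto 0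
      rw [zero_mul] at this
      exact this.mono_left nhdsWithin_le_nhds
    · filter_upwards [self_mem_nhdsWithin] with β hβ p
      rw [Real.norm_of_nonneg (mul_nonneg (le_of_lt hβ) (weight_term_nonneg η β p))]
      have h1 := mul_le_mul_of_nonneg_left (mul_log_mul_rpow_le p (β := β)) (sq_nonneg (η p))
      linarith
  rw [tsum_zero] at h1
  refine h1.congr fun β => ?_
  rw [weightSeries, tsum_mul_left]

omit [NumberField K] in
theorem norm_sub_mul_le {g e : Ideals K → ℂ} (hg1 : ∀ u, ‖g u‖ ≤ 1) (he1 : ∀ u, ‖e u‖ ≤ 1)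
    {l : ℂ} {D : ℝ} (hl : ‖l‖ ≤ D) (u : Ideals K) : ‖g u - l * e u‖ ≤ 1 + D := by
  refine (norm_sub_le _ _).trans ?_
  rw [norm_mul]
  have h1 := mul_le_mul hl (he1 u) (norm_nonneg _) ((norm_nonneg _).trans hl)
  linarith [hg1 u]

theorem dser_sub_mul {g e : Ideals K → ℂ} (hg1 : ∀ u, ‖g u‖ ≤ 1) (he1 : ∀ u, ‖e u‖ ≤ 1)
    (l : ℂ) {σ : ℝ} (hσ : 1 < σ) (t : ℝ) :
    dser rnorm (fun u => g u - l * e u) (σ + t * Complex.I) =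
      dser rnorm g (σ + t * Complex.I) - l * dser rnorm e (σ + t * Complex.I) := by
  have s1 := summable_dser one_le_norm (summable_ideals hg1 hσ) t
  have s2 := summable_dser one_le_norm (summable_ideals he1 hσ) t
  rw [dser, dser, dser, ← tsum_mul_left, ← s1.tsum_sub (s2.mul_left l)]
  exact tsum_congr fun u => by ring

theorem integral_sq_primeLog_le {g : Ideals K → ℂ} (hg1 : ∀ u, ‖g u‖ ≤ 1) {β : ℝ} (hβ : 0 < β)
    (hβ2 : β ≤ 2) :
    ∫ t : ℝ, ‖dser pnorm (primeLog g) ((1 + β : ℝ) + t * Complex.I)‖ ^ 2 * (1 + t ^ 2)⁻¹ ≤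
      9 * Real.pi * growthConst K ^ 2 / β := by
  have hG := growthConst_nonneg (K := K)
  have h1 : ∀ p, ‖primeLog g p‖ ≤ (fun _ => 1 : Primes K → ℝ) p * Real.log (pnorm p) := fun p => by
    simpa using norm_primeLog_le hg1 p
  have h2 := linearGrowth_primes.summable one_le_pnorm (fun p : Primes K => log_norm_nonneg _)
    (show 1 < 1 + β by linarith)
  refine (integral_sq_dser_le linearGrowth_primes one_le_pnorm hG
    (fun p => log_norm_nonneg _) (by linarith : 1 < 1 + β) (fun _ => zero_le_one) h1
    (summable_primes zero_le_one h1 (by linarith)) (by simpa using h2)).trans ?_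
  have h3 := linearGrowth_primes.tsum_le one_le_pnorm (fun p : Primes K => log_norm_nonneg _)
    (show 1 < 1 + β by linarith)
  have h4 : growthConst K * ((1 + β) / (1 + β - 1)) ≤ growthConst K * (3 / β) := by
    gcongr <;> linarith
  calc _ ≤ 3 * Real.pi * growthConst K * (growthConst K * (3 / β)) := by
        gcongr
        simpa using h3.trans h4
    _ = _ := by ring

theorem integral_sq_primeLog_sub_le {g e : Ideals K → ℂ} {l : ℂ} {η : Primes K → ℝ}
    (hg1 : ∀ u, ‖g u‖ ≤ 1) (he1 : ∀ u, ‖e u‖ ≤ 1)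
    (hη0 : ∀ p, 0 ≤ η p) (hη : Summable fun p => η p ^ 2 * (pnorm p)⁻¹)
    (hl : ∀ p : Primes K, ‖l‖ * ‖g p.toIdeals - e p.toIdeals‖ ≤ η p) {β : ℝ} (hβ : 0 < β) :
    (Summable fun p => ‖l * primeLog (fun u => g u - e u) p‖ * pnorm p ^ (-(1 + β))) ∧
    ∫ t : ℝ, ‖dser pnorm (fun p => l * primeLog (fun u => g u - e u) p)
      ((1 + β : ℝ) + t * Complex.I)‖ ^ 2 * (1 + t ^ 2)⁻¹ ≤
      3 * Real.pi * growthConst K * weightSeries η β := by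
  have h1 : ∀ p, ‖l * primeLog (fun u => g u - e u) p‖ ≤ η p * Real.log (pnorm p) := fun p => by
    rw [primeLog, norm_mul, norm_mul, Complex.norm_real, Real.norm_of_nonneg (log_norm_nonneg _),
      ← mul_assoc]
    exact mul_le_mul_of_nonneg_right (hl p) (log_norm_nonneg _)
  have h2 : ∀ p, ‖l * primeLog (fun u => g u - e u) p‖ ≤ (‖l‖ * 2) * Real.log (pnorm p) := fun p => by
    rw [primeLog, norm_mul, norm_mul, Complex.norm_real, Real.norm_of_nonneg (log_norm_nonneg _),
      ← mul_assoc]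
    refine mul_le_mul_of_nonneg_right (mul_le_mul_of_nonneg_left ?_ (norm_nonneg _))
      (log_norm_nonneg _)
    refine (norm_sub_le _ _).trans ?_
    linarith [hg1 p.toIdeals, he1 p.toIdeals]
  have h3 := summable_primes (by positivity) h2 (show 1 < 1 + β by linarith)
  exact ⟨h3, integral_sq_dser_le linearGrowth_primes one_le_pnorm growthConst_nonneg
    (fun p => log_norm_nonneg _) (by linarith : 1 < 1 + β) hη0 h1 h3 (summable_weight hη hβ)⟩

/-- Mean square of the derivative of the Dirichlet series of `g - l e`, in terms of a bound `κ` for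
the series itself. By the logarithmic convolution identity the derivative is a sum of a series over
primes times the series of `g - l e`, a second series over primes times the series of `e`, and a
remainder; the series over primes are bounded in mean square and their cofactors pointwise. -/
theorem integral_sq_mulLog_le {g e : Ideals K → ℂ} {l : ℂ} {η : Primes K → ℝ} {D : ℝ}
    (hg : IsMultiplicative g) (he : IsMultiplicative e)
    (hg1 : ∀ u, ‖g u‖ ≤ 1) (he1 : ∀ u, ‖e u‖ ≤ 1) (hlD : ‖l‖ ≤ D)
    (hη0 : ∀ p, 0 ≤ η p) (hη : Summable fun p => η p ^ 2 * (pnorm p)⁻¹)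
    (hl : ∀ p : Primes K, ‖l‖ * ‖g p.toIdeals - e p.toIdeals‖ ≤ η p) {β : ℝ} (hβ : 0 < β)
    (hβ2 : β ≤ 2) {κ : ℝ}
    (hκ : ∀ t : ℝ, ‖dser rnorm (fun u => g u - l * e u) ((1 + β : ℝ) + t * Complex.I)‖ ≤
      κ * Real.sqrt (1 + t ^ 2) / β) :
    ∫ t : ℝ, ‖dser rnorm (mulLog fun u => g u - l * e u) ((1 + β : ℝ) + t * Complex.I)‖ ^ 2 *
      (1 + t ^ 2)⁻¹ ^ 2 ≤
      (81 * Real.pi * growthConst K ^ 3 * (1 + D) ^ 2) *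
        (β ^ (-3 : ℝ) * (κ ^ 2 + β * weightSeries η β + β)) := by
  have hD : 0 ≤ D := (norm_nonneg _).trans hlD
  have hG1 := one_le_growthConst (K := K)
  set G := growthConst K with hG
  have hσ : (1 : ℝ) < 1 + β := by linarith
  set c : Ideals K → ℂ := fun u => g u - l * e u with hc
  have hc1 : ∀ u, ‖c u‖ ≤ 1 + D := norm_sub_mul_le hg1 he1 hlD
  set W : Primes K → ℂ := fun p => l * primeLog (fun u => g u - e u) p with hW
  set R : Ideals K → ℂ := fun u => mulLog c u - (primeConv (primeLog g) c u +
    l * primeConv (primeLog fun v => g v - e v) e u) with hR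
  have hRle : ∀ u, ‖R u‖ ≤ (1 + D) * defect u := fun u =>
    (norm_sub_mul_log_sub_le hg he hg1 he1 l u).trans
      (mul_le_mul_of_nonneg_right (by linarith) (defect_nonneg u))
  have hRg := linearGrowth_defect (K := K).const_mul (show 0 ≤ 1 + D by linarith)
  have hpl : ∀ p, ‖primeLog g p‖ ≤ 1 * Real.log (pnorm p) := fun p => by
    simpa using norm_primeLog_le hg1 p
  obtain ⟨hWs, hWi⟩ := integral_sq_primeLog_sub_le hg1 he1 hη0 hη hl hβ
  have hPs := summable_primes zero_le_one hpl hσ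
  have hPi := integral_sq_primeLog_le hg1 hβ hβ2
  -- the Dirichlet series identity
  have hid : ∀ t : ℝ, dser rnorm (mulLog c) ((1 + β : ℝ) + t * Complex.I) =
      dser pnorm (primeLog g) ((1 + β : ℝ) + t * Complex.I) *
        dser rnorm c ((1 + β : ℝ) + t * Complex.I) +
      dser pnorm W ((1 + β : ℝ) + t * Complex.I) * dser rnorm e ((1 + β : ℝ) + t * Complex.I) +
      dser rnorm R ((1 + β : ℝ) + t * Complex.I) := by
    intro t
    obtain ⟨a1, a2⟩ := dser_primeConv hPs (summable_ideals hc1 hσ) t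
    obtain ⟨b1, b2⟩ := dser_primeConv hWs (summable_ideals he1 hσ) t
    have r1 := summable_dser one_le_norm (hRg.summable_norm one_le_norm hRle hσ) t
    rw [← a2, ← b2, dser, dser, dser, dser, ← a1.tsum_add b1, ← (a1.add b1).tsum_add r1]
    refine tsum_congr fun u => ?_
    have hWc : primeConv W e u = l * primeConv (primeLog fun v => g v - e v) e u := by
      simp only [primeConv, hW, Finset.mul_sum]
      exact Finset.sum_congr rfl fun p _ => by ring
    rw [hWc]
    simp only [hR]
    ring
  have hfrac : (1 + β) / (1 + β - 1) ≤ 3 / β := by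
    rw [add_sub_cancel_left]; gcongr; linarith
  have hE : ∀ t : ℝ, ‖dser rnorm e ((1 + β : ℝ) + t * Complex.I)‖ ≤ 3 * G / β := fun t =>
    (norm_dser_ideals_le he1 hσ t).trans (by
      rw [one_mul]
      calc _ ≤ G * (3 / β) := by gcongr
        _ = _ := by ring)
  have hRb : ∀ t : ℝ, ‖dser rnorm R ((1 + β : ℝ) + t * Complex.I)‖ ≤ 3 * (1 + D) * G / β :=
    fun t => (norm_dser_le_of_linearGrowth hRg one_le_norm hRle hσ t).trans (by
      calc _ ≤ (1 + D) * G * (3 / β) := by gcongr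
        _ = _ := by ring)
  set w : ℝ → ℝ := fun t => (1 + t ^ 2)⁻¹ with hw
  have hw0 : ∀ t, 0 ≤ w t := fun t => by simp only [hw]; positivity
  have hw1 : ∀ t, w t ≤ 1 := fun t => inv_le_one_of_one_le₀ (by nlinarith)
  set P : ℝ → ℝ := fun t => ‖dser pnorm (primeLog g) ((1 + β : ℝ) + t * Complex.I)‖ ^ 2 * w t
  set Q : ℝ → ℝ := fun t => ‖dser pnorm W ((1 + β : ℝ) + t * Complex.I)‖ ^ 2 * w t
  have hPint : Integrable P := integrable_sq_dser one_le_pnorm hPs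
  have hQint : Integrable Q := integrable_sq_dser one_le_pnorm hWs
  have hpt : ∀ t : ℝ, ‖dser rnorm (mulLog c) ((1 + β : ℝ) + t * Complex.I)‖ ^ 2 * w t ^ 2 ≤
      3 * (κ / β) ^ 2 * P t + 3 * (3 * G / β) ^ 2 * Q t +
        3 * (3 * (1 + D) * G / β) ^ 2 * w t := by
    intro t
    rw [hid t]
    set p' := dser pnorm (primeLog g) ((1 + β : ℝ) + t * Complex.I) with hp'
    set c' := dser rnorm c ((1 + β : ℝ) + t * Complex.I) with hc'
    set q' := dser pnorm W ((1 + β : ℝ) + t * Complex.I) with hq'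
    set e' := dser rnorm e ((1 + β : ℝ) + t * Complex.I) with he'
    set r' := dser rnorm R ((1 + β : ℝ) + t * Complex.I) with hr'
    have n1 : ‖p' * c' + q' * e' + r'‖ ≤ ‖p'‖ * ‖c'‖ + ‖q'‖ * ‖e'‖ + ‖r'‖ := by
      refine (norm_add₃_le).trans ?_
      rw [norm_mul, norm_mul]
    have n2 : ‖p' * c' + q' * e' + r'‖ ^ 2 ≤
        3 * (‖p'‖ ^ 2 * ‖c'‖ ^ 2 + ‖q'‖ ^ 2 * ‖e'‖ ^ 2 + ‖r'‖ ^ 2) := by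
      refine (pow_le_pow_left₀ (norm_nonneg _) n1 2).trans ?_
      nlinarith [sq_nonneg (‖p'‖ * ‖c'‖ - ‖q'‖ * ‖e'‖), sq_nonneg (‖p'‖ * ‖c'‖ - ‖r'‖),
        sq_nonneg (‖q'‖ * ‖e'‖ - ‖r'‖)]
    have hs : Real.sqrt (1 + t ^ 2) ^ 2 * w t = 1 := by
      rw [Real.sq_sqrt (by positivity)]
      exact mul_inv_cancel₀ (by positivity)
    have n3 : ‖c'‖ ^ 2 * w t ≤ (κ / β) ^ 2 := by
      calc ‖c'‖ ^ 2 * w t ≤ (κ * Real.sqrt (1 + t ^ 2) / β) ^ 2 * w t := by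
            gcongr
            exact hκ t
        _ = (κ / β) ^ 2 * (Real.sqrt (1 + t ^ 2) ^ 2 * w t) := by ring
        _ = _ := by rw [hs, mul_one]
    have n4 : ‖e'‖ ^ 2 ≤ (3 * G / β) ^ 2 := pow_le_pow_left₀ (norm_nonneg _) (hE t) 2
    have n5 : ‖r'‖ ^ 2 ≤ (3 * (1 + D) * G / β) ^ 2 := pow_le_pow_left₀ (norm_nonneg _) (hRb t) 2
    have m1 : ‖p'‖ ^ 2 * ‖c'‖ ^ 2 * w t ^ 2 ≤ (κ / β) ^ 2 * (‖p'‖ ^ 2 * w t) := by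
      have := mul_le_mul_of_nonneg_left n3 (mul_nonneg (sq_nonneg ‖p'‖) (hw0 t))
      linarith
    have m2 : ‖q'‖ ^ 2 * ‖e'‖ ^ 2 * w t ^ 2 ≤ (3 * G / β) ^ 2 * (‖q'‖ ^ 2 * w t) := by
      calc _ = ‖e'‖ ^ 2 * (‖q'‖ ^ 2 * w t) * w t := by ring
        _ ≤ (3 * G / β) ^ 2 * (‖q'‖ ^ 2 * w t) * 1 := by
            gcongr
            exact hw1 t
        _ = _ := mul_one _
    have m3 : ‖r'‖ ^ 2 * w t ^ 2 ≤ (3 * (1 + D) * G / β) ^ 2 * w t := by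
      calc _ = ‖r'‖ ^ 2 * w t * w t := by ring
        _ ≤ (3 * (1 + D) * G / β) ^ 2 * w t * 1 := by
            gcongr
            exact hw1 t
        _ = _ := mul_one _
    have m4 := mul_le_mul_of_nonneg_right n2 (sq_nonneg (w t))
    change _ ≤ 3 * (κ / β) ^ 2 * (‖p'‖ ^ 2 * w t) + 3 * (3 * G / β) ^ 2 * (‖q'‖ ^ 2 * w t) + _
    linarith
  have hwint : Integrable w := integrable_inv_one_add_sq
  have hint : Integrable fun t => 3 * (κ / β) ^ 2 * P t + 3 * (3 * G / β) ^ 2 * Q t +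
        3 * (3 * (1 + D) * G / β) ^ 2 * w t :=
    ((hPint.const_mul _).add (hQint.const_mul _)).add (hwint.const_mul _)
  have hle := integral_mono_of_nonneg (f := fun t : ℝ =>
    ‖dser rnorm (mulLog c) ((1 + β : ℝ) + t * Complex.I)‖ ^ 2 * w t ^ 2)
    (ae_of_all _ fun t => by positivity) hint
    (ae_of_all volume hpt)
  refine hle.trans ?_
  have hsplit : ∫ t, (3 * (κ / β) ^ 2 * P t + 3 * (3 * G / β) ^ 2 * Q t +
      3 * (3 * (1 + D) * G / β) ^ 2 * w t) = (3 * (κ / β) ^ 2 * ∫ t, P t) +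
      (3 * (3 * G / β) ^ 2 * ∫ t, Q t) + 3 * (3 * (1 + D) * G / β) ^ 2 * ∫ t, w t := by
    have h12 : Integrable fun t => 3 * (κ / β) ^ 2 * P t + 3 * (3 * G / β) ^ 2 * Q t :=
      (hPint.const_mul _).add (hQint.const_mul _)
    rw [integral_add h12 (hwint.const_mul _),
      integral_add (hPint.const_mul _) (hQint.const_mul _), integral_const_mul, integral_const_mul,
      integral_const_mul]
  rw [hsplit]
  have hwI : ∫ t, w t = Real.pi := integral_univ_inv_one_add_sq
  rw [hwI]
  have hΩ := weightSeries_nonneg η β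
  have hb3 : β ^ (-3 : ℝ) = (β ^ 3)⁻¹ := by
    rw [Real.rpow_neg hβ.le]; norm_cast
  have hpi := Real.pi_pos
  have k1 : 3 * (κ / β) ^ 2 * ∫ t, P t ≤ 27 * Real.pi * G ^ 2 * ((β ^ 3)⁻¹ * κ ^ 2) := by
    calc _ ≤ 3 * (κ / β) ^ 2 * (9 * Real.pi * G ^ 2 / β) := by gcongr
      _ = _ := by field_simp; ring
  have k2 : 3 * (3 * G / β) ^ 2 * ∫ t, Q t ≤
      81 * Real.pi * G ^ 3 * ((β ^ 3)⁻¹ * (β * weightSeries η β)) := by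
    calc _ ≤ 3 * (3 * G / β) ^ 2 * (3 * Real.pi * G * weightSeries η β) := by gcongr
      _ = _ := by field_simp; ring
  have k3 : 3 * (3 * (1 + D) * G / β) ^ 2 * Real.pi =
      27 * Real.pi * G ^ 2 * (1 + D) ^ 2 * ((β ^ 3)⁻¹ * β) := by
    field_simp; ring
  rw [k3, hb3]
  have g23 : G ^ 2 ≤ G ^ 3 := pow_le_pow_right₀ hG1 (by norm_num)
  have d1 : (1 : ℝ) ≤ (1 + D) ^ 2 := by nlinarith
  have hG3 : 0 ≤ G ^ 3 := by positivity
  have i1 : 27 * Real.pi * G ^ 2 * ((β ^ 3)⁻¹ * κ ^ 2) ≤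
      81 * Real.pi * G ^ 3 * (1 + D) ^ 2 * ((β ^ 3)⁻¹ * κ ^ 2) := by
    refine mul_le_mul_of_nonneg_right ?_ (by positivity)
    calc 27 * Real.pi * G ^ 2 ≤ 81 * Real.pi * G ^ 3 * 1 := by
          rw [mul_one]
          gcongr
          norm_num
      _ ≤ _ := by gcongr
  have i2 : 81 * Real.pi * G ^ 3 * ((β ^ 3)⁻¹ * (β * weightSeries η β)) ≤
      81 * Real.pi * G ^ 3 * (1 + D) ^ 2 * ((β ^ 3)⁻¹ * (β * weightSeries η β)) := by
    refine mul_le_mul_of_nonneg_right ?_ (by positivity)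
    exact le_mul_of_one_le_right (by positivity) d1
  have i3 : 27 * Real.pi * G ^ 2 * (1 + D) ^ 2 * ((β ^ 3)⁻¹ * β) ≤
      81 * Real.pi * G ^ 3 * (1 + D) ^ 2 * ((β ^ 3)⁻¹ * β) := by
    gcongr
    norm_num
  linarith

theorem tendsto_inv_log_atTop : Tendsto (fun X : ℝ => (Real.log X)⁻¹) atTop (𝓝[>] 0) :=
  tendsto_inv_atTop_nhdsGT_zero.comp Real.tendsto_log_atTop

/-- The mean square of the derivative is `o(β ^ (-3))` when `β` is comparable to `1 / log X`; the
factor `(β log X) ^ (1 / 4)` leaves room for the trivial bound for larger `β`. -/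
theorem IsComparison.integral_sq_mulLog_le {g e : Ideals K → ℂ} {L : ℝ → ℂ} {η : Primes K → ℝ}
    {D : ℝ} (H : IsComparison g e L η D) {s : ℝ} (hs : 0 < s) :
    ∀ᶠ X in atTop, ∀ β : ℝ, (Real.log X)⁻¹ ≤ β → β ≤ 2 →
      ∫ t : ℝ, ‖dser rnorm (mulLog fun u => g u - L X * e u) ((1 + β : ℝ) + t * Complex.I)‖ ^ 2 *
        (1 + t ^ 2)⁻¹ ^ 2 ≤ s ^ 2 * (β ^ (-(11 / 4) : ℝ) * (Real.log X)⁻¹ ^ (-(1 / 4) : ℝ)) := by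
  have hD : 0 ≤ D := (norm_nonneg _).trans (H.factor_le 0)
  have hG1 := one_le_growthConst (K := K)
  set G := growthConst K with hG
  set E : ℝ := 81 * Real.pi * G ^ 3 * (1 + D) ^ 2 with hE
  have hE0 : 0 < E := by have := Real.pi_pos; positivity
  set S₀ : ℝ := ∑' p, η p ^ 2 * (pnorm p)⁻¹
  have hS₀ : 0 ≤ S₀ := tsum_nonneg fun p =>
    mul_nonneg (sq_nonneg _) (inv_nonneg.2 (pnorm_pos p).le)
  -- `M` bounds the mean square for every `β ≤ 2`, and `B` is so large that this suffices for
  -- `β ≥ B / log X`; below, each of the three contributions is at most `r`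
  set M : ℝ := (3 * (1 + D) * G) ^ 2 + S₀ + 2 with hM
  have hM0 : 0 < M := by positivity
  set B : ℝ := (E * M / s ^ 2) ^ (4 : ℝ) with hB
  have hB0 : 0 < B := by positivity
  have hB4 : B ^ (1 / 4 : ℝ) = E * M / s ^ 2 := by
    rw [hB, ← Real.rpow_mul (by positivity)]; norm_num
  set r : ℝ := s ^ 2 / (3 * E) with hr
  have hr0 : 0 < r := by positivity
  have hΩ : ∀ᶠ β in 𝓝[>] (0 : ℝ), β * weightSeries η β < r :=
    (tendsto_mul_weightSeries H.prime_summable).eventually_lt_const hr0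
  obtain ⟨β₀, hβ₀, hΩ'⟩ := (mem_nhdsGT_iff_exists_Ioo_subset).1 hΩ
  have hβ₀' : (0 : ℝ) < β₀ := hβ₀
  have hε : ∀ᶠ X : ℝ in atTop, (Real.log X)⁻¹ < min (β₀ / B) (r / B) :=
    (tendsto_inv_log_atTop.mono_right nhdsWithin_le_nhds).eventually_lt_const
      (lt_min (div_pos hβ₀' hB0) (div_pos hr0 hB0))
  have hpos : ∀ᶠ X : ℝ in atTop, 0 < (Real.log X)⁻¹ :=
    tendsto_inv_log_atTop.eventually self_mem_nhdsWithin
  filter_upwards [H.close (Real.sqrt r) (Real.sqrt_pos.2 hr0) B, hε, hpos] with X hcl hX hε0 β h1 h2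
  set ε := (Real.log X)⁻¹ with hεdef
  have hβ : 0 < β := hε0.trans_le h1
  have hmain := fun κ => NumberFieldHalasz.integral_sq_mulLog_le (κ := κ) H.mult_left H.mult_right
    H.left_le H.right_le (H.factor_le X) H.prime_nonneg H.prime_summable (H.prime_le X) hβ h2
  have hβ3 : β ^ (-3 : ℝ) = β ^ (-(11 / 4) : ℝ) * β ^ (-(1 / 4) : ℝ) := by
    rw [← Real.rpow_add hβ]; norm_num
  have hb11 : 0 < β ^ (-(11 / 4) : ℝ) := by positivity
  rcases le_total β (B * ε) with hcase | hcase
  · have hβr : β < r := by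
      calc β ≤ B * ε := hcase
        _ < B * (r / B) := by gcongr; exact hX.trans_le (min_le_right _ _)
        _ = r := by field_simp
    have hβ0 : β < β₀ := by
      calc β ≤ B * ε := hcase
        _ < B * (β₀ / B) := by gcongr; exact hX.trans_le (min_le_left _ _)
        _ = β₀ := by field_simp
    have hw : β * weightSeries η β < r := hΩ' ⟨hβ, hβ0⟩
    refine (hmain (Real.sqrt r) fun t => ?_).trans ?_
    · rw [dser_sub_mul H.left_le H.right_le _ (by linarith)]
      exact hcl β h1 hcase t
    · rw [Real.sq_sqrt hr0.le]
      have h3 : β ^ (-(1 / 4) : ℝ) ≤ ε ^ (-(1 / 4) : ℝ) :=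
        Real.rpow_le_rpow_of_nonpos hε0 h1 (by norm_num)
      calc E * (β ^ (-3 : ℝ) * (r + β * weightSeries η β + β))
          ≤ E * (β ^ (-3 : ℝ) * (r + r + r)) := by gcongr
        _ = s ^ 2 * (β ^ (-(11 / 4) : ℝ) * β ^ (-(1 / 4) : ℝ)) := by
            rw [hβ3, hr]; field_simp; ring
        _ ≤ _ := by gcongr
  · refine (hmain (3 * (1 + D) * G) fun t => ?_).trans ?_
    · have h3 := norm_dser_ideals_le (norm_sub_mul_le H.left_le H.right_le (H.factor_le X))
        (show 1 < 1 + β by linarith) t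
      have h4 : (1 + β) / (1 + β - 1) ≤ 3 / β := by
        rw [add_sub_cancel_left]; gcongr; linarith
      have h5 : (1 : ℝ) ≤ Real.sqrt (1 + t ^ 2) := Real.one_le_sqrt.2 (by nlinarith)
      calc _ ≤ (1 + D) * G * ((1 + β) / (1 + β - 1)) := h3
        _ ≤ (1 + D) * G * (3 / β) := by gcongr
        _ = 3 * (1 + D) * G * 1 / β := by ring
        _ ≤ _ := by gcongr
    · have h3 := mul_weightSeries_le H.prime_summable hβ
      have h4 : B ^ (1 / 4 : ℝ) * β ^ (-(1 / 4) : ℝ) ≤ ε ^ (-(1 / 4) : ℝ) := by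
        rw [Real.rpow_neg hβ.le, Real.rpow_neg hε0.le, ← div_eq_mul_inv,
          div_le_iff₀ (by positivity), inv_mul_eq_div, le_div_iff₀ (by positivity),
          ← Real.mul_rpow hB0.le hε0.le]
        exact Real.rpow_le_rpow (by positivity) hcase (by norm_num)
      calc E * (β ^ (-3 : ℝ) * ((3 * (1 + D) * G) ^ 2 + β * weightSeries η β + β))
          ≤ E * (β ^ (-3 : ℝ) * M) := by
            rw [hM]
            gcongr
        _ = s ^ 2 * (β ^ (-(11 / 4) : ℝ) * (B ^ (1 / 4 : ℝ) * β ^ (-(1 / 4) : ℝ))) := by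
            rw [hβ3, hB4]; field_simp
        _ ≤ _ := by gcongr

/-! ### The smoothed sum over products of a prime and an ideal -/

/-- Perron's formula for a product, combined with the inequality of arithmetic and geometric
means. -/
theorem norm_tsum_ker_le_mean {ι κ : Type*} [Countable ι] [Countable κ] {N : ι → ℝ} {M : κ → ℝ}
    (hN : ∀ i, 1 ≤ N i) (hM : ∀ j, 1 ≤ M j) {a : ι → ℂ} {c : κ → ℂ} {σ x : ℝ} (hσ : 1 ≤ σ)
    (hx : 0 < x) (ha : Summable fun i => ‖a i‖ * N i ^ (-σ))
    (hc : Summable fun j => ‖c j‖ * M j ^ (-σ)) {r : ℝ} (hr : 0 < r) :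
    ‖∑' z : ι × κ, a z.1 * c z.2 * (ker (N z.1 * M z.2 / x) : ℂ)‖ ≤
      x ^ σ * ((r * (∫ t : ℝ, ‖dser N a (σ + t * Complex.I)‖ ^ 2 * (1 + t ^ 2)⁻¹) +
        r⁻¹ * ∫ t : ℝ, ‖dser M c (σ + t * Complex.I)‖ ^ 2 * (1 + t ^ 2)⁻¹ ^ 2) / 2) := by
  refine (norm_tsum_ker_le hN hM hσ hx ha hc).trans
    (mul_le_mul_of_nonneg_left ?_ (Real.rpow_nonneg hx.le _))
  have i1 := integrable_sq_dser hN ha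
  have i2 : Integrable fun t : ℝ => ‖dser M c (σ + t * Complex.I)‖ ^ 2 * (1 + t ^ 2)⁻¹ ^ 2 := by
    have h1 := (integrable_sq_dser hM hc).bdd_mul (f := fun t : ℝ => (1 + t ^ 2)⁻¹) (c := 1) ?_ ?_
    · refine h1.congr (ae_of_all _ fun t => ?_)
      simp only
      ring
    · exact (Continuous.inv₀ (by fun_prop) fun t => by positivity).aestronglyMeasurable
    · refine ae_of_all _ fun t => ?_
      rw [Real.norm_of_nonneg (by positivity)]
      exact inv_le_one_of_one_le₀ (by nlinarith)
  rw [← integral_const_mul, ← integral_const_mul, ← integral_add (i1.const_mul _) (i2.const_mul _),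
    ← integral_div]
  refine integral_mono_of_nonneg (ae_of_all _ fun t => by positivity)
    (((i1.const_mul _).add (i2.const_mul _)).div_const 2) (ae_of_all _ fun t => ?_)
  dsimp only
  set A := ‖dser N a (σ + t * Complex.I)‖
  set C := ‖dser M c (σ + t * Complex.I)‖
  set q := (Real.sqrt (1 + t ^ 2))⁻¹ with hq
  have hq0 : 0 ≤ q := by positivity
  have h1 : (1 + t ^ 2)⁻¹ = q ^ 2 := by
    rw [hq, inv_pow, Real.sq_sqrt (by positivity)]
  rw [h1, ← inv_pow, ← hq, le_div_iff₀ two_pos]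
  have h2 : 2 * A * (C * q) ≤ r * A ^ 2 + r⁻¹ * (C * q) ^ 2 := by
    have h3 : r * A ^ 2 + r⁻¹ * (C * q) ^ 2 - 2 * A * (C * q) = r⁻¹ * (r * A - C * q) ^ 2 := by
      field_simp; ring
    have : 0 ≤ r⁻¹ * (r * A - C * q) ^ 2 := by positivity
    linarith
  have h4 := mul_le_mul_of_nonneg_right h2 (sq_nonneg q)
  nlinarith

/-- The finite set of pairs that matter for products of norm at most `x`. -/
noncomputable def pairsLE (K : Type*) [Field K] [NumberField K] (x : ℝ) :
    Finset (Primes K × Ideals K) := primesLE K x ×ˢ idealsLE K x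

theorem ker_mul_eq_zero {x : ℝ} (hx : 0 < x) {z : Primes K × Ideals K} (hz : z ∉ pairsLE K x) :
    ker (pnorm z.1 * rnorm z.2 / x) = 0 := by
  refine ker_eq_zero ((one_le_div hx).2 ?_)
  by_contra! hlt
  refine hz (Finset.mem_product.2 ⟨mem_primesLE.2 ?_, mem_idealsLE.2 ?_⟩)
  · have := one_le_norm z.2
    have h1 := pnorm_pos z.1
    nlinarith
  · have := one_le_pnorm z.1
    have h1 := rnorm_pos z.2
    nlinarith

theorem tsum_pairs_ker {x : ℝ} (hx : 0 < x) (a : Primes K → ℂ) (c : Ideals K → ℂ) :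
    ∑' z : Primes K × Ideals K, a z.1 * c z.2 * (ker (pnorm z.1 * rnorm z.2 / x) : ℂ) =
      ∑ z ∈ pairsLE K x, a z.1 * c z.2 * (ker (pnorm z.1 * rnorm z.2 / x) : ℂ) :=
  tsum_eq_sum fun z hz => by rw [ker_mul_eq_zero hx hz]; simp

theorem sum_primeConv_ker {x : ℝ} (hx : 0 < x) (a : Primes K → ℂ) (c : Ideals K → ℂ) :
    ∑ u ∈ idealsLE K x, primeConv a c u * (ker (rnorm u / x) : ℂ) =
      ∑ z ∈ pairsLE K x, a z.1 * c z.2 * (ker (pnorm z.1 * rnorm z.2 / x) : ℂ) := by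
  have h1 : ∀ z : Primes K × Ideals K, rnorm (z.1.toIdeals * z.2) = pnorm z.1 * rnorm z.2 :=
    fun z => rnorm_toIdeals_mul _ _
  have hs : Summable fun z : Primes K × Ideals K =>
      a z.1 * c z.2 * (ker (rnorm (z.1.toIdeals * z.2) / x) : ℂ) := by
    refine summable_of_ne_finset_zero (s := pairsLE K x) fun z hz => ?_
    rw [h1, ker_mul_eq_zero hx hz]
    simp
  have h2 := (tsum_primeConv (a := a) (c := c) (F := fun u => (ker (rnorm u / x) : ℂ)) hs).2
  simp only [h1] at h2
  rw [← tsum_pairs_ker hx, ← h2]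
  refine (tsum_eq_sum fun u hu => ?_).symm
  rw [ker_eq_zero ((one_le_div hx).2 ?_)]
  · simp
  · by_contra! hlt
    exact hu (mem_idealsLE.2 hlt.le)

theorem dser_mul_rpow {c : Ideals K → ℂ} (σ α t : ℝ) :
    dser rnorm (fun u => c u * (rnorm u ^ (-α) : ℝ)) (σ + t * Complex.I) =
      dser rnorm c ((σ + α : ℝ) + t * Complex.I) := by
  refine tsum_congr fun u => ?_
  dsimp only
  have h0 : (rnorm u : ℂ) ≠ 0 := by exact_mod_cast (rnorm_pos u).ne'
  rw [Complex.ofReal_cpow (rnorm_pos u).le, mul_assoc, ← Complex.cpow_add _ _ h0]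
  congr 2
  push_cast
  ring

/-- The derivative of `α ↦ -n ^ (-α)` is `log n * n ^ (-α)`. -/
theorem one_eq_inv_add_integral {n : ℝ} (hn : 1 ≤ n) :
    (1 : ℝ) = n ^ (-1 : ℝ) + ∫ α in (0 : ℝ)..1, Real.log n * n ^ (-α) := by
  have hn0 : 0 < n := by linarith
  have h1 : ∀ α ∈ Set.uIcc (0 : ℝ) 1, HasDerivAt (fun α : ℝ => -n ^ (-α)) (Real.log n * n ^ (-α)) α := by
    intro α _
    have := ((hasDerivAt_id α).neg.const_rpow hn0).neg
    convert! this using 1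
    simp
  rw [intervalIntegral.integral_eq_sub_of_hasDerivAt h1]
  · simp
  · refine Continuous.intervalIntegrable ?_ _ _
    exact continuous_const.mul (Continuous.rpow continuous_const continuous_neg
      fun _ => Or.inl hn0.ne')

/-- The integral over `α` of the mean square bounds on the lines `Re s = 1 + ε + α` is `O(1 / ε)`,
without a logarithmic loss. -/
theorem integral_rpow_shift_le {ε : ℝ} (hε : 0 < ε) :
    ∫ α in (0 : ℝ)..1, ε ^ (-(3 / 4) : ℝ) * (ε + α) ^ (-(5 / 4) : ℝ) ≤ 4 / ε := by
  rw [intervalIntegral.integral_const_mul,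
    intervalIntegral.integral_comp_add_left (fun y : ℝ => y ^ (-(5 / 4) : ℝ)), integral_rpow]
  · have h1 : (-(5 / 4) + 1 : ℝ) = -(1 / 4) := by norm_num
    rw [h1]
    have h2 : 0 ≤ (ε + 1) ^ (-(1 / 4) : ℝ) := by positivity
    have h3 : ε ^ (-(3 / 4) : ℝ) * ε ^ (-(1 / 4) : ℝ) = ε⁻¹ := by
      rw [← Real.rpow_add hε, ← Real.rpow_neg_one]; norm_num
    have h4 : 0 ≤ ε ^ (-(3 / 4) : ℝ) := by positivity
    rw [add_zero]
    calc _ = 4 * (ε ^ (-(3 / 4) : ℝ) * ε ^ (-(1 / 4) : ℝ)) -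
          4 * (ε ^ (-(3 / 4) : ℝ) * (ε + 1) ^ (-(1 / 4) : ℝ)) := by ring
      _ ≤ 4 * ε⁻¹ := by
          rw [h3]
          have := mul_nonneg h4 h2
          linarith
      _ = _ := by ring
  · refine Or.inr ⟨by norm_num, ?_⟩
    rw [Set.uIcc_of_le (by linarith), Set.mem_Icc]
    intro h1
    linarith [h1.1]

/-- Inserting `1 = n⁻¹ + ∫₀¹ (log n) n^(-α) dα` at the norm `n` of the ideal in a
product of a prime and an ideal brings in the derivative of the Dirichlet series of `c`, for which a
mean square bound is available on every line. Since the coefficients `(log n) n^(-α)` shift the line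
of integration for the series over ideals only, the factor `x ^ (1 + ε)` does not depend on `α`. -/
theorem norm_sum_pairs_ker_le {g c : Ideals K → ℂ} {B ε s x : ℝ} (hg1 : ∀ u, ‖g u‖ ≤ 1)
    (hc : ∀ u, ‖c u‖ ≤ B) (hε : 0 < ε) (hε1 : ε ≤ 1) (hs : 0 < s) (hx : 0 < x)
    (hms : ∀ β : ℝ, ε ≤ β → β ≤ 2 →
      ∫ t : ℝ, ‖dser rnorm (mulLog c) ((1 + β : ℝ) + t * Complex.I)‖ ^ 2 * (1 + t ^ 2)⁻¹ ^ 2 ≤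
        s ^ 2 * (β ^ (-(11 / 4) : ℝ) * ε ^ (-(1 / 4) : ℝ))) :
    ‖∑ z ∈ pairsLE K x, primeLog g z.1 * c z.2 * (ker (pnorm z.1 * rnorm z.2 / x) : ℂ)‖ ≤
      x ^ (1 + ε) * (5 * (9 * Real.pi * growthConst K ^ 2 + 1) * s / ε +
        2 * Real.pi * (B * growthConst K) ^ 2 / s) := by
  have hB : 0 ≤ B := (norm_nonneg _).trans (hc 1)
  have hG1 := one_le_growthConst (K := K)
  set G := growthConst K with hG
  have hpi := Real.pi_pos
  set T := pairsLE K x with hT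
  set A : ℝ := 9 * Real.pi * G ^ 2 with hA
  have hσ1 : (1 : ℝ) < 1 + ε := by linarith
  have hP := integral_sq_primeLog_le hg1 hε (by linarith)
  have hPs := summable_primes zero_le_one (a := primeLog g)
    (fun p => by simpa using norm_primeLog_le hg1 p) hσ1
  set k : Primes K × Ideals K → ℂ := fun z => (ker (pnorm z.1 * rnorm z.2 / x) : ℂ) with hk
  set c₁ : Ideals K → ℂ := fun u => c u * (rnorm u ^ (-1 : ℝ) : ℝ) with hc₁
  set cα : ℝ → Ideals K → ℂ := fun α u => mulLog c u * (rnorm u ^ (-α) : ℝ) with hcα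
  set F : ℝ → ℂ := fun α => ∑ z ∈ T, primeLog g z.1 * cα α z.2 * k z with hF
  have hFc : Continuous F := by
    refine continuous_finsetSum _ fun z _ => (continuous_const.mul ?_).mul continuous_const
    refine continuous_const.mul (Complex.continuous_ofReal.comp ?_)
    exact Continuous.rpow continuous_const continuous_neg fun _ => Or.inl (rnorm_pos z.2).ne'
  -- the decomposition
  have hdec : ∑ z ∈ T, primeLog g z.1 * c z.2 * k z =
      (∑ z ∈ T, primeLog g z.1 * c₁ z.2 * k z) + ∫ α in (0 : ℝ)..1, F α := by
    simp only [hF]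
    rw [intervalIntegral.integral_finsetSum]
    · rw [← Finset.sum_add_distrib]
      refine Finset.sum_congr rfl fun z _ => ?_
      have h1 : ∀ α : ℝ, primeLog g z.1 * cα α z.2 * k z = (primeLog g z.1 * c z.2 * k z) *
          ((Real.log (rnorm z.2) * rnorm z.2 ^ (-α) : ℝ) : ℂ) := by
        intro α
        simp only [hcα, mulLog]
        push_cast
        ring
      simp_rw [h1]
      rw [intervalIntegral.integral_const_mul, intervalIntegral.integral_ofReal]
      have h2 := congrArg (Complex.ofReal) (one_eq_inv_add_integral (one_le_norm z.2))
      rw [Complex.ofReal_one, Complex.ofReal_add] at h2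
      simp only [hc₁]
      calc _ = (primeLog g z.1 * c z.2 * k z) * 1 := by ring
        _ = _ := by rw [h2]; ring
    · intro z _
      refine Continuous.intervalIntegrable ?_ _ _
      refine (continuous_const.mul ?_).mul continuous_const
      refine continuous_const.mul (Complex.continuous_ofReal.comp ?_)
      exact Continuous.rpow continuous_const continuous_neg fun _ => Or.inl (rnorm_pos z.2).ne'
  rw [hdec]
  have hxs : 0 ≤ x ^ (1 + ε) := Real.rpow_nonneg hx.le _
  -- the part with `n⁻¹`
  have hpart1 : ‖∑ z ∈ T, primeLog g z.1 * c₁ z.2 * k z‖ ≤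
      x ^ (1 + ε) * (A * s / ε + 2 * Real.pi * (B * G) ^ 2 / s) := by
    have hcs : ∀ u, ‖c₁ u‖ ≤ B := fun u => by
      simp only [hc₁]
      rw [norm_mul, Complex.norm_real, Real.norm_of_nonneg (Real.rpow_nonneg (rnorm_pos u).le _)]
      exact (mul_le_mul (hc u) (Real.rpow_le_one_of_one_le_of_nonpos (one_le_norm u) (by norm_num))
        (Real.rpow_nonneg (rnorm_pos u).le _) hB).trans_eq (mul_one B)
    have h1 := norm_tsum_ker_le_mean one_le_pnorm one_le_norm hσ1.le hx hPs
      (summable_ideals hcs hσ1) hs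
    rw [tsum_pairs_ker hx] at h1
    refine h1.trans (mul_le_mul_of_nonneg_left ?_ hxs)
    have h2 : ∫ t : ℝ, ‖dser rnorm c₁ ((1 + ε : ℝ) + t * Complex.I)‖ ^ 2 * (1 + t ^ 2)⁻¹ ^ 2 ≤
        (2 * (B * G)) ^ 2 * Real.pi := by
      rw [← integral_univ_inv_one_add_sq, ← integral_const_mul]
      refine integral_mono_of_nonneg (ae_of_all _ fun t => by positivity)
        (integrable_inv_one_add_sq.const_mul _) (ae_of_all _ fun t => ?_)
      simp only
      rw [hc₁, dser_mul_rpow]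
      have h3 := norm_dser_ideals_le hc (show 1 < 1 + ε + 1 by linarith) t
      have h4 : (1 + ε + 1) / (1 + ε + 1 - 1) ≤ 2 := by
        rw [div_le_iff₀ (by linarith)]; linarith
      have h5 : ‖dser rnorm c ((1 + ε + 1 : ℝ) + t * Complex.I)‖ ≤ 2 * (B * G) := by
        refine h3.trans ?_
        calc _ ≤ B * G * 2 := by gcongr
          _ = _ := by ring
      have h6 : (1 + t ^ 2)⁻¹ ≤ (1 : ℝ) := inv_le_one_of_one_le₀ (by nlinarith)
      have h7 : 0 ≤ (1 + t ^ 2)⁻¹ := by positivity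
      have h8 : (1 + t ^ 2)⁻¹ ^ 2 ≤ (1 + t ^ 2)⁻¹ := by nlinarith
      gcongr
    calc _ ≤ (s * (A / ε) + s⁻¹ * ((2 * (B * G)) ^ 2 * Real.pi)) / 2 := by gcongr
      _ = A * s / ε / 2 + 2 * Real.pi * (B * G) ^ 2 / s := by field_simp
      _ ≤ _ := by
          have : 0 ≤ A * s / ε := by positivity
          linarith
  -- the part with the integral
  have hpart2 : ‖∫ α in (0 : ℝ)..1, F α‖ ≤ x ^ (1 + ε) * (s * (A + 1) * (4 / ε)) := by
    have hbd : ∀ α ∈ Set.Ioc (0 : ℝ) 1, ‖F α‖ ≤ x ^ (1 + ε) * (s * (A + 1)) *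
        (ε ^ (-(3 / 4) : ℝ) * (ε + α) ^ (-(5 / 4) : ℝ)) := by
      intro α hα
      set β := ε + α with hβ
      have hβ0 : 0 < β := by have := hα.1; positivity
      have hβε : ε ≤ β := by linarith [hα.1]
      -- `r` balances the mean square over primes, `O(1 / ε)`, with the one over ideals
      set r : ℝ := s * (ε ^ (1 / 4 : ℝ) * β ^ (-(5 / 4) : ℝ)) with hr
      have hr0 : 0 < r := by positivity
      have hsum : Summable fun u => ‖cα α u‖ * rnorm u ^ (-(1 + ε)) := by
        refine (summable_mulLog hc (show 1 < 1 + ε by linarith)).of_nonneg_of_le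
          (fun u => mul_nonneg (norm_nonneg _) (Real.rpow_nonneg (rnorm_pos u).le _)) fun u => ?_
        refine mul_le_mul_of_nonneg_right ?_ (Real.rpow_nonneg (rnorm_pos u).le _)
        simp only [hcα]
        rw [norm_mul, Complex.norm_real,
          Real.norm_of_nonneg (Real.rpow_nonneg (rnorm_pos u).le _)]
        exact mul_le_of_le_one_right (norm_nonneg _)
          (Real.rpow_le_one_of_one_le_of_nonpos (one_le_norm u) (by linarith [hα.1]))
      have h1 := norm_tsum_ker_le_mean one_le_pnorm one_le_norm hσ1.le hx hPs hsum hr0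
      rw [tsum_pairs_ker hx] at h1
      refine h1.trans ?_
      rw [mul_assoc (x ^ (1 + ε))]
      refine mul_le_mul_of_nonneg_left ?_ hxs
      have h2 := hms β hβε (by linarith [hα.2])
      have h3 : ∫ t : ℝ, ‖dser rnorm (cα α) ((1 + ε : ℝ) + t * Complex.I)‖ ^ 2 *
          (1 + t ^ 2)⁻¹ ^ 2 ≤ s ^ 2 * (β ^ (-(11 / 4) : ℝ) * ε ^ (-(1 / 4) : ℝ)) := by
        refine le_of_eq_of_le ?_ h2
        refine integral_congr_ae (ae_of_all _ fun t => ?_)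
        simp only [hcα]
        rw [dser_mul_rpow, add_assoc]
      have e1 : r * (A / ε) = s * A * (ε ^ (-(3 / 4) : ℝ) * β ^ (-(5 / 4) : ℝ)) := by
        have : ε ^ (-(3 / 4) : ℝ) = ε ^ (1 / 4 : ℝ) * ε⁻¹ := by
          rw [← Real.rpow_neg_one, ← Real.rpow_add hε]; norm_num
        rw [this, hr]
        ring
      have e2 : r⁻¹ * (s ^ 2 * (β ^ (-(11 / 4) : ℝ) * ε ^ (-(1 / 4) : ℝ))) ≤
          s * (ε ^ (-(3 / 4) : ℝ) * β ^ (-(5 / 4) : ℝ)) := by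
        have h4 : r⁻¹ * (s ^ 2 * (β ^ (-(11 / 4) : ℝ) * ε ^ (-(1 / 4) : ℝ))) =
            s * (ε ^ (-(1 / 2) : ℝ) * β ^ (-(3 / 2) : ℝ)) := by
          have h5 : ε ^ (-(1 / 4) : ℝ) = ε ^ (1 / 4 : ℝ) * ε ^ (-(1 / 2) : ℝ) := by
            rw [← Real.rpow_add hε]; norm_num
          have h6 : β ^ (-(11 / 4) : ℝ) = β ^ (-(5 / 4) : ℝ) * β ^ (-(3 / 2) : ℝ) := by
            rw [← Real.rpow_add hβ0]; norm_num
          rw [h5, h6, hr]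
          field_simp
        rw [h4]
        have h7 : β ^ (-(3 / 2) : ℝ) = β ^ (-(5 / 4) : ℝ) * β ^ (-(1 / 4) : ℝ) := by
          rw [← Real.rpow_add hβ0]; norm_num
        have h8 : ε ^ (-(3 / 4) : ℝ) = ε ^ (-(1 / 2) : ℝ) * ε ^ (-(1 / 4) : ℝ) := by
          rw [← Real.rpow_add hε]; norm_num
        have h9 : β ^ (-(1 / 4) : ℝ) ≤ ε ^ (-(1 / 4) : ℝ) :=
          Real.rpow_le_rpow_of_nonpos hε hβε (by norm_num)
        rw [h7, h8]
        calc _ = s * (ε ^ (-(1 / 2) : ℝ) * β ^ (-(5 / 4) : ℝ)) * β ^ (-(1 / 4) : ℝ) := by ring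
          _ ≤ s * (ε ^ (-(1 / 2) : ℝ) * β ^ (-(5 / 4) : ℝ)) * ε ^ (-(1 / 4) : ℝ) := by gcongr
          _ = _ := by ring
      have e3 := mul_le_mul_of_nonneg_left hP hr0.le
      have e4 := mul_le_mul_of_nonneg_left h3 (inv_nonneg.2 hr0.le)
      have e5 : 0 ≤ s * A * (ε ^ (-(3 / 4) : ℝ) * β ^ (-(5 / 4) : ℝ)) := by positivity
      have e6 : 0 ≤ s * (ε ^ (-(3 / 4) : ℝ) * β ^ (-(5 / 4) : ℝ)) := by positivity
      rw [← hA, e1] at e3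
      linarith
    have hbi : IntervalIntegrable (fun α : ℝ => x ^ (1 + ε) * (s * (A + 1)) *
        (ε ^ (-(3 / 4) : ℝ) * (ε + α) ^ (-(5 / 4) : ℝ))) volume 0 1 := by
      refine ContinuousOn.intervalIntegrable ?_
      refine continuousOn_const.mul (continuousOn_const.mul ?_)
      refine ContinuousOn.rpow_const (by fun_prop) fun α hα => Or.inl ?_
      rw [Set.uIcc_of_le zero_le_one] at hα
      linarith [hα.1]
    refine (intervalIntegral.norm_integral_le_of_norm_le zero_le_one
      (ae_of_all _ hbd) hbi).trans ?_
    rw [intervalIntegral.integral_const_mul]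
    calc _ ≤ x ^ (1 + ε) * (s * (A + 1)) * (4 / ε) := by
          gcongr
          exact integral_rpow_shift_le hε
      _ = _ := by ring
  refine (norm_add_le _ _).trans ((add_le_add hpart1 hpart2).trans ?_)
  rw [← mul_add]
  refine mul_le_mul_of_nonneg_left ?_ hxs
  have h1 : 0 ≤ s / ε := by positivity
  have h2 : A * s / ε + s * (A + 1) * (4 / ε) = (5 * A + 4) * (s / ε) := by ring
  have h3 : 5 * (A + 1) * s / ε = (5 * A + 4) * (s / ε) + s / ε := by ring
  rw [h3]
  linarith

/-! ### The partial sums under the comparison hypotheses -/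

/-- The trivial bound: there are `O(x / 𝒩(p))` ideals to be paired with a prime `p`. -/
theorem norm_sum_pairs_ker_le_sum {a : Primes K → ℂ} {e : Ideals K → ℂ} {b : Primes K → ℝ}
    (hb : ∀ p, ‖a p‖ ≤ b p) (he1 : ∀ u, ‖e u‖ ≤ 1) {x : ℝ} (hx : 0 < x) :
    ‖∑ z ∈ pairsLE K x, a z.1 * e z.2 * (ker (pnorm z.1 * rnorm z.2 / x) : ℂ)‖ ≤
      ∑ p ∈ primesLE K x, b p * (growthConst K * (x / pnorm p)) := by
  rw [pairsLE, Finset.sum_product]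
  refine (norm_sum_le _ _).trans (Finset.sum_le_sum fun p _ => ?_)
  have hb0 : 0 ≤ b p := (norm_nonneg _).trans (hb p)
  have hp := pnorm_pos p
  classical
  have h1 := linearGrowth_ideals (K := K) ((idealsLE K x).filter fun u => rnorm u ≤ x / pnorm p)
    (x / pnorm p) (by positivity) fun u hu => (Finset.mem_filter.1 hu).2
  refine le_trans ?_ (mul_le_mul_of_nonneg_left h1 hb0)
  rw [Finset.sum_filter, Finset.mul_sum]
  refine (norm_sum_le _ _).trans (Finset.sum_le_sum fun u _ => ?_)
  split_ifs with hu
  · rw [norm_mul, norm_mul, Complex.norm_real, Real.norm_of_nonneg (ker_nonneg _)]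
    have h2 : 0 ≤ pnorm p * rnorm u / x := by have := rnorm_pos u; positivity
    calc _ ≤ b p * 1 * 1 := by
          refine mul_le_mul (mul_le_mul (hb p) (he1 u) (norm_nonneg _) hb0) (ker_le_one h2)
            (ker_nonneg _) (by linarith)
      _ = _ := by ring
  · rw [ker_eq_zero]
    · simp
    · rw [one_le_div hx]
      rw [not_le, div_lt_iff₀ hp] at hu
      linarith

/-- The inequality of arithmetic and geometric means bounds `∑ η(p) log 𝒩(p) / 𝒩(p)` by the series
for `η²`, which is `o(1 / ε)`. -/
theorem sum_mul_log_div_le {η : Primes K → ℝ} (hη : Summable fun p => η p ^ 2 * (pnorm p)⁻¹)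
    {ε δ x : ℝ} (hε : 0 < ε) (hε1 : ε ≤ 1) (hδ : 0 < δ) (hxε : x ^ ε ≤ 9) :
    ∑ p ∈ primesLE K x, η p * Real.log (pnorm p) * (growthConst K * (x / pnorm p)) ≤
      growthConst K * |x| * (9 * (δ * growthConst K / ε + δ⁻¹ * weightSeries η ε)) := by
  have hG1 := one_le_growthConst (K := K)
  have h1 : ∀ p ∈ primesLE K x, η p * Real.log (pnorm p) * (growthConst K * (x / pnorm p)) ≤
      growthConst K * |x| * (9 / 2) * (δ * (Real.log (pnorm p) * pnorm p ^ (-(1 + ε))) +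
        δ⁻¹ * (η p ^ 2 * (Real.log (pnorm p) * pnorm p ^ (-(1 + ε))))) := by
    intro p hp
    have hp0 := pnorm_pos p
    have hpx := mem_primesLE.1 hp
    have hx0 : 0 < x := hp0.trans_le hpx
    have h2 : pnorm p ^ ε ≤ 9 := (Real.rpow_le_rpow hp0.le hpx hε.le).trans hxε
    set q := pnorm p ^ (-(1 + ε)) with hq
    have hq0 : 0 ≤ q := Real.rpow_nonneg hp0.le _
    have h3 : (pnorm p)⁻¹ ≤ 9 * q := by
      have : (pnorm p)⁻¹ = pnorm p ^ ε * q := by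
        rw [hq, ← Real.rpow_add hp0, ← Real.rpow_neg_one]; congr 1; ring
      rw [this]
      gcongr
    have h4 : 2 * η p ≤ δ + δ⁻¹ * η p ^ 2 := by
      have h5 : δ + δ⁻¹ * η p ^ 2 - 2 * η p = δ⁻¹ * (δ - η p) ^ 2 := by field_simp; ring
      have : 0 ≤ δ⁻¹ * (δ - η p) ^ 2 := by positivity
      linarith
    have hl := log_norm_nonneg p.toIdeals
    have hm : 0 ≤ δ + δ⁻¹ * η p ^ 2 := by positivity
    calc _ = growthConst K * x * ((2 * η p) * (Real.log (pnorm p) * (pnorm p)⁻¹)) / 2 := by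
          rw [div_eq_mul_inv x]; ring
      _ ≤ growthConst K * x * ((δ + δ⁻¹ * η p ^ 2) * (Real.log (pnorm p) * (9 * q))) / 2 := by
          have h6 : Real.log (pnorm p) * (pnorm p)⁻¹ ≤ Real.log (pnorm p) * (9 * q) :=
            mul_le_mul_of_nonneg_left h3 hl
          have h7 : 0 ≤ Real.log (pnorm p) * (pnorm p)⁻¹ :=
            mul_nonneg hl (inv_nonneg.2 hp0.le)
          gcongr
      _ = _ := by rw [abs_of_pos hx0]; ring
  refine (Finset.sum_le_sum h1).trans ?_
  rw [← Finset.mul_sum, Finset.sum_add_distrib, ← Finset.mul_sum, ← Finset.mul_sum]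
  have h2 := (linearGrowth_primes (K := K)).sum_rpow_le_one one_le_pnorm
    (show 1 < 1 + ε by linarith) (primesLE K x)
  have h3 := (summable_weight hη hε).sum_le_tsum (primesLE K x)
    fun p _ => weight_term_nonneg η ε p
  have h4 : growthConst K * ((1 + ε) / (1 + ε - 1)) ≤ 2 * (growthConst K / ε) := by
    rw [add_sub_cancel_left, mul_div_assoc', mul_div_assoc']
    refine div_le_div_of_nonneg_right ?_ hε.le
    nlinarith
  have h5 := weightSeries_nonneg η ε
  calc _ ≤ growthConst K * |x| * (9 / 2) * (δ * (2 * (growthConst K / ε)) +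
        δ⁻¹ * weightSeries η ε) := by
          gcongr
          · exact h2.trans h4
          · exact h3
    _ ≤ growthConst K * |x| * (9 / 2) * (δ * (2 * (growthConst K / ε)) +
        δ⁻¹ * (2 * weightSeries η ε)) := by
          gcongr
          linarith
    _ = _ := by ring

/-- The sum of the coefficients `c` over ideals, smoothed by the kernel `ker`, which vanishes at
the ideals of norm above `x`. -/
noncomputable def smoothSum (c : Ideals K → ℂ) (x : ℝ) : ℂ :=
  ∑ u ∈ idealsLE K x, c u * (ker (rnorm u / x) : ℂ)

/-- Replacing `log x` by `log 𝒩(u)` costs `O(x)`, and the logarithmic convolution identity turns the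
sum with weights `log 𝒩(u)` into sums over pairs of a prime and an ideal. -/
theorem log_mul_norm_smoothSum_le {g e : Ideals K → ℂ} (hg : IsMultiplicative g)
    (he : IsMultiplicative e) (hg1 : ∀ u, ‖g u‖ ≤ 1) (he1 : ∀ u, ‖e u‖ ≤ 1) {l : ℂ} {D : ℝ}
    (hl : ‖l‖ ≤ D) {η : Primes K → ℝ} (hη : ∀ p, ‖l‖ * ‖g p.toIdeals - e p.toIdeals‖ ≤ η p)
    {x : ℝ} (hx : 1 ≤ x) :
    Real.log x * ‖smoothSum (fun u => g u - l * e u) x‖ ≤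
      ‖∑ z ∈ pairsLE K x, primeLog g z.1 * (g z.2 - l * e z.2) *
        (ker (pnorm z.1 * rnorm z.2 / x) : ℂ)‖ +
      ∑ p ∈ primesLE K x, η p * Real.log (pnorm p) * (growthConst K * (x / pnorm p)) +
      2 * (1 + D) * growthConst K * x := by
  have hx0 : 0 < x := by linarith
  have hD : 0 ≤ D := (norm_nonneg _).trans hl
  set c : Ideals K → ℂ := fun u => g u - l * e u with hc
  have hcD : ∀ u, ‖c u‖ ≤ 1 + D := norm_sub_mul_le hg1 he1 hl
  have hk0 : ∀ u : Ideals K, 0 ≤ ker (rnorm u / x) := fun u => ker_nonneg _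
  have hk1 : ∀ u : Ideals K, ker (rnorm u / x) ≤ 1 := fun u =>
    ker_le_one (div_nonneg (rnorm_pos u).le hx0.le)
  have hnk : ∀ u : Ideals K, ‖(ker (rnorm u / x) : ℂ)‖ ≤ 1 := fun u => by
    rw [Complex.norm_real, Real.norm_of_nonneg (hk0 u)]; exact hk1 u
  have hle : ∀ u ∈ idealsLE K x, rnorm u ≤ x := fun u hu => mem_idealsLE.1 hu
  -- replacing `log x` by `log 𝒩(u)`
  have h1 : ‖∑ u ∈ idealsLE K x, c u * Real.log (x / rnorm u) * (ker (rnorm u / x) : ℂ)‖ ≤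
      (1 + D) * growthConst K * x := by
    have h2 := ((linearGrowth_const (K := K) (by linarith : 0 ≤ 1 + D))).sum_log_le
      (S := idealsLE K x) (fun u _ => rnorm_pos u) hle hx0.le
    refine (norm_sum_le _ _).trans ((Finset.sum_le_sum fun u hu => ?_).trans h2)
    have h3 : 0 ≤ Real.log (x / rnorm u) :=
      Real.log_nonneg ((one_le_div (rnorm_pos u)).2 (hle u hu))
    rw [norm_mul, norm_mul, Complex.norm_real (Real.log _), Real.norm_of_nonneg h3]
    calc _ ≤ (1 + D) * Real.log (x / rnorm u) * 1 := by
          gcongr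
          · exact hcD u
          · exact hnk u
      _ = _ := mul_one _
  have h4 : ‖∑ u ∈ idealsLE K x, (c u * Real.log (rnorm u) - (primeConv (primeLog g) c u +
      l * primeConv (primeLog fun v => g v - e v) e u)) * (ker (rnorm u / x) : ℂ)‖ ≤
      (1 + D) * growthConst K * x := by
    have h2 := (linearGrowth_defect (K := K)) (idealsLE K x) x hx0.le hle
    rw [mul_assoc]
    refine le_trans ?_ (mul_le_mul_of_nonneg_left h2 (by linarith : 0 ≤ 1 + D))
    rw [Finset.mul_sum]
    refine (norm_sum_le _ _).trans (Finset.sum_le_sum fun u _ => ?_)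
    rw [norm_mul]
    have h5 := norm_sub_mul_log_sub_le hg he hg1 he1 l u
    have h6 := defect_nonneg u
    calc _ ≤ (1 + ‖l‖) * defect u * 1 := by
          gcongr
          exact hnk u
      _ ≤ _ := by
          rw [mul_one]; gcongr
  have h5 : ‖l * ∑ z ∈ pairsLE K x, primeLog (fun v => g v - e v) z.1 * e z.2 *
      (ker (pnorm z.1 * rnorm z.2 / x) : ℂ)‖ ≤
      ∑ p ∈ primesLE K x, η p * Real.log (pnorm p) * (growthConst K * (x / pnorm p)) := by
    have h6 := norm_sum_pairs_ker_le_sum (a := fun p => l * primeLog (fun v => g v - e v) p)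
      (b := fun p => η p * Real.log (pnorm p)) (fun p => ?_) he1 hx0
    · refine le_of_eq_of_le ?_ h6
      rw [Finset.mul_sum]
      congr 1
      exact Finset.sum_congr rfl fun z _ => by ring
    · rw [primeLog, norm_mul, norm_mul, Complex.norm_real,
        Real.norm_of_nonneg (log_norm_nonneg _), ← mul_assoc]
      exact mul_le_mul_of_nonneg_right (hη p) (log_norm_nonneg _)
  have hdec : (Real.log x : ℂ) * smoothSum c x =
      (∑ z ∈ pairsLE K x, primeLog g z.1 * c z.2 * (ker (pnorm z.1 * rnorm z.2 / x) : ℂ)) +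
      l * (∑ z ∈ pairsLE K x, primeLog (fun v => g v - e v) z.1 * e z.2 *
        (ker (pnorm z.1 * rnorm z.2 / x) : ℂ)) +
      ((∑ u ∈ idealsLE K x, (c u * Real.log (rnorm u) - (primeConv (primeLog g) c u +
        l * primeConv (primeLog fun v => g v - e v) e u)) * (ker (rnorm u / x) : ℂ)) +
      ∑ u ∈ idealsLE K x, c u * Real.log (x / rnorm u) * (ker (rnorm u / x) : ℂ)) := by
    rw [← sum_primeConv_ker hx0, ← sum_primeConv_ker hx0, smoothSum, Finset.mul_sum,
      Finset.mul_sum, ← Finset.sum_add_distrib, ← Finset.sum_add_distrib,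
      ← Finset.sum_add_distrib]
    refine Finset.sum_congr rfl fun u _ => ?_
    rw [Real.log_div hx0.ne' (rnorm_pos u).ne']
    push_cast
    ring
  have hlog : 0 ≤ Real.log x := Real.log_nonneg hx
  have h6 : Real.log x * ‖smoothSum c x‖ = ‖(Real.log x : ℂ) * smoothSum c x‖ := by
    rw [norm_mul, Complex.norm_real, Real.norm_of_nonneg hlog]
  rw [h6, hdec]
  refine (norm_add_le _ _).trans ?_
  refine (add_le_add (norm_add_le _ _) (norm_add_le _ _)).trans ?_
  linarith

/-- With `ε = 1 / log X` the factor `x ^ ε` is bounded, and the sums over pairs are `o(X log X)`. -/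
theorem IsComparison.norm_smoothSum_le {g e : Ideals K → ℂ} {L : ℝ → ℂ} {η : Primes K → ℝ}
    {D : ℝ} (H : IsComparison g e L η D) {κ : ℝ} (hκ : 0 < κ) :
    ∀ᶠ X in atTop, ∀ x : ℝ, X ≤ x → x ≤ 3 * X →
      ‖smoothSum (fun u => g u - L X * e u) x‖ ≤ κ * X := by
  have hD : 0 ≤ D := (norm_nonneg _).trans (H.factor_le 0)
  have hG1 := one_le_growthConst (K := K)
  have hpi := Real.pi_pos
  set G := growthConst K with hG
  set C₁ : ℝ := 5 * (9 * Real.pi * G ^ 2 + 1) with hC₁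
  set C₂ : ℝ := 2 * Real.pi * ((1 + D) * G) ^ 2 with hC₂
  have hC₁0 : 0 < C₁ := by positivity
  have hC₂0 : 0 ≤ C₂ := by positivity
  -- `s` and `δ` are chosen so that the two terms that do not tend to zero are `κ / 4` each
  set s : ℝ := κ / (4 * (27 * C₁)) with hs
  have hs0 : 0 < s := by positivity
  set δ : ℝ := κ / (4 * (27 * G ^ 2)) with hδ
  have hδ0 : 0 < δ := by positivity
  -- the two parts that tend to zero
  have hlim : Tendsto (fun ε : ℝ => 27 * (C₂ / s) * ε + 27 * G * δ⁻¹ * (ε * weightSeries η ε) +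
      6 * (1 + D) * G * ε) (𝓝[>] 0) (𝓝 0) := by
    have hid : Tendsto (fun ε : ℝ => ε) (𝓝[>] 0) (𝓝 0) := nhdsWithin_le_nhds
    simpa using ((hid.const_mul (27 * (C₂ / s))).add
      ((tendsto_mul_weightSeries H.prime_summable).const_mul (27 * G * δ⁻¹))).add
      (hid.const_mul (6 * (1 + D) * G))
  have hev := tendsto_inv_log_atTop.eventually
    (hlim.eventually_lt_const (show (0 : ℝ) < κ / 4 by positivity))
  filter_upwards [H.integral_sq_mulLog_le hs0, hev, eventually_ge_atTop (Real.exp 1),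
    eventually_ge_atTop 3] with X hms hX hXe hX3 x hx1 hx2
  have hX0 : 0 < X := by linarith
  have hlogX : 1 ≤ Real.log X := by
    rw [Real.le_log_iff_exp_le hX0]; exact hXe
  set ε := (Real.log X)⁻¹ with hεdef
  have hε : 0 < ε := by positivity
  have hε1 : ε ≤ 1 := inv_le_one_of_one_le₀ hlogX
  have hx0 : 0 < x := by linarith
  have hxε : x ^ ε ≤ 9 := by
    have h1 : x ≤ X ^ 2 := by nlinarith
    have h2 : Real.log x ≤ 2 * Real.log X := by
      have := Real.log_le_log hx0 h1
      rwa [Real.log_pow, Nat.cast_ofNat] at this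
    have h3 : Real.log x * ε ≤ 2 := by
      rw [hεdef, ← div_eq_mul_inv, div_le_iff₀ (by linarith)]; exact h2
    rw [Real.rpow_def_of_pos hx0]
    refine (Real.exp_le_exp.2 h3).trans ?_
    have h4 : Real.exp 2 = Real.exp 1 ^ 2 := by rw [← Real.exp_nat_mul]; norm_num
    have h5 := Real.exp_one_lt_d9
    have h6 := Real.exp_pos 1
    rw [h4]
    nlinarith
  have hx1ε : x ^ (1 + ε) ≤ 27 * X := by
    rw [Real.rpow_add hx0, Real.rpow_one]
    nlinarith
  have hcD := norm_sub_mul_le H.left_le H.right_le (H.factor_le X)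
  have m1 := norm_sum_pairs_ker_le H.left_le hcD hε hε1 hs0 hx0 hms
  have m2 := sum_mul_log_div_le H.prime_summable hε hε1 hδ0 hxε
  have m := log_mul_norm_smoothSum_le H.mult_left H.mult_right H.left_le H.right_le
    (H.factor_le X) (H.prime_le X) (show 1 ≤ x by linarith)
  set S := ‖smoothSum (fun u => g u - L X * e u) x‖ with hS
  have hS0 : 0 ≤ S := norm_nonneg _
  have hlogx : Real.log X ≤ Real.log x := Real.log_le_log hX0 hx1
  have hW := weightSeries_nonneg η ε
  have hSlog : S ≤ ε * (Real.log x * S) := by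
    have : S = ε * (Real.log X * S) := by
      rw [hεdef]; field_simp
    calc S = ε * (Real.log X * S) := this
      _ ≤ _ := by gcongr
  have m1' : x ^ (1 + ε) * (C₁ * s / ε + C₂ / s) ≤ 27 * X * (C₁ * s / ε + C₂ / s) := by
    gcongr
  have m2' : G * |x| * (9 * (δ * G / ε + δ⁻¹ * weightSeries η ε)) ≤
      G * (3 * X) * (9 * (δ * G / ε + δ⁻¹ * weightSeries η ε)) := by
    rw [abs_of_pos hx0]
    gcongr
  have m3' : 2 * (1 + D) * G * x ≤ 2 * (1 + D) * G * (3 * X) := by gcongr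
  calc S ≤ ε * (Real.log x * S) := hSlog
    _ ≤ ε * (27 * X * (C₁ * s / ε + C₂ / s) +
        G * (3 * X) * (9 * (δ * G / ε + δ⁻¹ * weightSeries η ε)) +
        2 * (1 + D) * G * (3 * X)) := by
          gcongr
          linarith
    _ = X * (27 * C₁ * s + 27 * G ^ 2 * δ + (27 * (C₂ / s) * ε +
        27 * G * δ⁻¹ * (ε * weightSeries η ε) + 6 * (1 + D) * G * ε)) := by
          field_simp; ring
    _ ≤ X * (κ / 4 + κ / 4 + κ / 4) := by
          have e1 : 27 * C₁ * s = κ / 4 := by rw [hs]; field_simp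
          have e2 : 27 * G ^ 2 * δ = κ / 4 := by rw [hδ]; field_simp
          rw [e1, e2]
          gcongr
    _ ≤ κ * X := by nlinarith

/-! ### Removing the smoothing -/

theorem sq_mul_ker {n y : ℝ} (hy : 0 < y) : y ^ 2 * ker (n / y) = max (y - n) 0 ^ 2 := by
  rw [ker, ← mul_pow, mul_max_of_nonneg _ _ hy.le, mul_zero, mul_sub, mul_one,
    mul_div_cancel₀ _ hy.ne']

/-- A second difference of smoothed sums is, up to the factor `2 h²`, a sharp sum with a short
transition range. -/
theorem secondDiff_sub_indicator_le {X n : ℝ} {h' : ℝ} (hh : 0 < h') :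
    |max (X + 2 * h' - n) 0 ^ 2 - 2 * max (X + h' - n) 0 ^ 2 + max (X - n) 0 ^ 2 -
      if n ≤ X then 2 * h' ^ 2 else 0| ≤
      if X < n ∧ n ≤ X + 2 * h' then 2 * h' ^ 2 else 0 := by
  rcases le_or_gt n X with h1 | h1
  · rw [if_pos h1, if_neg (by intro h; linarith [h.1]), max_eq_left (by linarith),
      max_eq_left (by linarith), max_eq_left (by linarith), abs_nonpos_iff]
    ring
  · rw [if_neg (by linarith), max_eq_right (by linarith : X - n ≤ 0)]
    rcases le_or_gt n (X + 2 * h') with h2 | h2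
    · rw [if_pos ⟨h1, h2⟩, max_eq_left (by linarith)]
      rcases le_total n (X + h') with h3 | h3
      · rw [max_eq_left (by linarith), abs_le]
        constructor <;> nlinarith
      · rw [max_eq_right (by linarith), abs_le]
        constructor <;> nlinarith
    · rw [if_neg (by intro h; linarith [h.2]), max_eq_right (by linarith),
        max_eq_right (by linarith)]
      simp

theorem smoothSum_eq_sum (c : Ideals K → ℂ) {x y : ℝ} (hx : 0 < x) (hxy : x ≤ y) :
    smoothSum c x = ∑ u ∈ idealsLE K y, c u * (ker (rnorm u / x) : ℂ) := by
  refine Finset.sum_subset (idealsLE_subset hxy) fun u _ hu => ?_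
  rw [ker_eq_zero ((one_le_div hx).2 ?_)]
  · simp
  · by_contra! hlt
    exact hu (mem_idealsLE.2 hlt.le)

/-- The sharp sum is bounded by smoothed sums and by the number of ideals whose norm lies in the
transition range `(X, X + 2 h']`. -/
theorem norm_sum_idealsLE_le {c : Ideals K → ℂ} {B X h' : ℝ} (hc : ∀ u, ‖c u‖ ≤ B) (hX : 0 < X)
    (hh : 0 < h') :
    2 * h' ^ 2 * ‖∑ u ∈ idealsLE K X, c u‖ ≤ (X + 2 * h') ^ 2 * ‖smoothSum c (X + 2 * h')‖ +
      2 * ((X + h') ^ 2 * ‖smoothSum c (X + h')‖) + X ^ 2 * ‖smoothSum c X‖ +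
      2 * h' ^ 2 * (B * ((idealsLE K (X + 2 * h')).card - (idealsLE K X).card)) := by
  classical
  have hB : 0 ≤ B := (norm_nonneg _).trans (hc 1)
  set Y := X + 2 * h' with hY
  have hsub : idealsLE K X ⊆ idealsLE K Y := idealsLE_subset (by linarith)
  have hfil : (idealsLE K Y).filter (fun u => rnorm u ≤ X) = idealsLE K X := by
    ext u
    rw [Finset.mem_filter, mem_idealsLE, mem_idealsLE]
    constructor
    · exact fun h => h.2
    · exact fun h => ⟨by linarith, h⟩
  set w : Ideals K → ℝ := fun u => max (X + 2 * h' - rnorm u) 0 ^ 2 -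
    2 * max (X + h' - rnorm u) 0 ^ 2 + max (X - rnorm u) 0 ^ 2 with hw
  have e1 : ∑ u ∈ idealsLE K Y, c u * (w u : ℂ) = ((X + 2 * h') ^ 2 : ℝ) * smoothSum c (X + 2 * h') -
      2 * (((X + h') ^ 2 : ℝ) * smoothSum c (X + h')) + (X ^ 2 : ℝ) * smoothSum c X := by
    rw [smoothSum_eq_sum c hX (by linarith : X ≤ Y),
      smoothSum_eq_sum c (by linarith : 0 < X + h') (by linarith : X + h' ≤ Y),
      smoothSum_eq_sum c (by linarith : 0 < X + 2 * h') (by linarith : X + 2 * h' ≤ Y),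
      Finset.mul_sum, Finset.mul_sum, Finset.mul_sum, Finset.mul_sum, ← Finset.sum_sub_distrib,
      ← Finset.sum_add_distrib]
    refine Finset.sum_congr rfl fun u _ => ?_
    simp only [hw]
    rw [← sq_mul_ker hX, ← sq_mul_ker (by linarith : 0 < X + h'),
      ← sq_mul_ker (by linarith : 0 < X + 2 * h')]
    push_cast
    ring
  have e2 : ((2 * h' ^ 2 : ℝ) : ℂ) * ∑ u ∈ idealsLE K X, c u =
      ∑ u ∈ idealsLE K Y, c u * ((if rnorm u ≤ X then 2 * h' ^ 2 else 0 : ℝ) : ℂ) := by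
    rw [← hfil, Finset.sum_filter, Finset.mul_sum]
    refine Finset.sum_congr rfl fun u _ => ?_
    split_ifs <;> simp [mul_comm]
  have e3 : ‖∑ u ∈ idealsLE K Y, c u * ((if rnorm u ≤ X then 2 * h' ^ 2 else 0 : ℝ) : ℂ) -
      ∑ u ∈ idealsLE K Y, c u * (w u : ℂ)‖ ≤
      2 * h' ^ 2 * (B * ((idealsLE K Y).card - (idealsLE K X).card)) := by
    rw [← Finset.sum_sub_distrib]
    have h2 : ((idealsLE K Y).card : ℝ) - (idealsLE K X).card =
        ∑ u ∈ idealsLE K Y, if X < rnorm u ∧ rnorm u ≤ Y then 1 else 0 := by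
      have h3 : ∀ u ∈ idealsLE K Y, (if X < rnorm u ∧ rnorm u ≤ Y then (1 : ℝ) else 0) =
          1 - if rnorm u ≤ X then 1 else 0 := fun u hu => by
        have := mem_idealsLE.1 hu
        by_cases h4 : rnorm u ≤ X
        · rw [if_neg (by intro h; linarith [h.1]), if_pos h4]; ring
        · rw [if_pos ⟨not_le.1 h4, this⟩, if_neg h4]; ring
      rw [Finset.sum_congr rfl h3, Finset.sum_sub_distrib, ← Finset.sum_filter, hfil]
      simp
    rw [h2, Finset.mul_sum, Finset.mul_sum]
    refine (norm_sum_le _ _).trans (Finset.sum_le_sum fun u _ => ?_)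
    rw [← mul_sub, ← Complex.ofReal_sub, norm_mul, Complex.norm_real, Real.norm_eq_abs, abs_sub_comm]
    have h5 := secondDiff_sub_indicator_le (X := X) (n := rnorm u) hh
    calc _ ≤ B * _ := mul_le_mul (hc u) h5 (abs_nonneg _) hB
      _ = _ := by split_ifs <;> ring
  have e4 : 2 * h' ^ 2 * ‖∑ u ∈ idealsLE K X, c u‖ =
      ‖((2 * h' ^ 2 : ℝ) : ℂ) * ∑ u ∈ idealsLE K X, c u‖ := by
    rw [norm_mul, Complex.norm_real, Real.norm_of_nonneg (by positivity)]
  have e5 : ∀ (y : ℝ) (z : ℂ), ‖((y ^ 2 : ℝ) : ℂ) * z‖ = y ^ 2 * ‖z‖ := fun y z => by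
    rw [norm_mul, Complex.norm_real, Real.norm_of_nonneg (sq_nonneg y)]
  rw [e4, e2]
  have e6 := norm_add_le (∑ u ∈ idealsLE K Y, c u * ((if rnorm u ≤ X then 2 * h' ^ 2 else 0 : ℝ) : ℂ)
    - ∑ u ∈ idealsLE K Y, c u * (w u : ℂ)) (∑ u ∈ idealsLE K Y, c u * (w u : ℂ))
  rw [sub_add_cancel] at e6
  refine e6.trans ?_
  rw [add_comm]
  refine add_le_add ?_ e3
  rw [e1]
  refine (norm_add_le _ _).trans (add_le_add ((norm_sub_le _ _).trans (add_le_add ?_ ?_)) ?_)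
  · rw [e5]
  · rw [norm_mul, e5, Complex.norm_ofNat]
  · rw [e5]

/-- The number of ideals with norm in `(X, (1 + 2 ν) X]` is asymptotic to `2 ν R X`, where `R` is
the residue. -/
theorem eventually_card_sub_card_le {ν : ℝ} (hν : 0 < ν) :
    ∀ᶠ X : ℝ in atTop, ((idealsLE K (X + 2 * (ν * X))).card : ℝ) - (idealsLE K X).card ≤
      (2 * dedekindZeta_residue K + 1) * ν * X := by
  have hR := dedekindZeta_residue_pos K
  set R := dedekindZeta_residue K
  have h1 := tendsto_card_idealsLE_div K
  set δ := ν / (2 + 2 * ν) with hδ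
  have hδ0 : 0 < δ := by positivity
  have h2 := h1.eventually_lt_const (show R < R + δ by linarith)
  have h3 := h1.eventually_const_lt (show R - δ < R by linarith)
  have h4 : Tendsto (fun X : ℝ => (1 + 2 * ν) * X) atTop atTop :=
    tendsto_id.const_mul_atTop (by positivity)
  filter_upwards [h4.eventually h2, h3, eventually_gt_atTop 0] with X h5 h6 hX
  have h7 : X + 2 * (ν * X) = (1 + 2 * ν) * X := by ring
  rw [div_lt_iff₀ (by positivity)] at h5
  rw [lt_div_iff₀ hX] at h6
  rw [h7]
  have h8 : δ * (2 + 2 * ν) = ν := by rw [hδ]; field_simp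
  calc _ ≤ (R + δ) * ((1 + 2 * ν) * X) - (R - δ) * X := by linarith
    _ = (2 * R * ν + δ * (2 + 2 * ν)) * X := by ring
    _ = _ := by rw [h8]; ring

/-- Under the comparison hypotheses, the partial sums of `g` and of `L(X) e` differ by `o(X)`. -/
theorem IsComparison.isLittleO {g e : Ideals K → ℂ} {L : ℝ → ℂ} {η : Primes K → ℝ}
    {D : ℝ} (H : IsComparison g e L η D) :
    (fun X : ℝ => ∑ u ∈ idealsLE K X, (g u - L X * e u)) =o[atTop] fun X : ℝ => X := by
  have hD : 0 ≤ D := (norm_nonneg _).trans (H.factor_le 0)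
  have hR := dedekindZeta_residue_pos K
  set R := dedekindZeta_residue K
  refine isLittleO_iff.2 fun κ hκ => ?_
  -- the transition range has relative length `2 ν`, chosen so that it contributes at most `κ / 2`;
  -- the smoothed sums may then be divided by `ν²`
  set ν : ℝ := min 1 (κ / (2 * ((1 + D) * (2 * R + 1)))) with hν
  have hν0 : 0 < ν := lt_min one_pos (by positivity)
  have hν1 : ν ≤ 1 := min_le_left _ _
  have hνκ : (1 + D) * (2 * R + 1) * ν ≤ κ / 2 := by
    calc _ ≤ (1 + D) * (2 * R + 1) * (κ / (2 * ((1 + D) * (2 * R + 1)))) := by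
          gcongr; exact min_le_right _ _
      _ = _ := by field_simp
  filter_upwards [H.norm_smoothSum_le (show 0 < κ * ν ^ 2 / 18 by positivity),
    eventually_card_sub_card_le (K := K) hν0, eventually_gt_atTop 0] with X h1 h2 hX
  have h3 := norm_sum_idealsLE_le (norm_sub_mul_le H.left_le H.right_le (H.factor_le X)) hX
    (show 0 < ν * X by positivity)
  have hνX : ν * X ≤ X := by nlinarith
  have hνX0 : 0 < ν * X := by positivity
  have b1 := h1 (X + 2 * (ν * X)) (by linarith) (by linarith)
  have b2 := h1 (X + ν * X) (by linarith) (by linarith)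
  have b3 := h1 X le_rfl (by linarith)
  have hb0 : 0 ≤ κ * ν ^ 2 / 18 * X := by positivity
  have c1 : (X + 2 * (ν * X)) ^ 2 * ‖smoothSum (fun u => g u - L X * e u) (X + 2 * (ν * X))‖ ≤
      (3 * X) ^ 2 * (κ * ν ^ 2 / 18 * X) := by
    gcongr
    linarith
  have c2 : (X + ν * X) ^ 2 * ‖smoothSum (fun u => g u - L X * e u) (X + ν * X)‖ ≤
      (2 * X) ^ 2 * (κ * ν ^ 2 / 18 * X) := by
    gcongr
    linarith
  have c3 : X ^ 2 * ‖smoothSum (fun u => g u - L X * e u) X‖ ≤ X ^ 2 * (κ * ν ^ 2 / 18 * X) := by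
    gcongr
  have c4 : 2 * (ν * X) ^ 2 * ((1 + D) * (((idealsLE K (X + 2 * (ν * X))).card : ℝ) -
      (idealsLE K X).card)) ≤ 2 * (ν * X) ^ 2 * ((1 + D) * ((2 * R + 1) * ν * X)) := by
    gcongr
  have c5 : 2 * (ν * X) ^ 2 * ((1 + D) * ((2 * R + 1) * ν * X)) ≤
      2 * (ν * X) ^ 2 * (κ / 2 * X) := by
    have : (1 + D) * ((2 * R + 1) * ν * X) = ((1 + D) * (2 * R + 1) * ν) * X := by ring
    rw [this]
    gcongr
  rw [Real.norm_of_nonneg hX.le]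
  have c6 : 2 * (ν * X) ^ 2 * ‖∑ u ∈ idealsLE K X, (g u - L X * e u)‖ ≤
      2 * (ν * X) ^ 2 * (κ * X) := by
    refine (h3.trans (add_le_add (add_le_add (add_le_add c1
      (mul_le_mul_of_nonneg_left c2 zero_le_two)) c3) (c4.trans c5))).trans_eq ?_
    ring
  exact le_of_mul_le_mul_left c6 (by positivity)

/-! ### Euler products -/

/-- The ideals all of whose prime factors lie in a given finite set. -/
def smooth (S : Finset (Primes K)) : Set (Ideals K) := {u | primeDivs u ⊆ S}

theorem mem_smooth_empty {u : Ideals K} : u ∈ smooth (∅ : Finset (Primes K)) ↔ u = 1 := by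
  constructor
  · intro hu
    by_contra hne
    have h1 : (u : Ideal (𝓞 K)) ≠ ⊤ := fun h => hne (Subtype.ext (h.trans Ideal.one_eq_top.symm))
    obtain ⟨m, hm, hle⟩ := Ideal.exists_le_maximal _ h1
    have hm0 : m ≠ ⊥ := fun h => nonZeroDivisors.ne_zero u.2 (by
      rw [h] at hle; exact le_bot_iff.1 hle)
    have h2 : (⟨m, hm.isPrime, hm0⟩ : Primes K) ∈ primeDivs u :=
      mem_primeDivs.2 (dvd_iff_coe.2 (Ideal.dvd_iff_le.2 hle))
    exact absurd (hu h2) (Finset.notMem_empty _)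
  · rintro rfl p hp
    have h1 := mem_primeDivs.1 hp
    have h2 := two_le_norm_toIdeals p
    obtain ⟨c, hc⟩ := h1
    have h3 : norm (1 : Ideals K) = norm p.toIdeals * norm c := by rw [← idealNorm_mul, ← hc]
    rw [idealNorm_one] at h3
    have h4 : norm p.toIdeals = 1 := Nat.eq_one_of_mul_eq_one_right h3.symm
    rw [h4] at h2
    norm_num at h2

theorem not_dvd_of_mem_smooth {S : Finset (Primes K)} {p : Primes K} (hp : p ∉ S) {u : Ideals K}
    (hu : u ∈ smooth S) : ¬ p.toIdeals ∣ u := fun h => hp (hu (mem_primeDivs.2 h))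

/-- An ideal with all prime factors in `S ∪ {p}` splits into a power of `p` and an ideal with all
prime factors in `S`. -/
noncomputable def smoothEquiv [DecidableEq (Primes K)] {S : Finset (Primes K)} {p : Primes K}
    (hp : p ∉ S) :
    ℕ × smooth S ≃ smooth (insert p S) :=
  Equiv.ofBijective (fun z => ⟨p.toIdeals ^ z.1 * z.2.1, fun q hq => by
      rcases prime_dvd_mul (mem_primeDivs.1 hq) with h | h
      · exact Finset.mem_insert.2 (Or.inl (prime_dvd_pow h))
      · exact Finset.mem_insert_of_mem (z.2.2 (mem_primeDivs.2 h))⟩) <| by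
    constructor
    · rintro ⟨k, v, hv⟩ ⟨k', v', hv'⟩ heq
      have h1 : p.toIdeals ^ k * v = p.toIdeals ^ k' * v' := congrArg Subtype.val heq
      have h2 : k = k' := by
        rw [← val_pow_mul (not_dvd_of_mem_smooth hp hv) k, h1,
          val_pow_mul (not_dvd_of_mem_smooth hp hv') k']
      subst h2
      have h3 : v = v' := mul_left_cancel h1
      subst h3
      rfl
    · rintro ⟨u, hu⟩
      obtain ⟨k, w, rfl, hw⟩ := exists_eq_pow_mul p u
      refine ⟨(k, ⟨w, fun q hq => ?_⟩), rfl⟩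
      have hqw := mem_primeDivs.1 hq
      rcases Finset.mem_insert.1 (hu (mem_primeDivs.2 (hqw.mul_left _))) with h | h
      · subst h; exact absurd hqw hw
      · exact h

/-- The finite Euler product, for coefficients `a` that are multiplicative at prime powers and
absolutely summable. -/
theorem tsum_smooth_eq_prod {a : Ideals K → ℂ} (h1 : a 1 = 1)
    (hm : ∀ (p : Primes K) (k : ℕ) (w : Ideals K), ¬ p.toIdeals ∣ w →
      a (p.toIdeals ^ k * w) = a (p.toIdeals ^ k) * a w)
    (hs : Summable fun u => ‖a u‖) (S : Finset (Primes K)) :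
    ∑' u : smooth S, a u = ∏ p ∈ S, ∑' k : ℕ, a (p.toIdeals ^ k) := by
  classical
  induction S using Finset.induction_on with
  | empty =>
    have h2 : smooth (∅ : Finset (Primes K)) = {1} := Set.ext fun u => mem_smooth_empty
    rw [h2, Finset.prod_empty, tsum_singleton, h1]
  | insert p S hp ih =>
    have hinj : Function.Injective fun k : ℕ => p.toIdeals ^ k := by
      intro k k' h
      have h3 : ¬ p.toIdeals ∣ 1 := not_dvd_of_mem_smooth (S := ∅) (Finset.notMem_empty _)
        (mem_smooth_empty.2 rfl)
      rw [← val_pow_mul h3 k, ← val_pow_mul h3 k']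
      simpa using congrArg (val p) h
    rw [Finset.prod_insert hp, ← ih, ← (smoothEquiv hp).tsum_eq,
      tsum_mul_tsum_of_summable_norm (hs.comp_injective hinj) (hs.subtype _)]
    exact tsum_congr fun z => hm p z.1 z.2.1 (not_dvd_of_mem_smooth hp z.2.2)

/-- The Euler product, as a limit along the finite sets of primes: every ideal eventually has all
its prime factors in the set. -/
theorem tendsto_prod_tsum {a : Ideals K → ℂ} (h1 : a 1 = 1)
    (hm : ∀ (p : Primes K) (k : ℕ) (w : Ideals K), ¬ p.toIdeals ∣ w →
      a (p.toIdeals ^ k * w) = a (p.toIdeals ^ k) * a w)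
    (hs : Summable fun u => ‖a u‖) :
    Tendsto (fun S : Finset (Primes K) => ∏ p ∈ S, ∑' k : ℕ, a (p.toIdeals ^ k)) atTop
      (𝓝 (∑' u, a u)) := by
  classical
  have h2 : ∀ S : Finset (Primes K), ∏ p ∈ S, ∑' k : ℕ, a (p.toIdeals ^ k) =
      ∑' u, (smooth S).indicator a u := fun S => by
    rw [← tsum_smooth_eq_prod h1 hm hs, tsum_subtype]
  simp_rw [h2]
  refine tendsto_tsum_of_dominated_convergence hs (fun u => ?_) (.of_forall fun S u => ?_)
  · refine tendsto_const_nhds.congr' ?_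
    filter_upwards [eventually_ge_atTop (primeDivs u)] with S hS
    rw [Set.indicator_of_mem]
    exact hS
  · exact norm_indicator_le_norm_self a u

/-! ### Estimates for Euler factors -/

theorem norm_rnorm_cpow (u : Ideals K) (s : ℂ) : ‖(rnorm u : ℂ) ^ (-s)‖ = rnorm u ^ (-s.re) := by
  rw [Complex.norm_cpow_eq_rpow_re_of_pos (rnorm_pos u), Complex.neg_re]

theorem norm_pnorm_cpow_le (p : Primes K) {s : ℂ} (hs : 1 ≤ s.re) :
    ‖(pnorm p : ℂ) ^ (-s)‖ ≤ (pnorm p)⁻¹ := by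
  rw [norm_rnorm_cpow, ← Real.rpow_neg_one]
  exact Real.rpow_le_rpow_of_exponent_le (one_le_pnorm p) (by linarith)

theorem norm_term_h_le {g : Ideals K → ℂ} (hg1 : ∀ u, ‖g u‖ ≤ 1) (p : Primes K) {s : ℂ}
    (hs : 1 ≤ s.re) (k : ℕ) :
    ‖g (p.toIdeals ^ k) * (norm (p.toIdeals ^ k) : ℂ) ^ (-s)‖ ≤ (pnorm p)⁻¹ ^ k := by
  have h1 : ((norm (p.toIdeals ^ k) : ℕ) : ℂ) = ((rnorm (p.toIdeals ^ k) : ℝ) : ℂ) := by simp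
  rw [norm_mul, h1, norm_rnorm_cpow]
  have h2 : rnorm (p.toIdeals ^ k) ^ (-s.re) ≤ (pnorm p)⁻¹ ^ k := by
    rw [inv_pow]
    have h3 : rnorm (p.toIdeals ^ k) = pnorm p ^ k := by simp [rnorm, idealNorm_pow]
    rw [← h3, ← Real.rpow_neg_one]
    exact Real.rpow_le_rpow_of_exponent_le (one_le_norm _) (by linarith)
  have h4 := Real.rpow_nonneg (rnorm_pos (p.toIdeals ^ k)).le (-s.re)
  calc _ ≤ 1 * rnorm (p.toIdeals ^ k) ^ (-s.re) := mul_le_mul_of_nonneg_right (hg1 _) h4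
    _ ≤ _ := by rw [one_mul]; exact h2

theorem inv_pnorm_le_half (p : Primes K) : (pnorm p)⁻¹ ≤ 1 / 2 := by
  rw [one_div]
  exact inv_anti₀ two_pos (two_le_norm_toIdeals p)

theorem summable_inv_pnorm_pow (p : Primes K) : Summable fun k : ℕ => (pnorm p)⁻¹ ^ k :=
  summable_geometric_of_lt_one (inv_nonneg.2 (pnorm_pos p).le)
    (by linarith [inv_pnorm_le_half p])

theorem norm_h_sub_le {g : Ideals K → ℂ} (hg1 : ∀ u, ‖g u‖ ≤ 1) (p : Primes K) {s : ℂ}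
    (hs : 1 ≤ s.re) :
    ‖h g s p - g p.toIdeals * (pnorm p : ℂ) ^ (-s)‖ ≤ 2 * (pnorm p)⁻¹ ^ 2 := by
  have h1 := fun k => norm_term_h_le hg1 p hs k
  have hr := summable_inv_pnorm_pow p
  have hq := inv_pnorm_le_half p
  have hq0 : 0 ≤ (pnorm p)⁻¹ := inv_nonneg.2 (pnorm_pos p).le
  have hs1 : Summable fun k : ℕ => g (p.toIdeals ^ (k + 1)) *
      (norm (p.toIdeals ^ (k + 1)) : ℂ) ^ (-s) :=
    Summable.of_norm_bounded ((summable_nat_add_iff 1).2 hr) fun k => h1 (k + 1)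
  rw [h, hs1.tsum_eq_zero_add]
  have h2 : g (p.toIdeals ^ (0 + 1)) * (norm (p.toIdeals ^ (0 + 1)) : ℂ) ^ (-s) =
      g p.toIdeals * (pnorm p : ℂ) ^ (-s) := by simp
  rw [h2, add_sub_cancel_left]
  have h3 : ∀ k : ℕ, (pnorm p)⁻¹ ^ (k + 1 + 1) = (pnorm p)⁻¹ ^ 2 * (pnorm p)⁻¹ ^ k := fun k => by
    ring
  refine (tsum_of_norm_bounded (g := fun k : ℕ => (pnorm p)⁻¹ ^ 2 * (pnorm p)⁻¹ ^ k)
    (hr.hasSum.mul_left _) fun k => (h1 (k + 1 + 1)).trans_eq (h3 k)).trans ?_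
  rw [tsum_geometric_of_lt_one hq0 (by linarith), mul_comm]
  refine mul_le_mul_of_nonneg_right ?_ (sq_nonneg _)
  rw [inv_le_comm₀ (by linarith) two_pos]
  linarith

theorem tsum_pow_eq_one_add_h {g : Ideals K → ℂ} (hg1 : ∀ u, ‖g u‖ ≤ 1) (hg : g 1 = 1)
    (p : Primes K) {s : ℂ} (hs : 1 ≤ s.re) :
    ∑' k : ℕ, g (p.toIdeals ^ k) * (rnorm (p.toIdeals ^ k) : ℂ) ^ (-s) = 1 + h g s p := by
  have hs1 : Summable fun k : ℕ => g (p.toIdeals ^ k) *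
      (norm (p.toIdeals ^ k) : ℂ) ^ (-s) :=
    Summable.of_norm_bounded (summable_inv_pnorm_pow p) fun k => norm_term_h_le hg1 p hs k
  simp only [rnorm, Complex.ofReal_natCast]
  rw [hs1.tsum_eq_zero_add, pow_zero, hg, idealNorm_one, h]
  simp

theorem tendsto_prod_one_add_h {g : Ideals K → ℂ} (hg : IsMultiplicative g)
    (hg1 : ∀ u, ‖g u‖ ≤ 1) (h1 : g 1 = 1) {s : ℂ} (hs : 1 < s.re) :
    Tendsto (fun S : Finset (Primes K) => ∏ p ∈ S, (1 + h g s p)) atTop (𝓝 (dser rnorm g s)) := by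
  have h2 := tendsto_prod_tsum (a := fun u => g u * (rnorm u : ℂ) ^ (-s))
    (by simp [h1, idealNorm_one]) (fun p k w hw => ?_) ?_
  · refine h2.congr fun S => Finset.prod_congr rfl fun p _ => ?_
    exact tsum_pow_eq_one_add_h hg1 h1 p hs.le
  · rw [hg.pow_mul hw, rnorm, idealNorm_mul, Nat.cast_mul, Complex.ofReal_mul,
      Complex.mul_cpow_ofReal_nonneg (rnorm_pos _).le (rnorm_pos _).le]
    ring
  · refine (summable_ideals hg1 hs).congr fun u => ?_
    rw [norm_mul, norm_rnorm_cpow]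

theorem one_add_h_one (p : Primes K) {s : ℂ} (hs : 1 ≤ s.re) :
    1 + h (fun _ => 1) s p = (1 - (pnorm p : ℂ) ^ (-s))⁻¹ := by
  rw [← tsum_pow_eq_one_add_h (by simp) rfl p hs, ← tsum_geometric_of_norm_lt_one]
  · refine tsum_congr fun k => ?_
    rw [one_mul]
    induction k with
    | zero => simp [idealNorm_one]
    | succ k ih =>
      rw [pow_succ', rnorm_toIdeals_mul, Complex.ofReal_mul,
        Complex.mul_cpow_ofReal_nonneg (pnorm_pos _).le (rnorm_pos _).le, ih, pow_succ']
  · exact (norm_pnorm_cpow_le p hs).trans_lt (by linarith [inv_pnorm_le_half p])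

/-- The inequality `|1 + z|² ≤ exp (2 Re z + |z|²)`, with room for an error `w`. The factor three
comes from `exp (-1) ≥ 1 / 3`, as `Re z ≥ -1`. -/
theorem norm_one_add_add_le {z w : ℂ} (hz : ‖z‖ ≤ 1) :
    ‖1 + z + w‖ ≤ Real.exp (z.re + ‖z‖ ^ 2 / 2 + 3 * ‖w‖) := by
  have h1 : ‖1 + z‖ ≤ Real.exp (z.re + ‖z‖ ^ 2 / 2) := by
    have h2 : ‖1 + z‖ ^ 2 = 1 + (2 * z.re + ‖z‖ ^ 2) := by
      rw [← Complex.normSq_eq_norm_sq, ← Complex.normSq_eq_norm_sq, Complex.normSq_apply,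
        Complex.normSq_apply]
      simp
      ring
    refine (sq_le_sq₀ (norm_nonneg _) (Real.exp_pos _).le).1 ?_
    rw [h2, ← Real.exp_nat_mul, add_comm]
    refine (Real.add_one_le_exp _).trans_eq ?_
    congr 1
    push_cast
    ring
  have h3 : 1 ≤ 3 * Real.exp (z.re + ‖z‖ ^ 2 / 2) := by
    have h4 : -1 ≤ z.re + ‖z‖ ^ 2 / 2 := by
      have := (Complex.abs_re_le_norm z).trans hz
      have := neg_le_of_abs_le this
      nlinarith [sq_nonneg ‖z‖]
    have h5 := Real.exp_le_exp.2 h4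
    have h6 : (1 : ℝ) ≤ 3 * Real.exp (-1) := by
      rw [Real.exp_neg, ← div_eq_mul_inv, one_le_div (Real.exp_pos _)]
      linarith [Real.exp_one_lt_d9]
    linarith
  set E := Real.exp (z.re + ‖z‖ ^ 2 / 2)
  have hE : 0 ≤ E := (Real.exp_pos _).le
  rw [Real.exp_add]
  have h7 := Real.add_one_le_exp (3 * ‖w‖)
  calc _ ≤ ‖1 + z‖ + ‖w‖ := norm_add_le _ _
    _ ≤ E + ‖w‖ * (3 * E) := by nlinarith [norm_nonneg w]
    _ = E * (3 * ‖w‖ + 1) := by ring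
    _ ≤ _ := by gcongr

theorem norm_one_add_h_le {g : Ideals K → ℂ} (hg1 : ∀ u, ‖g u‖ ≤ 1) (p : Primes K) {s : ℂ}
    (hs : 1 ≤ s.re) :
    ‖1 + h g s p‖ ≤
      Real.exp ((g p.toIdeals * (pnorm p : ℂ) ^ (-s)).re + 7 * (pnorm p)⁻¹ ^ 2) := by
  set z := g p.toIdeals * (pnorm p : ℂ) ^ (-s)
  have hq0 : 0 ≤ (pnorm p)⁻¹ := inv_nonneg.2 (pnorm_pos p).le
  have h1 : ‖z‖ ≤ (pnorm p)⁻¹ := by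
    rw [norm_mul]
    exact (mul_le_of_le_one_left (norm_nonneg _) (hg1 _)).trans (norm_pnorm_cpow_le p hs)
  have h2 := norm_h_sub_le hg1 p hs
  have h3 := norm_one_add_add_le (z := z) (w := h g s p - z)
    (h1.trans (by linarith [inv_pnorm_le_half p]))
  rw [show 1 + z + (h g s p - z) = 1 + h g s p by ring] at h3
  refine h3.trans (Real.exp_le_exp.2 ?_)
  have h4 : ‖z‖ ^ 2 ≤ (pnorm p)⁻¹ ^ 2 := pow_le_pow_left₀ (norm_nonneg _) h1 2
  nlinarith

theorem norm_one_sub_le (p : Primes K) {s : ℂ} (hs : 1 ≤ s.re) :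
    ‖1 - (pnorm p : ℂ) ^ (-s)‖ ≤
      Real.exp (-((pnorm p : ℂ) ^ (-s)).re + (pnorm p)⁻¹ ^ 2) := by
  have h1 := norm_pnorm_cpow_le p hs
  have h3 := norm_one_add_add_le (z := -(pnorm p : ℂ) ^ (-s)) (w := 0)
    (by rw [norm_neg]; exact h1.trans (by linarith [inv_pnorm_le_half p]))
  rw [add_zero, ← sub_eq_add_neg, norm_neg, Complex.neg_re, norm_zero] at h3
  refine h3.trans (Real.exp_le_exp.2 ?_)
  have h4 : ‖(pnorm p : ℂ) ^ (-s)‖ ^ 2 ≤ (pnorm p)⁻¹ ^ 2 := pow_le_pow_left₀ (norm_nonneg _) h1 2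
  nlinarith [sq_nonneg (pnorm p)⁻¹]

variable (K) in
theorem summable_inv_pnorm_sq : Summable fun p : Primes K => (pnorm p)⁻¹ ^ 2 := by
  have h1 := ((linearGrowth_ideals (K := K)).summable one_le_norm (fun _ => zero_le_one)
    one_lt_two).comp_injective toIdeals_injective
  refine h1.congr fun p => ?_
  simp only [Function.comp, one_mul]
  rw [Real.rpow_neg (pnorm_pos p).le, Real.rpow_two, inv_pow]

variable (K) in
/-- The sum of the inverse squares of the norms of the primes. -/
noncomputable def primeSq : ℝ := ∑' p : Primes K, (pnorm p)⁻¹ ^ 2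

theorem sum_inv_pnorm_sq_le (S : Finset (Primes K)) : ∑ p ∈ S, (pnorm p)⁻¹ ^ 2 ≤ primeSq K :=
  (summable_inv_pnorm_sq K).sum_le_tsum S fun _ _ => sq_nonneg _

/-- The Dedekind zeta function on the half-plane of convergence. -/
noncomputable abbrev zeta (K : Type*) [Field K] [NumberField K] (s : ℂ) : ℂ :=
  dser (rnorm (K := K)) (fun _ => 1) s

omit [NumberField K] in
theorem isMultiplicative_one : IsMultiplicative (fun _ : Ideals K => (1 : ℂ)) := fun _ _ _ => by simp

theorem tendsto_prod_zeta {s : ℂ} (hs : 1 < s.re) :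
    Tendsto (fun S : Finset (Primes K) => ∏ p ∈ S, (1 - (pnorm p : ℂ) ^ (-s))⁻¹) atTop
      (𝓝 (zeta K s)) :=
  (tendsto_prod_one_add_h isMultiplicative_one (by simp) rfl hs).congr fun _ =>
    Finset.prod_congr rfl fun p _ => one_add_h_one p hs.le

theorem one_sub_cpow_ne_zero (p : Primes K) {s : ℂ} (hs : 1 ≤ s.re) :
    1 - (pnorm p : ℂ) ^ (-s) ≠ 0 := fun h0 => by
  have h1 := norm_pnorm_cpow_le p hs
  rw [← sub_eq_zero.1 h0, norm_one] at h1
  linarith [inv_pnorm_le_half p]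

/-- `exp (Re ∑ 𝒩(p)^(-s))` is at most a constant times the Euler product of the zeta function. -/
theorem exp_sum_re_le {s : ℂ} (hs : 1 ≤ s.re) (S : Finset (Primes K)) :
    Real.exp (∑ p ∈ S, ((pnorm p : ℂ) ^ (-s)).re) ≤
      Real.exp (primeSq K) * ‖∏ p ∈ S, (1 - (pnorm p : ℂ) ^ (-s))⁻¹‖ := by
  have h1 : ∀ p ∈ S, Real.exp (((pnorm p : ℂ) ^ (-s)).re) ≤
      Real.exp ((pnorm p)⁻¹ ^ 2) * ‖(1 - (pnorm p : ℂ) ^ (-s))⁻¹‖ := fun p _ => by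
    have h2 := norm_one_sub_le p hs
    have h3 : 0 < ‖1 - (pnorm p : ℂ) ^ (-s)‖ := norm_pos_iff.2 (one_sub_cpow_ne_zero p hs)
    rw [norm_inv, ← div_eq_mul_inv, le_div_iff₀ h3]
    calc _ ≤ _ := mul_le_mul_of_nonneg_left h2 (Real.exp_pos _).le
      _ = _ := by rw [← Real.exp_add]; congr 1; ring
  rw [Real.exp_sum, norm_prod]
  calc _ ≤ _ := Finset.prod_le_prod (fun p _ => (Real.exp_pos _).le) h1
    _ = Real.exp (∑ p ∈ S, (pnorm p)⁻¹ ^ 2) * ∏ p ∈ S, ‖(1 - (pnorm p : ℂ) ^ (-s))⁻¹‖ := by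
        rw [Finset.prod_mul_distrib, Real.exp_sum]
    _ ≤ _ := by
        gcongr
        exact sum_inv_pnorm_sq_le S

theorem norm_prod_one_add_h_le {g : Ideals K → ℂ} (hg1 : ∀ u, ‖g u‖ ≤ 1) {s : ℂ}
    (hs : 1 ≤ s.re) (S : Finset (Primes K)) :
    ‖∏ p ∈ S, (1 + h g s p)‖ ≤ Real.exp (7 * primeSq K) *
      Real.exp (∑ p ∈ S, (g p.toIdeals * (pnorm p : ℂ) ^ (-s)).re) := by
  rw [norm_prod]
  refine (Finset.prod_le_prod (fun p _ => norm_nonneg _)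
    fun p _ => norm_one_add_h_le hg1 p hs).trans ?_
  rw [← Real.exp_sum, Finset.sum_add_distrib, ← Finset.mul_sum, ← Real.exp_add, add_comm]
  gcongr
  exact sum_inv_pnorm_sq_le S

/-! ### Functions far from every power of the norm -/

/-- The term `𝒩(p)^(-σ) - Re (g(p) 𝒩(p)^(-s))`, where `σ = Re s`. -/
noncomputable def gap (g : Ideals K → ℂ) (s : ℂ) (p : Primes K) : ℝ :=
  pnorm p ^ (-s.re) - (g p.toIdeals * (pnorm p : ℂ) ^ (-s)).re

theorem gap_nonneg {g : Ideals K → ℂ} (hg1 : ∀ u, ‖g u‖ ≤ 1) (s : ℂ) (p : Primes K) :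
    0 ≤ gap g s p := by
  refine sub_nonneg.2 ((Complex.re_le_norm _).trans ?_)
  rw [norm_mul, norm_rnorm_cpow]
  exact mul_le_of_le_one_left (Real.rpow_nonneg (pnorm_pos p).le _) (hg1 _)

theorem cpow_re_ofReal (p : Primes K) (s : ℂ) :
    ((pnorm p : ℂ) ^ (-(s.re : ℂ))).re = pnorm p ^ (-s.re) := by
  rw [← Complex.ofReal_neg, ← Complex.ofReal_cpow (pnorm_pos p).le, Complex.ofReal_re]

/-- In the half-plane of convergence the Euler product gives
`|G(s)| ≪ ζ(Re s) exp (-∑ gap g s p)`, and the nonnegative sum may be truncated to a finite set. -/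
theorem norm_dser_le_zeta_mul_exp {g : Ideals K → ℂ} (hg : IsMultiplicative g)
    (hg1 : ∀ u, ‖g u‖ ≤ 1) (h1 : g 1 = 1) {s : ℂ} (hs : 1 < s.re) (S : Finset (Primes K)) :
    ‖dser rnorm g s‖ ≤ Real.exp (8 * primeSq K) * ‖zeta K s.re‖ *
      Real.exp (-∑ p ∈ S, gap g s p) := by
  have hlim := ((tendsto_prod_zeta (K := K) (s := s.re) (by simpa using hs)).norm.const_mul
    (Real.exp (8 * primeSq K))).mul_const (Real.exp (-∑ p ∈ S, gap g s p))
  refine le_of_tendsto_of_tendsto (tendsto_prod_one_add_h hg hg1 h1 hs).norm hlim ?_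
  filter_upwards [eventually_ge_atTop S] with T hT
  refine (norm_prod_one_add_h_le hg1 hs.le T).trans ?_
  have h2 : ∑ p ∈ T, (g p.toIdeals * (pnorm p : ℂ) ^ (-s)).re ≤
      ∑ p ∈ T, ((pnorm p : ℂ) ^ (-(s.re : ℂ))).re - ∑ p ∈ S, gap g s p := by
    have h3 : ∑ p ∈ S, gap g s p ≤ ∑ p ∈ T, gap g s p :=
      Finset.sum_le_sum_of_subset_of_nonneg hT fun p _ _ => gap_nonneg hg1 s p
    have h4 : ∑ p ∈ T, gap g s p = ∑ p ∈ T, ((pnorm p : ℂ) ^ (-(s.re : ℂ))).re -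
        ∑ p ∈ T, (g p.toIdeals * (pnorm p : ℂ) ^ (-s)).re := by
      rw [← Finset.sum_sub_distrib]
      exact Finset.sum_congr rfl fun p _ => by rw [gap, cpow_re_ofReal]
    linarith
  have h5 := exp_sum_re_le (s := s.re) (by simpa using hs.le) T
  calc _ ≤ Real.exp (7 * primeSq K) * Real.exp (∑ p ∈ T, ((pnorm p : ℂ) ^ (-(s.re : ℂ))).re -
        ∑ p ∈ S, gap g s p) := by gcongr
    _ = Real.exp (7 * primeSq K) * Real.exp (∑ p ∈ T, ((pnorm p : ℂ) ^ (-(s.re : ℂ))).re) *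
        Real.exp (-∑ p ∈ S, gap g s p) := by rw [sub_eq_add_neg, Real.exp_add]; ring
    _ ≤ Real.exp (7 * primeSq K) * (Real.exp (primeSq K) *
        ‖∏ p ∈ T, (1 - (pnorm p : ℂ) ^ (-(s.re : ℂ)))⁻¹‖) *
        Real.exp (-∑ p ∈ S, gap g s p) := by gcongr
    _ = _ := by
        rw [← mul_assoc, ← Real.exp_add]
        congr 3
        ring

theorem norm_zeta_le {s : ℂ} (hs : 1 < s.re) :
    ‖zeta K s‖ ≤ growthConst K * (s.re / (s.re - 1)) := by
  have h1 := norm_dser_ideals_le (c := fun _ : Ideals K => (1 : ℂ)) (B := 1) (by simp) hs s.im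
  rwa [Complex.re_add_im, one_mul] at h1

theorem continuous_gap (g : Ideals K → ℂ) (p : Primes K) : Continuous fun s => gap g s p := by
  have hp := (pnorm_pos p).ne'
  refine Continuous.sub ?_ ?_
  · exact Continuous.rpow continuous_const (by fun_prop) fun _ => Or.inl hp
  · refine Complex.continuous_re.comp (continuous_const.mul ?_)
    exact Continuous.const_cpow (by fun_prop) (Or.inl (by exact_mod_cast hp))

theorem star_normPow (t : ℝ) (u : Ideals K) :
    starRingEnd ℂ (normPow t u) = (rnorm u : ℂ) ^ (-(t * Complex.I)) := by
  have h1 : normPow t u = (rnorm u : ℂ) ^ (t * Complex.I) := by simp [normPow]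
  have h2 : (rnorm u : ℂ).arg ≠ Real.pi := by
    rw [Complex.arg_ofReal_of_nonneg (rnorm_pos u).le]
    exact Real.pi_pos.ne
  have h3 := Complex.cpow_conj (rnorm u : ℂ) (t * Complex.I) h2
  rw [Complex.conj_ofReal] at h3
  rw [h1, ← h3]
  simp

/-- On the line `Re s = 1` the gaps are the terms of the distance from `g` to `𝒩^(it)`. -/
theorem gap_one_add (g : Ideals K → ℂ) (t : ℝ) (p : Primes K) :
    gap g (1 + t * Complex.I) p =
      (1 - (g p.toIdeals * starRingEnd ℂ (normPow t p.toIdeals)).re) / pnorm p := by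
  have hp := pnorm_pos p
  have hp' : (pnorm p : ℂ) ≠ 0 := by exact_mod_cast hp.ne'
  have h1 : (1 + t * Complex.I : ℂ).re = 1 := by simp
  have h2 : (pnorm p : ℂ) ^ (-(1 + t * Complex.I)) =
      ((pnorm p)⁻¹ : ℝ) * starRingEnd ℂ (normPow t p.toIdeals) := by
    rw [star_normPow, neg_add, Complex.cpow_add _ _ hp', Complex.cpow_neg_one,
      Complex.ofReal_inv]
  rw [gap, h1, h2, Real.rpow_neg_one, mul_left_comm, Complex.re_ofReal_mul]
  field_simp

theorem exists_lt_sum_gap {g : Ideals K → ℂ} (hg1 : ∀ u, ‖g u‖ ≤ 1) {t : ℝ}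
    (ht : dist g (normPow t) = ⊤) (M : ℝ) :
    ∃ S : Finset (Primes K), M < ∑ p ∈ S, gap g (1 + t * Complex.I) p := by
  by_contra! hM
  rw [dist, ENNReal.tsum_eq_iSup_sum] at ht
  refine absurd ht (ne_of_lt (lt_of_le_of_lt (iSup_le fun S => ?_) (ENNReal.ofReal_lt_top (r := M))))
  rw [← ENNReal.ofReal_sum_of_nonneg]
  · refine ENNReal.ofReal_le_ofReal ((Finset.sum_le_sum fun p _ => ?_).trans (hM S))
    exact (gap_one_add g t p).ge
  · intro p _
    exact (gap_nonneg hg1 _ p).trans_eq (gap_one_add g t p)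

/-- Uniformity in `t` by compactness: at each `t` a finite set of primes already has a large sum of
gaps, and by continuity it also has one at all neighbouring points. The finite set may depend on
`t`. -/
theorem eventually_forall_exists_sum_gap {g : Ideals K → ℂ} (hg1 : ∀ u, ‖g u‖ ≤ 1)
    (hd : ∀ t, dist g (normPow t) = ⊤) (M T : ℝ) :
    ∀ᶠ β : ℝ in 𝓝 0, ∀ t ∈ Set.Icc (-T) T, ∃ S : Finset (Primes K),
      M < ∑ p ∈ S, gap g ((1 + β : ℝ) + t * Complex.I) p := by
  refine isCompact_Icc.eventually_forall_of_forall_eventually fun t _ => ?_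
  obtain ⟨S, hS⟩ := exists_lt_sum_gap hg1 (hd t) M
  have hc : Continuous fun z : ℝ × ℝ => ∑ p ∈ S, gap g ((1 + z.1 : ℝ) + z.2 * Complex.I) p :=
    continuous_finsetSum _ fun p _ => (continuous_gap g p).comp (by fun_prop)
  have h1 : M < ∑ p ∈ S, gap g ((1 + (0 : ℝ) : ℝ) + t * Complex.I) p := by simpa using hS
  filter_upwards [hc.continuousAt.eventually (lt_mem_nhds h1)] with z hz
  exact ⟨S, hz⟩

theorem one_le_sqrt_one_add_sq (t : ℝ) : 1 ≤ Real.sqrt (1 + t ^ 2) :=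
  Real.one_le_sqrt.2 (by nlinarith)

theorem abs_le_sqrt_one_add_sq (t : ℝ) : |t| ≤ Real.sqrt (1 + t ^ 2) := by
  refine Real.le_sqrt_of_sq_le ?_
  rw [sq_abs]
  linarith

/-- If `g` is at infinite distance from every `𝒩^(it)`, its Dirichlet series is `o(1 / β)` on the
lines `Re s = 1 + β`, uniformly at bounded height, so that `g` can be compared with zero. -/
theorem isComparison_zero {g : Ideals K → ℂ} (hg : IsMultiplicative g) (hg1 : ∀ u, ‖g u‖ ≤ 1)
    (h1 : g 1 = 1) (hd : ∀ t, dist g (normPow t) = ⊤) :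
    IsComparison g (fun _ => 1) (fun _ => 0) (fun _ => 0) 0 where
  mult_left := hg
  mult_right := isMultiplicative_one
  left_le := hg1
  right_le := by simp
  factor_le := by simp
  prime_nonneg := by simp
  prime_le := by simp
  prime_summable := by simp
  close := by
    intro δ hδ B
    have hG1 := one_le_growthConst (K := K)
    set G := growthConst K
    -- above the height `T` the trivial bound for the series is sufficient
    set T : ℝ := 2 * G / δ with hT
    set C : ℝ := Real.exp (8 * primeSq K) * (2 * G) with hC
    have hC0 : 0 < C := by positivity
    set M : ℝ := Real.log (C / δ) with hM
    have hexp : C * Real.exp (-M) = δ := by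
      rw [hM, Real.exp_neg, Real.exp_log (by positivity)]
      field_simp
    have hev := eventually_forall_exists_sum_gap hg1 hd M T
    obtain ⟨β₀, hβ₀, hball⟩ := Metric.eventually_nhds_iff.1 hev
    have hlim : Tendsto (fun X : ℝ => B * (Real.log X)⁻¹) atTop (𝓝 0) := by
      simpa using (tendsto_inv_log_atTop.mono_right nhdsWithin_le_nhds).const_mul B
    filter_upwards [hlim.eventually_lt_const (lt_min hβ₀ one_pos),
      tendsto_inv_log_atTop.eventually self_mem_nhdsWithin] with X hX hε β hβ1 hβ2 t
    have hβ : 0 < β := lt_of_lt_of_le hε hβ1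
    have hββ₀ : β < β₀ := (hβ2.trans_lt hX).trans_le (min_le_left _ _)
    have hβ1' : β < 1 := (hβ2.trans_lt hX).trans_le (min_le_right _ _)
    have hre : ((1 + β : ℝ) + t * Complex.I : ℂ).re = 1 + β := by simp
    have hratio : (1 + β) / (1 + β - 1) ≤ 2 / β := by
      rw [add_sub_cancel_left]; gcongr; linarith
    rw [zero_mul, sub_zero]
    rcases le_or_gt |t| T with ht | ht
    · obtain ⟨S, hS⟩ := hball (y := β)
        (by rw [Real.dist_eq, sub_zero, abs_of_pos hβ]; exact hββ₀) t (abs_le.1 ht)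
      have h2 := norm_dser_le_zeta_mul_exp hg hg1 h1 (s := (1 + β : ℝ) + t * Complex.I)
        (by rw [hre]; linarith) S
      rw [hre] at h2
      have h3 := norm_zeta_le (K := K) (s := (1 + β : ℝ)) (by simpa using hβ)
      rw [Complex.ofReal_re] at h3
      have h4 := one_le_sqrt_one_add_sq t
      calc _ ≤ _ := h2
        _ ≤ Real.exp (8 * primeSq K) * (G * (2 / β)) * Real.exp (-M) := by
            gcongr
            exact h3.trans (by gcongr)
        _ = C * Real.exp (-M) * 1 / β := by rw [hC]; ring
        _ ≤ _ := by rw [hexp]; gcongr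
    · have h2 := norm_dser_ideals_le hg1 (show 1 < 1 + β by linarith) t
      have h3 : 2 * G ≤ δ * Real.sqrt (1 + t ^ 2) := by
        have h4 := abs_le_sqrt_one_add_sq t
        rw [hT, div_lt_iff₀ hδ] at ht
        nlinarith
      calc _ ≤ 1 * G * (2 / β) := h2.trans (by gcongr)
        _ = 2 * G / β := by ring
        _ ≤ _ := by gcongr

omit [NumberField K] in
theorem one_add_eq_one (u : Ideals K) : ((1 : Ideals K) : Ideal (𝓞 K)) + (u : Ideal (𝓞 K)) = 1 := by
  have : ((1 : Ideals K) : Ideal (𝓞 K)) = 1 := rfl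
  rw [this, Ideal.one_eq_top]
  exact top_sup_eq _

omit [NumberField K] in
/-- Multiplicativity does not exclude the zero function, as `g 1 = 1` is not part of it. -/
theorem IsMultiplicative.eq_zero_or_map_one {g : Ideals K → ℂ} (hg : IsMultiplicative g) :
    (∀ u, g u = 0) ∨ g 1 = 1 := by
  have h1 : ∀ u, g u = g 1 * g u := fun u => by simpa using hg 1 u (one_add_eq_one u)
  by_cases h0 : g 1 = 0
  · exact Or.inl fun u => by rw [h1, h0, zero_mul]
  · exact Or.inr (mul_left_cancel₀ h0 (by rw [mul_one]; exact (h1 1).symm))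

theorem tendsto_mean_zero {g : Ideals K → ℂ} (hg : IsMultiplicative g) (hg1 : ∀ u, ‖g u‖ ≤ 1)
    (hd : ∀ t, dist g (normPow t) = ⊤) : Tendsto (fun x : ℝ => mean g x) atTop (𝓝 0) := by
  have h1 : (fun x : ℝ => ∑ u ∈ idealsLE K x, g u) =o[atTop] fun x : ℝ => x := by
    rcases hg.eq_zero_or_map_one with h0 | h0
    · simp [h0]
    · simpa using (isComparison_zero hg hg1 h0 hd).isLittleO
  have h2 := (tendsto_card_idealsLE_div K).inv₀ (dedekindZeta_residue_pos K).ne'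
  have h3 : Tendsto (fun x : ℝ => (∑ u ∈ idealsLE K x, g u) / (x : ℂ)) atTop (𝓝 0) := by
    have h4 := h1.norm_left.tendsto_div_nhds_zero
    rw [tendsto_zero_iff_norm_tendsto_zero]
    refine h4.norm.congr' ?_ |>.trans (by simp)
    filter_upwards with x
    simp
  have h5 := h3.mul ((Complex.continuous_ofReal.tendsto _).comp h2)
  rw [zero_mul] at h5
  refine h5.congr' ?_
  filter_upwards [eventually_gt_atTop 0] with x hx
  have : (x : ℂ) ≠ 0 := by exact_mod_cast hx.ne'
  simp only [Function.comp, mean]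
  push_cast
  field_simp

/-! ### Partial summation over ideals -/

variable (K) in
/-- The asymptotic density of the ideals as an inequality valid for all `t ≥ 0`, for a use under
integrals. -/
theorem exists_abs_card_sub_le {δ : ℝ} (hδ : 0 < δ) : ∃ C, 0 ≤ C ∧ ∀ t, 0 ≤ t →
    |((idealsLE K t).card : ℝ) - dedekindZeta_residue K * t| ≤ C + δ * t := by
  have hR := dedekindZeta_residue_pos K
  set R := dedekindZeta_residue K
  have h1 := (tendsto_card_idealsLE_div K).eventually (Metric.ball_mem_nhds R hδ)
  obtain ⟨x₀, hx₀⟩ := eventually_atTop.1 (h1.and (eventually_gt_atTop 0))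
  have hx₀0 := (hx₀ x₀ le_rfl).2
  refine ⟨(idealsLE K x₀).card + R * x₀, by positivity, fun t ht => ?_⟩
  rcases le_total x₀ t with h | h
  · obtain ⟨h2, h3⟩ := hx₀ t h
    rw [Real.dist_eq] at h2
    have h4 : ((idealsLE K t).card : ℝ) - R * t = ((idealsLE K t).card / t - R) * t := by
      field_simp
    rw [h4, abs_mul, abs_of_pos h3]
    have : 0 ≤ ((idealsLE K x₀).card : ℝ) + R * x₀ := by positivity
    nlinarith
  · have h2 : ((idealsLE K t).card : ℝ) ≤ (idealsLE K x₀).card := by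
      exact_mod_cast Finset.card_le_card (idealsLE_subset h)
    have h3 : R * t ≤ R * x₀ := by gcongr
    have h4 : 0 ≤ R * t := by positivity
    have h5 : 0 ≤ δ * t := by positivity
    have h6 : (0 : ℝ) ≤ (idealsLE K t).card := by positivity
    rw [abs_le]
    constructor <;> linarith

theorem continuousOn_cpow {x : ℝ} (w : ℂ) : ContinuousOn (fun t : ℝ => (t : ℂ) ^ w) (Set.Icc 1 x) := by
  refine ContinuousOn.cpow_const (by fun_prop) fun t ht => ?_
  exact Complex.ofReal_mem_slitPlane.2 (by linarith [ht.1])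

theorem cpow_eq_add_integral {n x : ℝ} (hn : 1 ≤ n) (hnx : n ≤ x) (w : ℂ) :
    (n : ℂ) ^ (-w) = (x : ℂ) ^ (-w) + w * ∫ t in Set.Icc n x, (t : ℂ) ^ (-w - 1) := by
  have h1 : ∀ t ∈ Set.uIcc n x, HasDerivAt (fun t : ℝ => -(t : ℂ) ^ (-w))
      (w * (t : ℂ) ^ (-w - 1)) t := by
    intro t ht
    rw [Set.uIcc_of_le hnx] at ht
    have h2 : (t : ℂ) ∈ Complex.slitPlane :=
      Complex.ofReal_mem_slitPlane.2 (by linarith [ht.1])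
    have h3 := ((hasDerivAt_id (t : ℂ)).cpow_const (c := -w) h2).neg.comp_ofReal
    convert! h3 using 1
    simp
  rw [← integral_const_mul, integral_Icc_eq_integral_Ioc, ← intervalIntegral.integral_of_le hnx,
    intervalIntegral.integral_eq_sub_of_hasDerivAt h1]
  · ring
  · refine ContinuousOn.intervalIntegrable ?_
    rw [Set.uIcc_of_le hnx]
    exact continuousOn_const.mul ((continuousOn_cpow _).mono (Set.Icc_subset_Icc_left hn))

/-- Abel summation of a power of the norm. -/
theorem sum_cpow_eq (w : ℂ) {x : ℝ} :
    IntegrableOn (fun t : ℝ => ((idealsLE K t).card : ℂ) * (t : ℂ) ^ (-w - 1)) (Set.Icc 1 x) ∧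
    ∑ u ∈ idealsLE K x, (rnorm u : ℂ) ^ (-w) = (idealsLE K x).card * (x : ℂ) ^ (-w) +
      w * ∫ t in Set.Icc 1 x, ((idealsLE K t).card : ℂ) * (t : ℂ) ^ (-w - 1) := by
  classical
  set φ : ℝ → ℂ := fun t => (t : ℂ) ^ (-w - 1) with hφ
  have hint : IntegrableOn φ (Set.Icc 1 x) := (continuousOn_cpow _).integrableOn_Icc
  have h1 : ∀ t ∈ Set.Icc 1 x, ∑ u ∈ idealsLE K x, (Set.Ici (rnorm u)).indicator φ t =
      ((idealsLE K t).card : ℂ) * φ t := by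
    intro t ht
    have h2 : (idealsLE K x).filter (fun u => rnorm u ≤ t) = idealsLE K t := by
      ext u
      rw [Finset.mem_filter, mem_idealsLE, mem_idealsLE]
      exact ⟨fun h => h.2, fun h => ⟨h.trans ht.2, h⟩⟩
    rw [← h2, ← nsmul_eq_mul, ← Finset.sum_const, Finset.sum_filter]
    exact Finset.sum_congr rfl fun u _ => by simp [Set.indicator]
  have hind : ∀ u ∈ idealsLE K x, IntegrableOn ((Set.Ici (rnorm u)).indicator φ) (Set.Icc 1 x) :=
    fun u _ => hint.indicator measurableSet_Ici
  refine ⟨(integrable_finsetSum _ hind).congr ?_, ?_⟩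
  · exact (ae_restrict_iff' measurableSet_Icc).2 (ae_of_all _ h1)
  · rw [← setIntegral_congr_fun measurableSet_Icc h1, integral_finsetSum _ hind, Finset.mul_sum,
      ← nsmul_eq_mul, ← Finset.sum_const, ← Finset.sum_add_distrib]
    refine Finset.sum_congr rfl fun u hu => ?_
    have hux : rnorm u ≤ x := mem_idealsLE.1 hu
    have h3 : Set.Icc 1 x ∩ Set.Ici (rnorm u) = Set.Icc (rnorm u) x := by
      ext t
      simp only [Set.mem_inter_iff, Set.mem_Icc, Set.mem_Ici]
      have := one_le_norm u
      exact ⟨fun h => ⟨h.2, h.1.2⟩, fun h => ⟨⟨this.trans h.1, h.2⟩, h.1⟩⟩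
    rw [setIntegral_indicator measurableSet_Ici, h3]
    exact cpow_eq_add_integral (one_le_norm u) hux w

/-- Partial summation of a power of the norm against the density of the ideals. -/
theorem norm_sum_cpow_sub_le {C δ : ℝ} (hC : ∀ t, 0 ≤ t →
    |((idealsLE K t).card : ℝ) - dedekindZeta_residue K * t| ≤ C + δ * t) {w : ℂ} (hw : w ≠ 1)
    {x : ℝ} (hx : 1 ≤ x) :
    ‖∑ u ∈ idealsLE K x, (rnorm u : ℂ) ^ (-w) -
      dedekindZeta_residue K * (((x : ℂ) ^ (1 - w) - w) / (1 - w))‖ ≤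
      (C + δ * x) * x ^ (-w.re) +
        ‖w‖ * ∫ t in Set.Icc 1 x, (C + δ * t) * t ^ (-w.re - 1) := by
  have hx0 : 0 < x := by linarith
  have hw1 : 1 - w ≠ 0 := sub_ne_zero.2 hw.symm
  set R := dedekindZeta_residue K
  obtain ⟨h1, h2⟩ := sum_cpow_eq (K := K) w (x := x)
  have hφ : IntegrableOn (fun t : ℝ => (t : ℂ) ^ (-w)) (Set.Icc 1 x) :=
    (continuousOn_cpow _).integrableOn_Icc
  have h3 : ∫ t in Set.Icc 1 x, (t : ℂ) ^ (-w) = ((x : ℂ) ^ (1 - w) - 1) / (1 - w) := by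
    rw [integral_Icc_eq_integral_Ioc, ← intervalIntegral.integral_of_le hx, integral_cpow]
    · rw [neg_add_eq_sub, Complex.ofReal_one, Complex.one_cpow]
    · refine Or.inr ⟨fun h => hw (by linear_combination -h), ?_⟩
      rw [Set.uIcc_of_le hx, Set.mem_Icc]
      intro h
      linarith [h.1]
  have h4 : (x : ℂ) ^ (1 - w) = x * (x : ℂ) ^ (-w) := by
    rw [sub_eq_add_neg, Complex.cpow_add _ _ (by exact_mod_cast hx0.ne'), Complex.cpow_one]
  have h5 : ∑ u ∈ idealsLE K x, (rnorm u : ℂ) ^ (-w) -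
      R * (((x : ℂ) ^ (1 - w) - w) / (1 - w)) =
      (((idealsLE K x).card - R * x : ℝ) : ℂ) * (x : ℂ) ^ (-w) +
      w * ∫ t in Set.Icc 1 x, (((idealsLE K t).card - R * t : ℝ) : ℂ) * (t : ℂ) ^ (-w - 1) := by
    have h6 : ∫ t in Set.Icc 1 x, (((idealsLE K t).card - R * t : ℝ) : ℂ) * (t : ℂ) ^ (-w - 1) =
        (∫ t in Set.Icc 1 x, ((idealsLE K t).card : ℂ) * (t : ℂ) ^ (-w - 1)) -
          R * (((x : ℂ) ^ (1 - w) - 1) / (1 - w)) := by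
      rw [← h3, ← integral_const_mul, ← integral_sub h1 (hφ.const_mul _)]
      refine setIntegral_congr_fun measurableSet_Icc fun t ht => ?_
      have ht0 : (t : ℂ) ≠ 0 := by exact_mod_cast (by linarith [ht.1] : t ≠ 0)
      have h7 : (t : ℂ) ^ (-w) = t * (t : ℂ) ^ (-w - 1) := by
        rw [Complex.cpow_sub _ _ ht0, Complex.cpow_one]
        field_simp
      simp only [h7]
      push_cast
      ring
    rw [h6, h2, h4]
    push_cast
    field_simp
    ring
  have hnorm : ∀ t : ℝ, 0 < t → ∀ z : ℂ, ‖(t : ℂ) ^ z‖ = t ^ z.re := fun t ht z =>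
    Complex.norm_cpow_eq_rpow_re_of_pos ht z
  rw [h5]
  refine (norm_add_le _ _).trans (add_le_add ?_ ?_)
  · rw [norm_mul, Complex.norm_real, hnorm x hx0, Complex.neg_re]
    exact mul_le_mul_of_nonneg_right (hC x hx0.le) (Real.rpow_nonneg hx0.le _)
  · rw [norm_mul]
    refine mul_le_mul_of_nonneg_left ?_ (norm_nonneg _)
    refine norm_integral_le_of_norm_le ?_ ?_
    · refine ContinuousOn.integrableOn_Icc ?_
      refine ContinuousOn.mul (by fun_prop) (ContinuousOn.rpow_const (by fun_prop) fun t ht => ?_)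
      exact Or.inl (by linarith [ht.1])
    · refine (ae_restrict_iff' measurableSet_Icc).2 (ae_of_all _ fun t ht => ?_)
      have ht0 : 0 < t := by linarith [ht.1]
      rw [norm_mul, Complex.norm_real, hnorm t ht0]
      have : (-w - 1).re = -w.re - 1 := by simp
      rw [this]
      exact mul_le_mul_of_nonneg_right (hC t ht0.le) (Real.rpow_nonneg ht0.le _)

theorem tendsto_idealsLE : Tendsto (fun x : ℝ => idealsLE K x) atTop atTop :=
  tendsto_atTop_finset_of_monotone (fun _ _ h => idealsLE_subset h)
    fun u => ⟨rnorm u, mem_idealsLE.2 le_rfl⟩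

theorem integral_rpow_Icc_le {C δ σ x : ℝ} (hC : 0 ≤ C) (hδ : 0 ≤ δ) (hσ : 1 < σ) :
    ∫ t in Set.Icc 1 x, (C + δ * t) * t ^ (-σ - 1) ≤ C + δ / (σ - 1) := by
  have i1 : IntegrableOn (fun t : ℝ => t ^ (-σ - 1)) (Set.Ioi 1) :=
    integrableOn_Ioi_rpow_of_lt (by linarith) one_pos
  have i2 : IntegrableOn (fun t : ℝ => t ^ (-σ)) (Set.Ioi 1) :=
    integrableOn_Ioi_rpow_of_lt (by linarith) one_pos
  have h1 : ∀ t ∈ Set.Ioi (1 : ℝ), C * t ^ (-σ - 1) + δ * t ^ (-σ) =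
      (C + δ * t) * t ^ (-σ - 1) := by
    intro t ht
    have ht0 : 0 < t := by linarith [Set.mem_Ioi.1 ht]
    rw [Real.rpow_sub_one ht0.ne']
    field_simp
  have h2 : ∫ t in Set.Ioi 1, (C + δ * t) * t ^ (-σ - 1) = C / σ + δ / (σ - 1) := by
    rw [← setIntegral_congr_fun measurableSet_Ioi h1, integral_add (i1.const_mul _) (i2.const_mul _),
      integral_const_mul, integral_const_mul, integral_Ioi_rpow_of_lt (by linarith) one_pos,
      integral_Ioi_rpow_of_lt (by linarith) one_pos, Real.one_rpow, Real.one_rpow]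
    have e1 : -σ - 1 + 1 = -σ := by ring
    have e2 : -σ + 1 = -(σ - 1) := by ring
    rw [e1, e2]
    have : σ - 1 ≠ 0 := by linarith
    field_simp
  rw [integral_Icc_eq_integral_Ioc]
  have i3 : IntegrableOn (fun t : ℝ => (C + δ * t) * t ^ (-σ - 1)) (Set.Ioi 1) :=
    ((i1.const_mul C).add (i2.const_mul δ)).congr
      ((ae_restrict_iff' measurableSet_Ioi).2 (ae_of_all _ h1))
  calc _ ≤ ∫ t in Set.Ioi 1, (C + δ * t) * t ^ (-σ - 1) := by
        refine setIntegral_mono_set i3 ?_ Set.Ioc_subset_Ioi_self.eventuallyLE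
        refine (ae_restrict_iff' measurableSet_Ioi).2 (ae_of_all _ fun t ht => ?_)
        have ht0 : 0 < t := by linarith [Set.mem_Ioi.1 ht]
        simp only [Pi.zero_apply]
        positivity
    _ = C / σ + δ / (σ - 1) := h2
    _ ≤ _ := by
        gcongr
        exact div_le_self hC hσ.le

/-- The zeta function is close to `R s / (s - 1)`, with an error that is small compared with the
inverse distance to the line `Re s = 1`. -/
theorem exists_norm_zeta_sub_le {δ : ℝ} (hδ : 0 < δ) : ∃ C, 0 ≤ C ∧ ∀ s : ℂ, 1 < s.re →
    ‖zeta K s - dedekindZeta_residue K * (s / (s - 1))‖ ≤ ‖s‖ * (C + δ / (s.re - 1)) := by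
  obtain ⟨C, hC0, hC⟩ := exists_abs_card_sub_le K hδ
  refine ⟨C, hC0, fun s hs => ?_⟩
  set R := dedekindZeta_residue K
  have hs1 : s ≠ 1 := by rintro rfl; simp at hs
  have hs1' : 1 - s ≠ 0 := sub_ne_zero.2 hs1.symm
  have hs1'' : s - 1 ≠ 0 := sub_ne_zero.2 hs1
  have hsum : Summable fun u : Ideals K => (1 : ℂ) * (rnorm u : ℂ) ^ (-s) := by
    refine Summable.of_norm ((summable_ideals (c := fun _ : Ideals K => (1 : ℂ)) (B := 1)
      (by simp) hs).congr fun u => ?_)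
    rw [norm_mul, norm_rnorm_cpow]
  have h1 : Tendsto (fun x : ℝ => ∑ u ∈ idealsLE K x, (rnorm u : ℂ) ^ (-s)) atTop
      (𝓝 (zeta K s)) := by
    refine (hsum.hasSum.comp tendsto_idealsLE).congr fun x => ?_
    simp
  have h2 : Tendsto (fun x : ℝ => (x : ℂ) ^ (1 - s)) atTop (𝓝 0) := by
    rw [tendsto_zero_iff_norm_tendsto_zero]
    refine (tendsto_rpow_neg_atTop (show 0 < s.re - 1 by linarith)).congr' ?_
    filter_upwards [eventually_gt_atTop 0] with x hx
    rw [Complex.norm_cpow_eq_rpow_re_of_pos hx]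
    congr 1
    simp
  have h3 : Tendsto (fun x : ℝ => (C + δ * x) * x ^ (-s.re) +
      ‖s‖ * (C + δ / (s.re - 1))) atTop (𝓝 (0 + ‖s‖ * (C + δ / (s.re - 1)))) := by
    refine Tendsto.add_const _ ?_
    have h4 := ((tendsto_rpow_neg_atTop (show 0 < s.re by linarith)).const_mul C).add
      ((tendsto_rpow_neg_atTop (show 0 < s.re - 1 by linarith)).const_mul δ)
    rw [mul_zero, mul_zero, add_zero] at h4
    refine h4.congr' ?_
    filter_upwards [eventually_gt_atTop 0] with x hx
    have : x ^ (-(s.re - 1)) = x * x ^ (-s.re) := by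
      rw [neg_sub, sub_eq_add_neg, Real.rpow_add hx, Real.rpow_one]
    rw [this]
    ring
  have h5 : Tendsto (fun x : ℝ => ∑ u ∈ idealsLE K x, (rnorm u : ℂ) ^ (-s) -
      R * (((x : ℂ) ^ (1 - s) - s) / (1 - s))) atTop (𝓝 (zeta K s - R * (s / (s - 1)))) := by
    have h6 := h1.sub (((h2.sub_const s).div_const (1 - s)).const_mul (R : ℂ))
    have h7 : (0 - s) / (1 - s) = s / (s - 1) := by field_simp; ring
    rwa [h7] at h6
  rw [zero_add] at h3
  refine le_of_tendsto_of_tendsto h5.norm h3 ?_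
  filter_upwards [eventually_ge_atTop 1] with x hx
  refine (norm_sum_cpow_sub_le hC hs1 hx).trans ?_
  gcongr
  exact integral_rpow_Icc_le hC0 hδ.le hs

/-- The sum of `𝒩(u)^(iτ)` over `𝒩(u) ≤ x` is asymptotic to `R x^(1+iτ) / (1 + iτ)`. -/
theorem sum_normPow_isLittleO (τ : ℝ) :
    (fun x : ℝ => ∑ u ∈ idealsLE K x, normPow τ u -
      (dedekindZeta_residue K : ℂ) * ((x : ℂ) ^ (1 + τ * Complex.I) / (1 + τ * Complex.I)))
      =o[atTop] fun x : ℝ => x := by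
  set R := dedekindZeta_residue K
  refine isLittleO_iff.2 fun κ hκ => ?_
  set δ := κ / (2 * (1 + |τ|)) with hδ
  have hδ0 : 0 < δ := by positivity
  obtain ⟨C, hC0, hC⟩ := exists_abs_card_sub_le K hδ0
  set w : ℂ := -(τ * Complex.I) with hw
  have hwre : w.re = 0 := by simp [hw]
  have hw1 : w ≠ 1 := fun h => by rw [h] at hwre; simp at hwre
  have hwn : ‖w‖ = |τ| := by simp [hw]
  have h1w : 1 - w = 1 + τ * Complex.I := by rw [hw]; ring
  have hz : 1 + τ * Complex.I ≠ 0 := by rw [← h1w]; exact sub_ne_zero.2 hw1.symm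
  set E := ‖(R : ℂ) * (w / (1 + τ * Complex.I))‖ with hE
  have hlog : (fun x : ℝ => C + E + |τ| * (C * Real.log x)) =o[atTop] fun x : ℝ => x := by
    refine IsLittleO.add (isLittleO_const_id_atTop _) ?_
    exact (Real.isLittleO_log_id_atTop.const_mul_left C).const_mul_left _
  filter_upwards [eventually_ge_atTop 1, isLittleO_iff.1 hlog (half_pos hκ)] with x hx hlx
  have hx0 : 0 < x := by linarith
  have h1 := norm_sum_cpow_sub_le hC hw1 hx
  rw [hwre, hwn, h1w, neg_zero, Real.rpow_zero, mul_one] at h1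
  have h2 : ∫ t in Set.Icc 1 x, (C + δ * t) * t ^ ((0 : ℝ) - 1) = C * Real.log x + δ * (x - 1) := by
    have h3 : ∀ t ∈ Set.Icc 1 x, (C + δ * t) * t ^ ((0 : ℝ) - 1) = C * t⁻¹ + δ := by
      intro t ht
      have ht0 : t ≠ 0 := by linarith [ht.1]
      rw [zero_sub, Real.rpow_neg_one]
      field_simp
    have h0 : (0 : ℝ) ∉ Set.uIcc 1 x := by
      rw [Set.uIcc_of_le hx, Set.mem_Icc]; intro h; linarith [h.1]
    rw [setIntegral_congr_fun measurableSet_Icc h3, integral_Icc_eq_integral_Ioc,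
      ← intervalIntegral.integral_of_le hx, intervalIntegral.integral_add,
      intervalIntegral.integral_const_mul, integral_inv h0, intervalIntegral.integral_const]
    · simp [mul_comm]
    · exact (intervalIntegral.intervalIntegrable_inv (by
        intro t ht h; exact h0 (h ▸ ht)) continuousOn_id).const_mul C
    · exact intervalIntegrable_const
  rw [h2] at h1
  have h3 : ∑ u ∈ idealsLE K x, normPow τ u - (R : ℂ) * ((x : ℂ) ^ (1 + τ * Complex.I) /
      (1 + τ * Complex.I)) = (∑ u ∈ idealsLE K x, (rnorm u : ℂ) ^ (-w) -
        R * (((x : ℂ) ^ (1 + τ * Complex.I) - w) / (1 + τ * Complex.I))) -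
        R * (w / (1 + τ * Complex.I)) := by
    have h4 : ∑ u ∈ idealsLE K x, normPow τ u = ∑ u ∈ idealsLE K x, (rnorm u : ℂ) ^ (-w) :=
      Finset.sum_congr rfl fun u _ => by simp [normPow, hw]
    rw [h4]
    ring
  rw [h3]
  rw [Real.norm_of_nonneg hx0.le] at hlx ⊢
  have h4 := (le_abs_self _).trans hlx
  have h5 : δ * x + |τ| * (δ * (x - 1)) ≤ κ / 2 * x := by
    have h6 : (1 + |τ|) * δ = κ / 2 := by rw [hδ]; field_simp
    have h7 : 0 ≤ |τ| * δ := by positivity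
    nlinarith
  refine (norm_sub_le _ _).trans ((add_le_add_left h1 E).trans ?_)
  linarith

/-! ### Quotients of Euler products close to the point one -/

/-- The Euler factor at `p` of the quotient of the Dirichlet series of `g` by the zeta function. -/
noncomputable def eulerFactor (g : Ideals K → ℂ) (s : ℂ) (p : Primes K) : ℂ :=
  (1 - (pnorm p : ℂ) ^ (-s)) * (1 + h g s p)

theorem norm_eulerFactor_sub_le {g : Ideals K → ℂ} (hg1 : ∀ u, ‖g u‖ ≤ 1) (p : Primes K) {s : ℂ}
    (hs : 1 ≤ s.re) :
    ‖eulerFactor g s p - 1 - (g p.toIdeals - 1) * (pnorm p : ℂ) ^ (-s)‖ ≤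
      4 * (pnorm p)⁻¹ ^ 2 := by
  have h1 := norm_h_sub_le hg1 p hs
  have hv := norm_pnorm_cpow_le p hs
  have hr := inv_pnorm_le_half p
  set r := (pnorm p)⁻¹
  have hr0 : 0 ≤ r := inv_nonneg.2 (pnorm_pos p).le
  set v := (pnorm p : ℂ) ^ (-s)
  set w := h g s p - g p.toIdeals * v with hw
  have h2 : eulerFactor g s p - 1 - (g p.toIdeals - 1) * v =
      w - g p.toIdeals * (v * v) - v * w := by
    rw [eulerFactor, hw]; ring
  rw [h2]
  have h3 : ‖g p.toIdeals * (v * v)‖ ≤ r ^ 2 := by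
    rw [norm_mul, norm_mul, sq]
    exact (mul_le_of_le_one_left (by positivity) (hg1 _)).trans
      (mul_le_mul hv hv (norm_nonneg _) hr0)
  have h4 : ‖v * w‖ ≤ r ^ 2 := by
    rw [norm_mul]
    calc _ ≤ r * (2 * r ^ 2) := mul_le_mul hv h1 (norm_nonneg _) hr0
      _ ≤ _ := by nlinarith [sq_nonneg r]
  have h5 := norm_sub_le (w - g p.toIdeals * (v * v)) (v * w)
  have h6 := norm_sub_le w (g p.toIdeals * (v * v))
  linarith

/-- Up to second order the Euler factor is `1 + (g(p) - 1) 𝒩(p)^(-s)`. Since `Re (g(p) - 1) y ≤ 0`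
for `y ≥ 0`, only the difference of `𝒩(p)^(-s)` and `y` enters the bound. -/
theorem norm_eulerFactor_le {g : Ideals K → ℂ} (hg1 : ∀ u, ‖g u‖ ≤ 1) (p : Primes K) {s : ℂ}
    (hs : 1 ≤ s.re) {y : ℝ} (hy : 0 ≤ y) :
    ‖eulerFactor g s p‖ ≤ Real.exp (‖g p.toIdeals - 1‖ * ‖(pnorm p : ℂ) ^ (-s) - y‖ +
      14 * (pnorm p)⁻¹ ^ 2) := by
  have h1 := norm_eulerFactor_sub_le hg1 p hs
  have hv := norm_pnorm_cpow_le p hs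
  have hr := inv_pnorm_le_half p
  set r := (pnorm p)⁻¹
  have hr0 : 0 ≤ r := inv_nonneg.2 (pnorm_pos p).le
  set v := (pnorm p : ℂ) ^ (-s)
  set z := (g p.toIdeals - 1) * v with hz
  have hz1 : ‖z‖ ≤ 2 * r := by
    rw [norm_mul]
    have : ‖g p.toIdeals - 1‖ ≤ 2 := by
      refine (norm_sub_le _ _).trans ?_
      rw [norm_one]
      linarith [hg1 p.toIdeals]
    exact mul_le_mul this hv (norm_nonneg _) zero_le_two
  have h2 := norm_one_add_add_le (z := z) (w := eulerFactor g s p - 1 - z) (by linarith)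
  rw [show 1 + z + (eulerFactor g s p - 1 - z) = eulerFactor g s p by ring] at h2
  refine h2.trans (Real.exp_le_exp.2 ?_)
  have h3 : z.re ≤ ‖g p.toIdeals - 1‖ * ‖v - y‖ := by
    have h4 : z = (g p.toIdeals - 1) * (v - y) + (y : ℂ) * (g p.toIdeals - 1) := by rw [hz]; ring
    rw [h4, Complex.add_re, Complex.re_ofReal_mul, ← norm_mul]
    have h5 : (g p.toIdeals - 1).re ≤ 0 := by
      rw [Complex.sub_re, Complex.one_re]
      linarith [(Complex.re_le_norm (g p.toIdeals)).trans (hg1 _)]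
    have h6 := Complex.re_le_norm ((g p.toIdeals - 1) * (v - y))
    nlinarith
  have h4 : ‖z‖ ^ 2 ≤ (2 * r) ^ 2 := pow_le_pow_left₀ (norm_nonneg _) hz1 2
  nlinarith

/-- Telescoping for a difference of products whose factors have sizes at most `exp (x i)`. -/
theorem norm_prod_sub_prod_le {ι : Type*} (S : Finset ι) {a b : ι → ℂ} {x : ι → ℝ}
    (hx : ∀ i, 0 ≤ x i) (ha : ∀ i, ‖a i‖ ≤ Real.exp (x i)) (hb : ∀ i, ‖b i‖ ≤ Real.exp (x i)) :
    ‖∏ i ∈ S, a i - ∏ i ∈ S, b i‖ ≤ (∑ i ∈ S, ‖a i - b i‖) * Real.exp (∑ i ∈ S, x i) := by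
  classical
  induction S using Finset.induction_on with
  | empty => simp
  | insert j S hj ih =>
    rw [Finset.prod_insert hj, Finset.prod_insert hj, Finset.sum_insert hj, Finset.sum_insert hj]
    have h1 : a j * ∏ i ∈ S, a i - b j * ∏ i ∈ S, b i =
        (a j - b j) * ∏ i ∈ S, a i + b j * (∏ i ∈ S, a i - ∏ i ∈ S, b i) := by ring
    have h2 : ‖∏ i ∈ S, a i‖ ≤ Real.exp (∑ i ∈ S, x i) := by
      rw [norm_prod, Real.exp_sum]
      exact Finset.prod_le_prod (fun i _ => norm_nonneg _) fun i _ => ha i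
    have h3 : 1 ≤ Real.exp (x j) := Real.one_le_exp (hx j)
    have h4 : 0 ≤ ∑ i ∈ S, ‖a i - b i‖ := Finset.sum_nonneg fun i _ => norm_nonneg _
    rw [h1, Real.exp_add]
    set E := Real.exp (∑ i ∈ S, x i)
    have hE : 0 < E := Real.exp_pos _
    refine (norm_add_le _ _).trans ?_
    rw [norm_mul, norm_mul]
    calc _ ≤ ‖a j - b j‖ * E + Real.exp (x j) * ((∑ i ∈ S, ‖a i - b i‖) * E) := by
          gcongr
          exact hb j
      _ = (‖a j - b j‖ + Real.exp (x j) * ∑ i ∈ S, ‖a i - b i‖) * E := by ring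
      _ ≤ (‖a j - b j‖ * Real.exp (x j) + Real.exp (x j) * ∑ i ∈ S, ‖a i - b i‖) * E := by
          gcongr
          exact le_mul_of_one_le_right (norm_nonneg _) h3
      _ = _ := by ring

/-- The factor `∏_{𝒩(p) ≤ X} (1 - 1 / 𝒩(p)) (1 + h_1(p))`. -/
noncomputable def eulerQuotient (g : Ideals K → ℂ) (X : ℝ) : ℂ :=
  ∏ p ∈ primesLE K X, eulerFactor g 1 p

/-- The Euler factors at the point one, cut off at `X`. -/
noncomputable def cutFactor (g : Ideals K → ℂ) (X : ℝ) (p : Primes K) : ℂ :=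
  if pnorm p ≤ X then eulerFactor g 1 p else 1

/-- The function `1 / 𝒩(p)` cut off at `X`. -/
noncomputable def cutInv (X : ℝ) (p : Primes K) : ℝ := if pnorm p ≤ X then (pnorm p)⁻¹ else 0

theorem cutInv_nonneg (X : ℝ) (p : Primes K) : 0 ≤ cutInv X p := by
  rw [cutInv]
  split_ifs
  · exact inv_nonneg.2 (pnorm_pos p).le
  · exact le_rfl

theorem eulerQuotient_eq_prod (g : Ideals K → ℂ) {X : ℝ} {S : Finset (Primes K)}
    (hS : primesLE K X ⊆ S) : eulerQuotient g X = ∏ p ∈ S, cutFactor g X p := by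
  have h1 : ∏ p ∈ primesLE K X, cutFactor g X p = ∏ p ∈ S, cutFactor g X p :=
    Finset.prod_subset hS fun p _ hp => by
      rw [cutFactor, if_neg fun h => hp (mem_primesLE.2 h)]
  rw [← h1, eulerQuotient]
  exact Finset.prod_congr rfl fun p hp => by rw [cutFactor, if_pos (mem_primesLE.1 hp)]

theorem pnorm_cpow_neg_one (p : Primes K) : (pnorm p : ℂ) ^ (-(1 : ℂ)) = ((pnorm p)⁻¹ : ℝ) := by
  rw [Complex.cpow_neg_one, Complex.ofReal_inv]

theorem norm_eulerFactor_one_le {g : Ideals K → ℂ} (hg1 : ∀ u, ‖g u‖ ≤ 1) (p : Primes K) :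
    ‖eulerFactor g 1 p‖ ≤ Real.exp (14 * (pnorm p)⁻¹ ^ 2) := by
  have h1 := norm_eulerFactor_le hg1 p (s := 1) (by simp) (inv_nonneg.2 (pnorm_pos p).le)
  rwa [pnorm_cpow_neg_one, sub_self, norm_zero, mul_zero, zero_add] at h1

theorem norm_cutFactor_le {g : Ideals K → ℂ} (hg1 : ∀ u, ‖g u‖ ≤ 1) (X : ℝ) (p : Primes K) :
    ‖cutFactor g X p‖ ≤ Real.exp (14 * (pnorm p)⁻¹ ^ 2) := by
  rw [cutFactor]
  split_ifs
  · exact norm_eulerFactor_one_le hg1 p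
  · rw [norm_one]
    exact Real.one_le_exp (by positivity)

theorem norm_eulerQuotient_le {g : Ideals K → ℂ} (hg1 : ∀ u, ‖g u‖ ≤ 1) (X : ℝ) :
    ‖eulerQuotient g X‖ ≤ Real.exp (14 * primeSq K) := by
  rw [eulerQuotient, norm_prod]
  refine (Finset.prod_le_prod (fun p _ => norm_nonneg _)
    fun p _ => norm_eulerFactor_one_le hg1 p).trans ?_
  rw [← Real.exp_sum, ← Finset.mul_sum]
  gcongr
  exact sum_inv_pnorm_sq_le _

theorem norm_cutFactor_sub_le {g : Ideals K → ℂ} (hg1 : ∀ u, ‖g u‖ ≤ 1) (X : ℝ) (p : Primes K) :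
    ‖cutFactor g X p - 1 - (g p.toIdeals - 1) * (cutInv X p : ℂ)‖ ≤ 4 * (pnorm p)⁻¹ ^ 2 := by
  rw [cutFactor, cutInv]
  split_ifs
  · have := norm_eulerFactor_sub_le hg1 p (s := 1) (by simp)
    rwa [pnorm_cpow_neg_one] at this
  · simp

/-! ### The region around the point one -/

/-- The point `1 + β + i t` attached to a triple `(X, β, t)`. -/
noncomputable def point (z : ℝ × ℝ × ℝ) : ℂ := (1 + z.2.1 : ℝ) + z.2.2 * Complex.I

/-- The filter of triples `(X, β, t)` with `X → ∞`, `1 / log X ≤ β` and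
`β + |t| ≤ b / log X`. -/
def nearFilter (b : ℝ) : Filter (ℝ × ℝ × ℝ) :=
  comap Prod.fst atTop ⊓
    𝓟 {z | (Real.log z.1)⁻¹ ≤ z.2.1 ∧ z.2.1 + |z.2.2| ≤ b * (Real.log z.1)⁻¹}

theorem eventually_nearFilter {b : ℝ} {P : ℝ × ℝ × ℝ → Prop} :
    (∀ᶠ z in nearFilter b, P z) ↔ ∀ᶠ X in atTop, ∀ β t : ℝ, (Real.log X)⁻¹ ≤ β →
      β + |t| ≤ b * (Real.log X)⁻¹ → P (X, β, t) := by
  rw [nearFilter, eventually_inf_principal, eventually_comap]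
  refine eventually_congr (.of_forall fun X => ?_)
  constructor
  · exact fun h β t h1 h2 => h (X, β, t) rfl ⟨h1, h2⟩
  · rintro h ⟨X', β, t⟩ rfl ⟨h1, h2⟩
    exact h β t h1 h2

theorem tendsto_fst_nearFilter (b : ℝ) : Tendsto Prod.fst (nearFilter b) atTop :=
  tendsto_comap.mono_left inf_le_left

theorem eventually_near_mem (b : ℝ) : ∀ᶠ z in nearFilter b, 0 < (Real.log z.1)⁻¹ ∧
    (Real.log z.1)⁻¹ ≤ 1 ∧ (Real.log z.1)⁻¹ ≤ z.2.1 ∧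
    z.2.1 + |z.2.2| ≤ b * (Real.log z.1)⁻¹ := by
  rw [eventually_nearFilter]
  have h1 := (tendsto_inv_log_atTop.mono_right nhdsWithin_le_nhds).eventually_le_const one_pos
  filter_upwards [h1, tendsto_inv_log_atTop.eventually self_mem_nhdsWithin]
    with X h2 h3 β t h4 h5
  exact ⟨h3, h2, h4, h5⟩

theorem eventually_one_le_re_point (b : ℝ) : ∀ᶠ z in nearFilter b, 1 ≤ (point z).re := by
  filter_upwards [eventually_near_mem b] with z hz
  simp only [point, Complex.add_re, Complex.ofReal_re, Complex.mul_re, Complex.I_re,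
    Complex.ofReal_im, Complex.I_im]
  linarith [hz.1, hz.2.2.1]

theorem tendsto_point (b : ℝ) : Tendsto point (nearFilter b) (𝓝 1) := by
  have h0 : Tendsto (fun z : ℝ × ℝ × ℝ => b * (Real.log z.1)⁻¹) (nearFilter b) (𝓝 0) := by
    have := ((tendsto_inv_log_atTop.mono_right nhdsWithin_le_nhds).comp
      (tendsto_fst_nearFilter b)).const_mul b
    simpa using this
  have h1 : Tendsto (fun z : ℝ × ℝ × ℝ => z.2.1) (nearFilter b) (𝓝 0) := by
    refine squeeze_zero' ?_ ?_ h0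
    · filter_upwards [eventually_near_mem b] with z hz
      linarith [hz.1, hz.2.2.1]
    · filter_upwards [eventually_near_mem b] with z hz
      linarith [abs_nonneg z.2.2, hz.2.2.2]
  have h2 : Tendsto (fun z : ℝ × ℝ × ℝ => z.2.2) (nearFilter b) (𝓝 0) := by
    refine squeeze_zero_norm' ?_ h0
    filter_upwards [eventually_near_mem b] with z hz
    rw [Real.norm_eq_abs]
    linarith [hz.1, hz.2.2.1, hz.2.2.2]
  have h3 := ((Complex.continuous_ofReal.tendsto _).comp (h1.const_add 1)).add
    (((Complex.continuous_ofReal.tendsto _).comp h2).mul_const Complex.I)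
  refine Tendsto.congr (fun z => ?_) (by simpa [Function.comp_def] using h3 :
    Tendsto (fun z : ℝ × ℝ × ℝ => (1 : ℂ) + z.2.1 + z.2.2 * Complex.I) (nearFilter b) (𝓝 1))
  simp [point]

theorem tendsto_pnorm_cpow (b : ℝ) (p : Primes K) :
    Tendsto (fun z => (pnorm p : ℂ) ^ (-point z)) (nearFilter b) (𝓝 ((pnorm p)⁻¹ : ℝ)) := by
  have hp : (pnorm p : ℂ) ≠ 0 := by exact_mod_cast (pnorm_pos p).ne'
  rw [← pnorm_cpow_neg_one]
  have hc : Continuous fun s : ℂ => (pnorm p : ℂ) ^ (-s) :=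
    Continuous.const_cpow (by fun_prop) (Or.inl hp)
  exact (hc.tendsto 1).comp (tendsto_point b)

theorem eventually_pnorm_le (b : ℝ) (p : Primes K) :
    ∀ᶠ z : ℝ × ℝ × ℝ in nearFilter b, pnorm p ≤ z.1 :=
  (tendsto_fst_nearFilter b).eventually_ge_atTop _

theorem tendsto_cutInv (b : ℝ) (p : Primes K) :
    Tendsto (fun z : ℝ × ℝ × ℝ => cutInv z.1 p) (nearFilter b) (𝓝 (pnorm p)⁻¹) := by
  refine tendsto_const_nhds.congr' ?_
  filter_upwards [eventually_pnorm_le b p] with z hz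
  rw [cutInv, if_pos hz]

theorem tendsto_h {g : Ideals K → ℂ} (hg1 : ∀ u, ‖g u‖ ≤ 1) (b : ℝ) (p : Primes K) :
    Tendsto (fun z => h g (point z) p) (nearFilter b) (𝓝 (h g 1 p)) := by
  refine tendsto_tsum_of_dominated_convergence
    ((summable_nat_add_iff 1).2 (summable_inv_pnorm_pow p)) (fun k => ?_) ?_
  · refine Tendsto.const_mul _ ?_
    have hc : Continuous fun s : ℂ => (norm (p.toIdeals ^ (k + 1)) : ℂ) ^ (-s) :=
      Continuous.const_cpow (by fun_prop) (Or.inl (idealNorm_ne_zero _))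
    exact (hc.tendsto 1).comp (tendsto_point b)
  · filter_upwards [eventually_one_le_re_point b] with z hz k
    exact norm_term_h_le hg1 p hz (k + 1)

theorem tendsto_eulerFactor {g : Ideals K → ℂ} (hg1 : ∀ u, ‖g u‖ ≤ 1) (b : ℝ) (p : Primes K) :
    Tendsto (fun z => eulerFactor g (point z) p) (nearFilter b) (𝓝 (eulerFactor g 1 p)) := by
  have h1 := ((tendsto_pnorm_cpow b p).const_sub 1).mul ((tendsto_h hg1 b p).const_add 1)
  rwa [← pnorm_cpow_neg_one] at h1

theorem tendsto_cutFactor (g : Ideals K → ℂ) (b : ℝ) (p : Primes K) :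
    Tendsto (fun z : ℝ × ℝ × ℝ => cutFactor g z.1 p) (nearFilter b) (𝓝 (eulerFactor g 1 p)) := by
  refine tendsto_const_nhds.congr' ?_
  filter_upwards [eventually_pnorm_le b p] with z hz
  rw [cutFactor, if_pos hz]

/-- The remainder after the first order term in the difference of the Euler factors. -/
noncomputable def remainder (g : Ideals K → ℂ) (z : ℝ × ℝ × ℝ) (p : Primes K) : ℂ :=
  (eulerFactor g (point z) p - 1 - (g p.toIdeals - 1) * (pnorm p : ℂ) ^ (-point z)) -
    (cutFactor g z.1 p - 1 - (g p.toIdeals - 1) * (cutInv z.1 p : ℂ))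

theorem norm_remainder_le {g : Ideals K → ℂ} (hg1 : ∀ u, ‖g u‖ ≤ 1) {z : ℝ × ℝ × ℝ}
    (hz : 1 ≤ (point z).re) (p : Primes K) : ‖remainder g z p‖ ≤ 8 * (pnorm p)⁻¹ ^ 2 := by
  have h1 := norm_eulerFactor_sub_le hg1 p hz
  have h2 := norm_cutFactor_sub_le hg1 z.1 p
  refine (norm_sub_le _ _).trans ?_
  linarith

theorem tendsto_tsum_remainder {g : Ideals K → ℂ} (hg1 : ∀ u, ‖g u‖ ≤ 1) (b : ℝ) :
    Tendsto (fun z => ∑' p, ‖remainder g z p‖) (nearFilter b) (𝓝 0) := by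
  have h1 : Tendsto (fun z => ∑' p, ‖remainder g z p‖) (nearFilter b)
      (𝓝 (∑' _ : Primes K, 0)) := by
    refine tendsto_tsum_of_dominated_convergence ((summable_inv_pnorm_sq K).mul_left 8)
      (fun p => ?_) ?_
    · have h2 := (((tendsto_eulerFactor hg1 b p).sub_const 1).sub
        ((tendsto_pnorm_cpow b p).const_mul (g p.toIdeals - 1))).sub
        (((tendsto_cutFactor g b p).sub_const 1).sub
          (((Complex.continuous_ofReal.tendsto _).comp (tendsto_cutInv b p)).const_mul
            (g p.toIdeals - 1)))
      rw [sub_self] at h2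
      simpa [remainder] using h2.norm
    · filter_upwards [eventually_one_le_re_point b] with z hz p
      rw [norm_norm]
      exact norm_remainder_le hg1 hz p
  simpa using h1

theorem norm_exp_sub_one_le_two_mul {z : ℂ} (hz : z.re ≤ 0) : ‖Complex.exp z - 1‖ ≤ 2 * ‖z‖ := by
  rcases le_total ‖z‖ 1 with h | h
  · exact Complex.norm_exp_sub_one_le h
  · refine (norm_sub_le _ _).trans ?_
    rw [norm_one, Complex.norm_exp]
    linarith [Real.exp_le_one_iff.2 hz]

/-- The difference of `𝒩(p)^(-s)` and the cut off `1 / 𝒩(p)` is small in mean square, since `s` is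
within a multiple of `1 / log X` of the point one. -/
theorem pnorm_mul_sq_norm_sub_le {b : ℝ} {z : ℝ × ℝ × ℝ} (h0 : 0 < (Real.log z.1)⁻¹)
    (h1 : (Real.log z.1)⁻¹ ≤ z.2.1) (h2 : z.2.1 + |z.2.2| ≤ b * (Real.log z.1)⁻¹)
    (hX : 0 < z.1) (p : Primes K) :
    pnorm p * ‖(pnorm p : ℂ) ^ (-point z) - cutInv z.1 p‖ ^ 2 ≤ (12 * b ^ 2 + 1) *
      ((Real.log z.1)⁻¹ * (Real.log (pnorm p) * pnorm p ^ (-(1 + (Real.log z.1)⁻¹)))) := by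
  obtain ⟨X, β, t⟩ := z
  dsimp only at *
  set ε := (Real.log X)⁻¹ with hε
  have hq := pnorm_pos p
  set q := pnorm p
  have hl : 0 ≤ Real.log q := log_norm_nonneg _
  have hq0 : (q : ℂ) ≠ 0 := by exact_mod_cast hq.ne'
  have hq' : 0 ≤ q ^ (-(1 + ε)) := Real.rpow_nonneg hq.le _
  have hlogX : 0 < Real.log X := inv_pos.1 h0
  rw [cutInv]
  split_ifs with hle
  · have hlq : ε * Real.log q ≤ 1 := by
      rw [hε, inv_mul_le_iff₀ hlogX, mul_one]
      exact Real.log_le_log hq hle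
    set y : ℂ := -((β : ℂ) + t * Complex.I) * Real.log q with hy
    have e1 : (q : ℂ) ^ (-point (X, β, t)) = (q⁻¹ : ℝ) * Complex.exp y := by
      have : -point (X, β, t) = -1 + -((β : ℂ) + t * Complex.I) := by
        simp only [point]; push_cast; ring
      rw [this, Complex.cpow_add _ _ hq0, Complex.cpow_neg_one, Complex.ofReal_inv,
        Complex.cpow_def_of_ne_zero hq0, ← Complex.ofReal_log hq.le, hy, mul_comm (Real.log q : ℂ)]
    have e2 : ‖(q : ℂ) ^ (-point (X, β, t)) - (q⁻¹ : ℝ)‖ ≤ q⁻¹ * (2 * (b * ε * Real.log q)) := by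
      have e3 : (q : ℂ) ^ (-point (X, β, t)) - (q⁻¹ : ℝ) =
          (q⁻¹ : ℝ) * (Complex.exp y - 1) := by rw [e1]; ring
      rw [e3, norm_mul, Complex.norm_real, Real.norm_of_nonneg (inv_nonneg.2 hq.le)]
      refine mul_le_mul_of_nonneg_left ?_ (inv_nonneg.2 hq.le)
      have hyre : y.re ≤ 0 := by
        have : y.re = -(β * Real.log q) := by simp [hy]
        rw [this]
        have : 0 ≤ β * Real.log q := mul_nonneg (by linarith) hl
        linarith
      refine (norm_exp_sub_one_le_two_mul hyre).trans (mul_le_mul_of_nonneg_left ?_ zero_le_two)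
      rw [hy, norm_mul, norm_neg, Complex.norm_real, Real.norm_of_nonneg hl]
      refine mul_le_mul_of_nonneg_right (le_trans ?_ h2) hl
      refine (norm_add_le _ _).trans_eq ?_
      rw [Complex.norm_real, norm_mul, Complex.norm_real, Complex.norm_I, mul_one,
        Real.norm_of_nonneg (by linarith), Real.norm_eq_abs]
    have e4 : q⁻¹ ≤ 3 * q ^ (-(1 + ε)) := by
      have e5 : q⁻¹ = q ^ ε * q ^ (-(1 + ε)) := by
        rw [← Real.rpow_add hq, ← Real.rpow_neg_one]; congr 1; ring
      have e6 : q ^ ε ≤ 3 := by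
        rw [Real.rpow_def_of_pos hq, mul_comm]
        exact (Real.exp_le_exp.2 hlq).trans (by linarith [Real.exp_one_lt_d9])
      rw [e5]
      gcongr
    have e7 : ε * Real.log q * (ε * Real.log q) ≤ ε * Real.log q :=
      mul_le_of_le_one_left (mul_nonneg h0.le hl) hlq
    calc _ ≤ q * (q⁻¹ * (2 * (b * ε * Real.log q))) ^ 2 := by gcongr
      _ = 4 * b ^ 2 * (ε * Real.log q * (ε * Real.log q)) * q⁻¹ := by field_simp; ring
      _ ≤ 4 * b ^ 2 * (ε * Real.log q) * (3 * q ^ (-(1 + ε))) := by gcongr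
      _ ≤ _ := by
          have : 0 ≤ ε * (Real.log q * q ^ (-(1 + ε))) := by positivity
          linarith
  · rw [Complex.ofReal_zero, sub_zero, norm_rnorm_cpow]
    have hlq : 1 ≤ ε * Real.log q := by
      rw [hε, le_inv_mul_iff₀ hlogX, mul_one]
      exact Real.log_le_log hX (not_le.1 hle).le
    have hre : (point (X, β, t)).re = 1 + β := by simp [point]
    rw [hre]
    have e1 : q ^ (-(1 + β)) ≤ q ^ (-(1 + ε)) :=
      Real.rpow_le_rpow_of_exponent_le (one_le_pnorm p) (by linarith)
    have e2 : q ^ (-(1 + β)) ≤ q⁻¹ := by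
      rw [← Real.rpow_neg_one]
      exact Real.rpow_le_rpow_of_exponent_le (one_le_pnorm p) (by linarith)
    have e3 : 0 ≤ q ^ (-(1 + β)) := Real.rpow_nonneg hq.le _
    calc q * (q ^ (-(1 + β))) ^ 2 = (q * q ^ (-(1 + β))) * q ^ (-(1 + β)) := by ring
      _ ≤ (q * q⁻¹) * q ^ (-(1 + ε)) := by gcongr
      _ = 1 * q ^ (-(1 + ε)) := by rw [mul_inv_cancel₀ hq.ne']
      _ ≤ (ε * Real.log q) * q ^ (-(1 + ε)) := by gcongr
      _ ≤ _ := by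
          have h5 : 0 ≤ ε * (Real.log q * q ^ (-(1 + ε))) := by positivity
          have h6 : 0 ≤ 12 * b ^ 2 := by positivity
          nlinarith

variable (K) in
theorem eventually_sum_pnorm_mul_sq_le (b : ℝ) : ∀ᶠ z in nearFilter b,
    ∀ S : Finset (Primes K), ∑ p ∈ S, pnorm p * ‖(pnorm p : ℂ) ^ (-point z) - cutInv z.1 p‖ ^ 2 ≤
      (12 * b ^ 2 + 1) * (2 * growthConst K) := by
  filter_upwards [eventually_near_mem b, (tendsto_fst_nearFilter b).eventually_gt_atTop 0]
    with z hz hX S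
  obtain ⟨h0, h1, h2, h3⟩ := hz
  refine (Finset.sum_le_sum fun p _ => pnorm_mul_sq_norm_sub_le h0 h2 h3 hX p).trans ?_
  rw [← Finset.mul_sum, ← Finset.mul_sum]
  refine mul_le_mul_of_nonneg_left ?_ (by positivity)
  set ε := (Real.log z.1)⁻¹
  have h4 := (linearGrowth_primes (K := K)).sum_rpow_le_one one_le_pnorm
    (show 1 < 1 + ε by linarith) S
  have hG := growthConst_nonneg (K := K)
  calc _ ≤ ε * (growthConst K * ((1 + ε) / (1 + ε - 1))) := by gcongr
    _ = growthConst K * (1 + ε) := by rw [add_sub_cancel_left]; field_simp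
    _ ≤ _ := by nlinarith

section near

variable {g : Ideals K → ℂ}

theorem two_mul_mul_le (p : Primes K) {c x y : ℝ} (hc : 0 < c) :
    2 * (x * y) ≤ c⁻¹ * (x ^ 2 * (pnorm p)⁻¹) + c * (pnorm p * y ^ 2) := by
  have hq := pnorm_pos p
  have h1 : c⁻¹ * (x ^ 2 * (pnorm p)⁻¹) + c * (pnorm p * y ^ 2) - 2 * (x * y) =
      c⁻¹ * (pnorm p)⁻¹ * (x - c * pnorm p * y) ^ 2 := by field_simp; ring
  have : 0 ≤ c⁻¹ * (pnorm p)⁻¹ * (x - c * pnorm p * y) ^ 2 := by positivity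
  linarith

/-- Cauchy–Schwarz on a tail of the primes, where `∑ ‖g(p) - 1‖² / 𝒩(p)` is small; the finitely many
remaining terms tend to zero one by one. -/
theorem eventually_sum_mul_norm_sub_le
    (hξ : Summable fun p => ‖g p.toIdeals - 1‖ ^ 2 * (pnorm p)⁻¹) (b : ℝ) {κ : ℝ} (hκ : 0 < κ) :
    ∀ᶠ z in nearFilter b, ∀ S : Finset (Primes K),
      ∑ p ∈ S, ‖g p.toIdeals - 1‖ * ‖(pnorm p : ℂ) ^ (-point z) - cutInv z.1 p‖ ≤ κ := by
  classical
  have hG := one_le_growthConst (K := K)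
  set M : ℝ := (12 * b ^ 2 + 1) * (2 * growthConst K) with hM
  have hM0 : 0 < M := by positivity
  set c : ℝ := κ / (2 * M) with hc
  have hc0 : 0 < c := by positivity
  obtain ⟨Y, hY⟩ := summable_iff_vanishing_norm.1 hξ (c * (κ / 2)) (by positivity)
  have hlim : Tendsto (fun z => ∑ p ∈ Y, ‖g p.toIdeals - 1‖ *
      ‖(pnorm p : ℂ) ^ (-point z) - cutInv z.1 p‖) (nearFilter b) (𝓝 0) := by
    have h1 : Tendsto (fun z => ∑ p ∈ Y, ‖g p.toIdeals - 1‖ *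
        ‖(pnorm p : ℂ) ^ (-point z) - cutInv z.1 p‖) (nearFilter b)
        (𝓝 (∑ p ∈ Y, ‖g p.toIdeals - 1‖ * 0)) := by
      refine tendsto_finsetSum _ fun p _ => Tendsto.const_mul _ ?_
      have h2 := (tendsto_pnorm_cpow b p).sub
        ((Complex.continuous_ofReal.tendsto _).comp (tendsto_cutInv b p))
      rw [sub_self] at h2
      simpa using h2.norm
    simpa using h1
  filter_upwards [hlim.eventually_le_const (half_pos hκ), eventually_sum_pnorm_mul_sq_le K b]
    with z hz hms S
  rw [← Finset.sum_inter_add_sum_sdiff S Y]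
  have h1 : ∑ p ∈ S ∩ Y, ‖g p.toIdeals - 1‖ * ‖(pnorm p : ℂ) ^ (-point z) - cutInv z.1 p‖ ≤
      κ / 2 := (Finset.sum_le_sum_of_subset_of_nonneg Finset.inter_subset_right
        fun p _ _ => by positivity).trans hz
  have h2 : 2 * ∑ p ∈ S \ Y, ‖g p.toIdeals - 1‖ *
      ‖(pnorm p : ℂ) ^ (-point z) - cutInv z.1 p‖ ≤ κ := by
    have h3 := hY (S \ Y) Finset.sdiff_disjoint
    have h4 := (Real.le_norm_self _).trans h3.le
    rw [Finset.mul_sum]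
    refine (Finset.sum_le_sum fun p _ => two_mul_mul_le p hc0).trans ?_
    rw [Finset.sum_add_distrib, ← Finset.mul_sum, ← Finset.mul_sum]
    calc _ ≤ c⁻¹ * (c * (κ / 2)) + c * M := by
          gcongr
          exact hms _
      _ = κ := by rw [hc]; field_simp; ring
  linarith

/-- The Euler product of the quotient of the two Dirichlet series is close to its value at the
point one, cut off at `X`. -/
theorem eventually_norm_prod_sub_eulerQuotient_le (hg1 : ∀ u, ‖g u‖ ≤ 1)
    (hξ : Summable fun p => ‖g p.toIdeals - 1‖ ^ 2 * (pnorm p)⁻¹) (b : ℝ) {κ : ℝ} (hκ : 0 < κ) :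
    ∀ᶠ z in nearFilter b, ∀ S : Finset (Primes K), primesLE K z.1 ⊆ S →
      ‖∏ p ∈ S, eulerFactor g (point z) p - eulerQuotient g z.1‖ ≤ κ := by
  set E : ℝ := Real.exp (1 + 14 * primeSq K) with hE
  have hE0 : 0 < E := Real.exp_pos _
  filter_upwards [eventually_sum_mul_norm_sub_le hξ b one_pos,
    eventually_sum_mul_norm_sub_le hξ b (show 0 < κ / (2 * E) by positivity),
    (tendsto_tsum_remainder hg1 b).eventually_le_const (show 0 < κ / (2 * E) by positivity),
    eventually_one_le_re_point b] with z h1 h2 h3 hre S hS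
  rw [eulerQuotient_eq_prod g hS]
  set m : Primes K → ℝ := fun p => ‖(pnorm p : ℂ) ^ (-point z) - cutInv z.1 p‖ with hm
  have h4 := norm_prod_sub_prod_le S (a := fun p => eulerFactor g (point z) p)
    (b := fun p => cutFactor g z.1 p)
    (x := fun p => ‖g p.toIdeals - 1‖ * m p + 14 * (pnorm p)⁻¹ ^ 2) (fun p => by positivity)
    (fun p => norm_eulerFactor_le hg1 p hre (cutInv_nonneg z.1 p))
    (fun p => (norm_cutFactor_le hg1 z.1 p).trans (Real.exp_le_exp.2
      (le_add_of_nonneg_left (by positivity))))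
  refine h4.trans ?_
  have h5 : Real.exp (∑ p ∈ S, (‖g p.toIdeals - 1‖ * m p + 14 * (pnorm p)⁻¹ ^ 2)) ≤ E := by
    rw [Finset.sum_add_distrib, ← Finset.mul_sum]
    refine Real.exp_le_exp.2 (add_le_add (h1 S) ?_)
    exact mul_le_mul_of_nonneg_left (sum_inv_pnorm_sq_le S) (by norm_num)
  have h6 : ∑ p ∈ S, ‖eulerFactor g (point z) p - cutFactor g z.1 p‖ ≤
      κ / (2 * E) + κ / (2 * E) := by
    have hs : Summable fun p => ‖remainder g z p‖ :=
      ((summable_inv_pnorm_sq K).mul_left 8).of_nonneg_of_le (fun _ => norm_nonneg _)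
        fun p => norm_remainder_le hg1 hre p
    have h7 : ∀ p ∈ S, ‖eulerFactor g (point z) p - cutFactor g z.1 p‖ ≤
        ‖g p.toIdeals - 1‖ * m p + ‖remainder g z p‖ := fun p _ => by
      have h8 : eulerFactor g (point z) p - cutFactor g z.1 p =
          (g p.toIdeals - 1) * ((pnorm p : ℂ) ^ (-point z) - cutInv z.1 p) + remainder g z p := by
        rw [remainder]; ring
      rw [h8]
      refine (norm_add_le _ _).trans_eq ?_
      rw [norm_mul]
    refine (Finset.sum_le_sum h7).trans ?_
    rw [Finset.sum_add_distrib]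
    exact add_le_add (h2 S) ((hs.sum_le_tsum S fun _ _ => norm_nonneg _).trans h3)
  calc _ ≤ (κ / (2 * E) + κ / (2 * E)) * E := by gcongr
    _ = κ := by field_simp; ring

/-- Near the point one, the Dirichlet series of `g` is close to the truncated Euler quotient times
the zeta function. -/
theorem eventually_norm_dser_sub_le_near (hg : IsMultiplicative g) (hg1 : ∀ u, ‖g u‖ ≤ 1)
    (h1 : g 1 = 1) (hξ : Summable fun p => ‖g p.toIdeals - 1‖ ^ 2 * (pnorm p)⁻¹) (b : ℝ) {κ : ℝ}
    (hκ : 0 < κ) :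
    ∀ᶠ z in nearFilter b, ‖dser rnorm g (point z) - eulerQuotient g z.1 * zeta K (point z)‖ ≤
      κ * ‖zeta K (point z)‖ := by
  filter_upwards [eventually_norm_prod_sub_eulerQuotient_le hg1 hξ b hκ,
    eventually_near_mem b] with z hz hmem
  have hre : 1 < (point z).re := by
    simp only [point, Complex.add_re, Complex.ofReal_re, Complex.mul_re, Complex.I_re,
      Complex.ofReal_im, Complex.I_im]
    linarith [hmem.1, hmem.2.2.1]
  have hZ := tendsto_prod_zeta (K := K) hre
  refine le_of_tendsto_of_tendsto
    ((tendsto_prod_one_add_h hg hg1 h1 hre).sub (hZ.const_mul (eulerQuotient g z.1))).norm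
    (hZ.norm.const_mul κ) ?_
  filter_upwards [eventually_ge_atTop (primesLE K z.1)] with S hS
  have h2 : ∏ p ∈ S, (1 + h g (point z) p) =
      (∏ p ∈ S, eulerFactor g (point z) p) * ∏ p ∈ S, (1 - (pnorm p : ℂ) ^ (-point z))⁻¹ := by
    rw [← Finset.prod_mul_distrib]
    refine Finset.prod_congr rfl fun p _ => ?_
    have := one_sub_cpow_ne_zero p hre.le
    rw [eulerFactor]
    field_simp
  rw [h2, ← sub_mul, norm_mul]
  exact mul_le_mul_of_nonneg_right (hz S hS) (norm_nonneg _)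

end near

/-! ### The Dirichlet series of a function close to one at the primes -/

/-- The pointwise form of the triangle inequality: this is
`|v| - Re v ≤ 2 (|v| - Re (z v)) + 2 (1 - Re z) |v|`, so that `v` is close to `|v|` if `z` is close
to one and `z v` is close to `|v|`. -/
theorem two_mul_re_mul_le {z v : ℂ} (hz : ‖z‖ ≤ 1) :
    2 * (z * v).re ≤ ‖v‖ + v.re + 2 * ((1 - z.re) * ‖v‖) := by
  have h1 : z.re ^ 2 + z.im ^ 2 ≤ 1 := by
    have := Complex.sq_norm z
    rw [Complex.normSq_apply] at this
    nlinarith [norm_nonneg z]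
  have h2 : ‖v‖ ^ 2 = v.re ^ 2 + v.im ^ 2 := by
    rw [Complex.sq_norm, Complex.normSq_apply]; ring
  set n := ‖v‖
  rcases (norm_nonneg v).eq_or_lt with h0 | h0
  · have : v = 0 := norm_eq_zero.1 h0.symm
    simp [n, this]
  · have hre : (z * v).re = z.re * v.re - z.im * v.im := by simp
    rw [hre]
    -- the parallelogram inequality for `n - v = (n - z v) - (1 - z) v`
    have h3 : (n - v.re) ^ 2 + v.im ^ 2 ≤
        2 * ((n - (z.re * v.re - z.im * v.im)) ^ 2 + (z.re * v.im + z.im * v.re) ^ 2) +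
        2 * (((1 - z.re) ^ 2 + z.im ^ 2) * (v.re ^ 2 + v.im ^ 2)) := by
      nlinarith [sq_nonneg ((n - (z.re * v.re - z.im * v.im)) + ((1 - z.re) * v.re + z.im * v.im)),
        sq_nonneg (-(z.re * v.im + z.im * v.re) + ((1 - z.re) * v.im - z.im * v.re))]
    have h4 : (z.re * v.re - z.im * v.im) ^ 2 + (z.re * v.im + z.im * v.re) ^ 2 ≤ n ^ 2 := by
      have : (z.re * v.re - z.im * v.im) ^ 2 + (z.re * v.im + z.im * v.re) ^ 2 =
          (z.re ^ 2 + z.im ^ 2) * n ^ 2 := by rw [h2]; ring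
      rw [this]
      exact mul_le_of_le_one_left (sq_nonneg n) h1
    have h5 : ((1 - z.re) ^ 2 + z.im ^ 2) * n ^ 2 ≤ 2 * (1 - z.re) * n ^ 2 :=
      mul_le_mul_of_nonneg_right (by nlinarith) (sq_nonneg n)
    rw [← h2] at h3
    have h6 : n * (2 * (z.re * v.re - z.im * v.im)) ≤
        n * (n + v.re + 2 * ((1 - z.re) * n)) := by nlinarith
    exact le_of_mul_le_mul_left h6 h0

/-- The triangle inequality for the distance, in terms of Dirichlet series: a function close to one
has a series of at most the geometric mean of the sizes of the zeta function at `s` and `Re s`. -/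
theorem norm_sq_dser_le {g : Ideals K → ℂ} (hg : IsMultiplicative g) (hg1 : ∀ u, ‖g u‖ ≤ 1)
    (h1 : g 1 = 1) (hd : Summable fun p => (1 - (g p.toIdeals).re) * (pnorm p)⁻¹) {s : ℂ}
    (hs : 1 < s.re) :
    ‖dser rnorm g s‖ ^ 2 ≤
      Real.exp (16 * primeSq K + 2 * ∑' p, (1 - (g p.toIdeals).re) * (pnorm p)⁻¹) *
        (‖zeta K s.re‖ * ‖zeta K s‖) := by
  set V := ∑' p, (1 - (g p.toIdeals).re) * (pnorm p)⁻¹ with hV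
  have h0 : ∀ p : Primes K, 0 ≤ 1 - (g p.toIdeals).re := fun p => by
    linarith [(Complex.re_le_norm (g p.toIdeals)).trans (hg1 _)]
  have hs' : 1 < (s.re : ℂ).re := by simpa using hs
  refine le_of_tendsto_of_tendsto ((tendsto_prod_one_add_h hg hg1 h1 hs).norm.pow 2)
    (((tendsto_prod_zeta (K := K) hs').norm.mul (tendsto_prod_zeta (K := K) hs).norm).const_mul _)
    (.of_forall fun S => ?_)
  have h2 := norm_prod_one_add_h_le hg1 hs.le S
  have h3 := exp_sum_re_le hs'.le S
  have h4 := exp_sum_re_le hs.le S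
  have h5 : 2 * ∑ p ∈ S, (g p.toIdeals * (pnorm p : ℂ) ^ (-s)).re ≤
      ∑ p ∈ S, ((pnorm p : ℂ) ^ (-(s.re : ℂ))).re + ∑ p ∈ S, ((pnorm p : ℂ) ^ (-s)).re + 2 * V := by
    have h6 := hd.sum_le_tsum S fun p _ => mul_nonneg (h0 p) (inv_nonneg.2 (pnorm_pos p).le)
    have h7 : ∀ p ∈ S, 2 * (g p.toIdeals * (pnorm p : ℂ) ^ (-s)).re ≤
        (((pnorm p : ℂ) ^ (-(s.re : ℂ))).re + ((pnorm p : ℂ) ^ (-s)).re) +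
          2 * ((1 - (g p.toIdeals).re) * (pnorm p)⁻¹) := fun p _ => by
      refine (two_mul_re_mul_le (hg1 _)).trans ?_
      rw [cpow_re_ofReal, ← norm_rnorm_cpow]
      have h8 := mul_le_mul_of_nonneg_left (norm_pnorm_cpow_le p hs.le) (h0 p)
      linarith
    rw [Finset.mul_sum]
    refine (Finset.sum_le_sum h7).trans ?_
    rw [Finset.sum_add_distrib, Finset.sum_add_distrib, ← Finset.mul_sum]
    linarith
  calc _ ≤ (Real.exp (7 * primeSq K) *
        Real.exp (∑ p ∈ S, (g p.toIdeals * (pnorm p : ℂ) ^ (-s)).re)) ^ 2 :=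
          pow_le_pow_left₀ (norm_nonneg _) h2 2
    _ = Real.exp (14 * primeSq K) *
        Real.exp (2 * ∑ p ∈ S, (g p.toIdeals * (pnorm p : ℂ) ^ (-s)).re) := by
        rw [mul_pow, ← Real.exp_nat_mul, ← Real.exp_nat_mul]
        push_cast
        ring_nf
    _ ≤ Real.exp (14 * primeSq K) * Real.exp (∑ p ∈ S, ((pnorm p : ℂ) ^ (-(s.re : ℂ))).re +
        ∑ p ∈ S, ((pnorm p : ℂ) ^ (-s)).re + 2 * V) := by gcongr
    _ = Real.exp (14 * primeSq K) * (Real.exp (∑ p ∈ S, ((pnorm p : ℂ) ^ (-(s.re : ℂ))).re) *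
        Real.exp (∑ p ∈ S, ((pnorm p : ℂ) ^ (-s)).re) * Real.exp (2 * V)) := by
        rw [Real.exp_add, Real.exp_add]
    _ ≤ Real.exp (14 * primeSq K) * ((Real.exp (primeSq K) *
        ‖∏ p ∈ S, (1 - (pnorm p : ℂ) ^ (-(s.re : ℂ)))⁻¹‖) * (Real.exp (primeSq K) *
        ‖∏ p ∈ S, (1 - (pnorm p : ℂ) ^ (-s))⁻¹‖) * Real.exp (2 * V)) := by gcongr
    _ = _ := by
        have : Real.exp (16 * primeSq K + 2 * V) = Real.exp (14 * primeSq K) *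
            Real.exp (primeSq K) * Real.exp (primeSq K) * Real.exp (2 * V) := by
          rw [← Real.exp_add, ← Real.exp_add, ← Real.exp_add]; congr 1; ring
        rw [this]
        ring

theorem re_vertical (β t : ℝ) : ((1 + β : ℝ) + t * Complex.I : ℂ).re = 1 + β := by simp

variable (K) in
/-- Away from the point one, at bounded height, the zeta function is `o(1 / β)` on the lines
`Re s = 1 + β`: its main term `R s / (s - 1)` is small when `|t|` is a large multiple of `β`. -/
theorem exists_norm_zeta_le_div {T κ : ℝ} (hT : 0 ≤ T) (hκ : 0 < κ) : ∃ B, 0 ≤ B ∧ ∃ β₀, 0 < β₀ ∧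
    ∀ β t : ℝ, 0 < β → β < β₀ → B * β < |t| → |t| ≤ T →
      ‖zeta K ((1 + β : ℝ) + t * Complex.I)‖ ≤ κ / β := by
  have hR := dedekindZeta_residue_pos K
  obtain ⟨C, hC0, hC⟩ := exists_norm_zeta_sub_le (K := K) (δ := κ / (4 * (2 + T))) (by positivity)
  set R := dedekindZeta_residue K
  set B := 4 * R * (2 + T) / κ with hB
  have hB0 : 0 < B := by positivity
  refine ⟨B, hB0.le, min 1 (κ / (4 * (2 + T) * (C + 1))), by positivity,
    fun β t hβ hββ ht1 ht2 => ?_⟩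
  set s : ℂ := (1 + β : ℝ) + t * Complex.I with hs
  have hre : s.re = 1 + β := re_vertical β t
  have hβ1 : β < 1 := hββ.trans_le (min_le_left _ _)
  have hβC : (2 + T) * C * β ≤ κ / 4 := by
    have h1 := hββ.le.trans (min_le_right _ _)
    rw [le_div_iff₀ (by positivity)] at h1
    have : 0 ≤ (2 + T) * β := by positivity
    nlinarith
  have hsn : ‖s‖ ≤ 2 + T := by
    refine (norm_add_le _ _).trans ?_
    rw [Complex.norm_real, norm_mul, Complex.norm_real, Complex.norm_I, mul_one, Real.norm_eq_abs,
      Real.norm_eq_abs, abs_of_pos (by linarith)]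
    linarith
  have hs1 : B * β ≤ ‖s - 1‖ := by
    refine ht1.le.trans ?_
    have : (s - 1).im = t := by simp [hs]
    rw [← this]
    exact Complex.abs_im_le_norm _
  have h2 := hC s (by rw [hre]; linarith)
  rw [hre, add_sub_cancel_left] at h2
  have h3 : ‖(R : ℂ) * (s / (s - 1))‖ ≤ R * ((2 + T) / (B * β)) := by
    rw [norm_mul, norm_div, Complex.norm_real, Real.norm_of_nonneg hR.le]
    gcongr
  have h4 := norm_add_le (zeta K s - R * (s / (s - 1))) (R * (s / (s - 1)))
  rw [sub_add_cancel] at h4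
  calc _ ≤ (2 + T) * (C + κ / (4 * (2 + T)) / β) + R * ((2 + T) / (B * β)) := by
        refine h4.trans (add_le_add (h2.trans ?_) h3)
        gcongr
    _ = ((2 + T) * C * β + κ / 4 + κ / 4) / β := by
        rw [hB]; field_simp
    _ ≤ κ / β := by
        gcongr
        linarith

/-- The Dirichlet series of a function `g` close to one at the primes is close to a multiple of the
zeta function, on every line `Re s = 1 + β` with `β` comparable to `1 / log X`. Near the point one
this is a comparison of Euler products, and elsewhere both series are `o(1 / β)`. -/
theorem eventually_norm_dser_sub_le {g : Ideals K → ℂ} (hg : IsMultiplicative g)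
    (hg1 : ∀ u, ‖g u‖ ≤ 1) (h1 : g 1 = 1)
    (hξ : Summable fun p => ‖g p.toIdeals - 1‖ ^ 2 * (pnorm p)⁻¹)
    (hd : Summable fun p => (1 - (g p.toIdeals).re) * (pnorm p)⁻¹) {δ : ℝ} (hδ : 0 < δ) (B : ℝ) :
    ∀ᶠ X in atTop, ∀ β : ℝ, (Real.log X)⁻¹ ≤ β → β ≤ B * (Real.log X)⁻¹ → ∀ t : ℝ,
      ‖dser rnorm g ((1 + β : ℝ) + t * Complex.I) -
        eulerQuotient g X * zeta K ((1 + β : ℝ) + t * Complex.I)‖ ≤ δ * (1 + |t|) / β := by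
  have hG1 := one_le_growthConst (K := K)
  set G := growthConst K
  set D : ℝ := Real.exp (14 * primeSq K) with hD
  have hD0 : 0 < D := Real.exp_pos _
  set T : ℝ := 2 * ((1 + D) * G) / δ with hT
  set A : ℝ := Real.exp (16 * primeSq K + 2 * ∑' p, (1 - (g p.toIdeals).re) * (pnorm p)⁻¹)
  have hA0 : 0 < A := Real.exp_pos _
  set κ : ℝ := min (δ / (2 * D)) (δ ^ 2 / (8 * A * G)) with hκ
  have hκ0 : 0 < κ := by positivity
  have hκ1 : D * κ ≤ δ / 2 := by
    calc _ ≤ D * (δ / (2 * D)) := by gcongr; exact min_le_left _ _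
      _ = _ := by field_simp
  have hκ2 : A * (2 * G * κ) ≤ (δ / 2) ^ 2 := by
    calc _ ≤ A * (2 * G * (δ ^ 2 / (8 * A * G))) := by gcongr; exact min_le_right _ _
      _ = _ := by field_simp; ring
  obtain ⟨B', hB'0, β₀, hβ₀, hfar⟩ := exists_norm_zeta_le_div K (show 0 ≤ T by positivity) hκ0
  have hnear := eventually_nearFilter.1 (eventually_norm_dser_sub_le_near hg hg1 h1 hξ
    ((1 + B') * B) (show 0 < δ / (2 * G) by positivity))
  have hlim : Tendsto (fun X : ℝ => B * (Real.log X)⁻¹) atTop (𝓝 0) := by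
    simpa using (tendsto_inv_log_atTop.mono_right nhdsWithin_le_nhds).const_mul B
  filter_upwards [hnear, hlim.eventually_lt_const (lt_min hβ₀ one_pos),
    tendsto_inv_log_atTop.eventually self_mem_nhdsWithin] with X hX hBX hε β hβ1 hβ2 t
  have hβ : 0 < β := lt_of_lt_of_le hε hβ1
  have hββ₀ : β < β₀ := (hβ2.trans_lt hBX).trans_le (min_le_left _ _)
  have hβ1' : β < 1 := (hβ2.trans_lt hBX).trans_le (min_le_right _ _)
  have hL := norm_eulerQuotient_le hg1 X
  set s : ℂ := (1 + β : ℝ) + t * Complex.I with hs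
  have hre : s.re = 1 + β := re_vertical β t
  have hs1 : 1 < s.re := by rw [hre]; linarith
  have hratio : G * ((1 + β) / (1 + β - 1)) ≤ 2 * G / β := by
    rw [add_sub_cancel_left, mul_div_assoc']
    refine div_le_div_of_nonneg_right ?_ hβ.le
    nlinarith
  have hζ : ‖zeta K s‖ ≤ 2 * G / β := by
    have := norm_zeta_le (K := K) hs1
    rw [hre] at this
    exact this.trans hratio
  have hζσ : ‖zeta K s.re‖ ≤ 2 * G / β := by
    have := norm_zeta_le (K := K) (s := s.re) (by simpa using hs1)
    rw [Complex.ofReal_re, hre] at this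
    rw [hre]
    exact this.trans hratio
  have ht0 := abs_nonneg t
  have hle1 : δ / β ≤ δ * (1 + |t|) / β := by
    gcongr
    nlinarith
  rcases le_or_gt |t| (B' * β) with htn | htn
  · -- near the point one
    have h2 := hX β t hβ1 (by nlinarith)
    refine (h2.trans ?_).trans hle1
    calc _ ≤ δ / (2 * G) * (2 * G / β) := by gcongr; exact hζ
      _ = _ := by field_simp
  · refine (norm_sub_le _ _).trans ?_
    rw [norm_mul]
    rcases le_or_gt |t| T with htT | htT
    · -- at bounded height, away from the point one
      have h2 := hfar β t hβ hββ₀ htn htT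
      have h3 := norm_sq_dser_le hg hg1 h1 hd hs1
      have h4 : ‖dser rnorm g s‖ ^ 2 ≤ (δ / 2 / β) ^ 2 := by
        calc _ ≤ A * (2 * G / β * (κ / β)) := h3.trans (mul_le_mul_of_nonneg_left
              (mul_le_mul hζσ h2 (norm_nonneg _) (by positivity)) hA0.le)
          _ = A * (2 * G * κ) / β ^ 2 := by field_simp
          _ ≤ (δ / 2) ^ 2 / β ^ 2 := by gcongr
          _ = _ := (div_pow _ _ _).symm
      have h5 : ‖dser rnorm g s‖ ≤ δ / 2 / β :=
        (sq_le_sq₀ (norm_nonneg _) (by positivity)).1 h4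
      have h6 : ‖eulerQuotient g X‖ * ‖zeta K s‖ ≤ δ / 2 / β := by
        calc _ ≤ D * (κ / β) := by gcongr
          _ = D * κ / β := by ring
          _ ≤ _ := by gcongr
      refine le_trans ?_ hle1
      calc _ ≤ δ / 2 / β + δ / 2 / β := add_le_add h5 h6
        _ = _ := by ring
    · -- at large height, by the trivial bound
      have h2 := norm_dser_ideals_le hg1 (show 1 < 1 + β by linarith) t
      rw [one_mul] at h2
      have h3 : 2 * ((1 + D) * G) ≤ δ * (1 + |t|) := by
        rw [hT, div_lt_iff₀ hδ] at htT
        nlinarith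
      calc _ ≤ 2 * G / β + D * (2 * G / β) := by
            gcongr
            exact h2.trans hratio
        _ = 2 * ((1 + D) * G) / β := by ring
        _ ≤ _ := by gcongr

/-! ### Functions close to a power of the norm -/

/-- The function `g 𝒩^(-iτ)`. -/
noncomputable def twist (g : Ideals K → ℂ) (τ : ℝ) (u : Ideals K) : ℂ :=
  g u * (rnorm u : ℂ) ^ (-(τ * Complex.I))

theorem norm_rnorm_cpow_mul_I (τ : ℝ) (u : Ideals K) : ‖(rnorm u : ℂ) ^ (-(τ * Complex.I))‖ = 1 := by
  rw [norm_rnorm_cpow]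
  simp

theorem norm_twist (g : Ideals K → ℂ) (τ : ℝ) (u : Ideals K) : ‖twist g τ u‖ = ‖g u‖ := by
  rw [twist, norm_mul, norm_rnorm_cpow_mul_I, mul_one]

theorem mul_rnorm_cpow (u v : Ideals K) (s : ℂ) :
    (rnorm (u * v) : ℂ) ^ s = (rnorm u : ℂ) ^ s * (rnorm v : ℂ) ^ s := by
  rw [rnorm, idealNorm_mul, Nat.cast_mul, Complex.ofReal_mul,
    Complex.mul_cpow_ofReal_nonneg (rnorm_pos _).le (rnorm_pos _).le]

theorem normPow_eq (τ : ℝ) (u : Ideals K) : normPow τ u = (rnorm u : ℂ) ^ (τ * Complex.I) := by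
  simp [normPow]

theorem isMultiplicative_normPow (τ : ℝ) : IsMultiplicative (normPow (K := K) τ) := fun u v _ => by
  simp only [normPow_eq, mul_rnorm_cpow]

theorem norm_normPow (τ : ℝ) (u : Ideals K) : ‖normPow τ u‖ = 1 := by
  rw [normPow_eq, Complex.norm_cpow_eq_rpow_re_of_pos (rnorm_pos u)]
  simp

theorem IsMultiplicative.twist {g : Ideals K → ℂ} (hg : IsMultiplicative g) (τ : ℝ) :
    IsMultiplicative (twist g τ) := fun u v huv => by
  simp only [NumberFieldHalasz.twist, hg u v huv, mul_rnorm_cpow]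
  ring

theorem twist_one (g : Ideals K → ℂ) (τ : ℝ) : twist g τ 1 = g 1 := by
  simp [twist, idealNorm_one]

theorem dser_twist (g : Ideals K → ℂ) (τ β t : ℝ) :
    dser rnorm (twist g τ) ((1 + β : ℝ) + (t - τ : ℝ) * Complex.I) =
      dser rnorm g ((1 + β : ℝ) + t * Complex.I) := by
  refine tsum_congr fun u => ?_
  have h0 : (rnorm u : ℂ) ≠ 0 := by exact_mod_cast (rnorm_pos u).ne'
  rw [twist, mul_assoc, ← Complex.cpow_add _ _ h0]
  congr 2
  push_cast
  ring

theorem twist_normPow (τ : ℝ) : twist (normPow (K := K) τ) τ = fun _ => 1 := by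
  funext u
  have h0 : (rnorm u : ℂ) ≠ 0 := by exact_mod_cast (rnorm_pos u).ne'
  rw [twist, normPow_eq, ← Complex.cpow_add _ _ h0, add_neg_cancel, Complex.cpow_zero]

theorem norm_twist_sub_one (g : Ideals K → ℂ) (τ : ℝ) (u : Ideals K) :
    ‖twist g τ u - 1‖ = ‖g u - normPow τ u‖ := by
  have h1 : twist g τ u - 1 = (g u - normPow τ u) * (rnorm u : ℂ) ^ (-(τ * Complex.I)) := by
    have := congrFun (twist_normPow (K := K) τ) u
    simp only [twist] at this ⊢
    rw [sub_mul, this]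
  rw [h1, norm_mul, norm_rnorm_cpow_mul_I, mul_one]

theorem h_twist (g : Ideals K → ℂ) (τ : ℝ) (p : Primes K) :
    h (twist g τ) 1 p = h g (1 + τ * Complex.I) p := by
  refine tsum_congr fun k => ?_
  have h0 := idealNorm_ne_zero (p.toIdeals ^ (k + 1))
  simp only [twist, rnorm, Complex.ofReal_natCast]
  rw [mul_assoc, ← Complex.cpow_add _ _ h0]
  congr 2
  ring

theorem summable_one_sub_re_twist {g : Ideals K → ℂ} (hg1 : ∀ u, ‖g u‖ ≤ 1) {τ : ℝ}
    (hd : dist g (normPow τ) < ⊤) :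
    Summable fun p => (1 - (twist g τ p.toIdeals).re) * (pnorm p)⁻¹ := by
  have h1 : ∀ p : Primes K, (1 - (g p.toIdeals * starRingEnd ℂ (normPow τ p.toIdeals)).re) /
      pnorm p = (1 - (twist g τ p.toIdeals).re) * (pnorm p)⁻¹ := fun p => by
    rw [star_normPow, twist, div_eq_mul_inv]
  have h2 : ∀ p : Primes K, 0 ≤ (1 - (twist g τ p.toIdeals).re) * (pnorm p)⁻¹ := fun p => by
    refine mul_nonneg ?_ (inv_nonneg.2 (pnorm_pos p).le)
    have := (Complex.re_le_norm (twist g τ p.toIdeals)).trans_eq (norm_twist g τ _)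
    linarith [hg1 p.toIdeals]
  have h3 := ENNReal.summable_toReal hd.ne
  refine h3.congr fun p => ?_
  rw [h1, ENNReal.toReal_ofReal (h2 p)]

theorem summable_sq_norm_sub_one {g : Ideals K → ℂ} (hg1 : ∀ u, ‖g u‖ ≤ 1)
    (hd : Summable fun p => (1 - (g p.toIdeals).re) * (pnorm p)⁻¹) :
    Summable fun p => ‖g p.toIdeals - 1‖ ^ 2 * (pnorm p)⁻¹ := by
  refine (hd.mul_left 2).of_nonneg_of_le
    (fun p => mul_nonneg (sq_nonneg _) (inv_nonneg.2 (pnorm_pos p).le)) fun p => ?_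
  rw [← mul_assoc]
  refine mul_le_mul_of_nonneg_right ?_ (inv_nonneg.2 (pnorm_pos p).le)
  have h1 := hg1 p.toIdeals
  have h2 : ‖g p.toIdeals‖ ^ 2 ≤ 1 := pow_le_one₀ (norm_nonneg _) h1
  rw [Complex.sq_norm, Complex.normSq_apply] at h2 ⊢
  simp only [Complex.sub_re, Complex.one_re, Complex.sub_im, Complex.one_im]
  nlinarith

/-- Otherwise the zeta function would be bounded near the point one, where it has a pole. -/
theorem not_summable_inv_pnorm : ¬ Summable fun p : Primes K => (pnorm p)⁻¹ := by
  intro hsum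
  have hR := dedekindZeta_residue_pos K
  obtain ⟨C, hC0, hC⟩ := exists_norm_zeta_sub_le (K := K)
    (δ := dedekindZeta_residue K / 4) (by positivity)
  set R := dedekindZeta_residue K
  set M : ℝ := Real.exp (7 * primeSq K) * Real.exp (∑' p : Primes K, (pnorm p)⁻¹) with hM
  have hM0 : 0 < M := by positivity
  have hbound : ∀ s : ℂ, 1 < s.re → ‖zeta K s‖ ≤ M := fun s hs => by
    have h1 := tendsto_prod_one_add_h (K := K) isMultiplicative_one (by simp) rfl hs
    refine le_of_tendsto h1.norm (.of_forall fun S => ?_)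
    refine (norm_prod_one_add_h_le (by simp) hs.le S).trans ?_
    rw [hM]
    gcongr
    refine (Finset.sum_le_sum fun p _ => ?_).trans
      (hsum.sum_le_tsum S fun p _ => inv_nonneg.2 (pnorm_pos p).le)
    rw [one_mul]
    exact (Complex.re_le_norm _).trans (norm_pnorm_cpow_le p hs.le)
  set β : ℝ := min 1 (R / (4 * (M + 2 * C))) with hβ
  have hβ0 : 0 < β := lt_min one_pos (by positivity)
  have hβ1 : β ≤ 1 := min_le_left _ _
  have hβ2 : (M + 2 * C) * β ≤ R / 4 := by
    calc _ ≤ (M + 2 * C) * (R / (4 * (M + 2 * C))) := by gcongr; exact min_le_right _ _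
      _ = _ := by field_simp
  have h1 := hC ((1 + β : ℝ) : ℂ) (by simpa using hβ0)
  have h2 := hbound ((1 + β : ℝ) : ℂ) (by simpa using hβ0)
  have h3 : (R : ℂ) * (((1 + β : ℝ) : ℂ) / (((1 + β : ℝ) : ℂ) - 1)) =
      ((R * ((1 + β) / β) : ℝ) : ℂ) := by
    push_cast
    ring
  rw [h3, Complex.ofReal_re, add_sub_cancel_left, Complex.norm_real,
    Real.norm_of_nonneg (by linarith)] at h1
  have h4 := norm_sub_norm_le ((R * ((1 + β) / β) : ℝ) : ℂ) (zeta K ((1 + β : ℝ) : ℂ))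
  rw [norm_sub_rev, Complex.norm_real, Real.norm_of_nonneg (by positivity)] at h4
  have h5 : R * ((1 + β) / β) ≤ M + (1 + β) * (C + R / 4 / β) := by linarith
  have h6 : R * (1 + β) ≤ M * β + (1 + β) * (C * β + R / 4) := by
    have := mul_le_mul_of_nonneg_right h5 hβ0.le
    have e1 : R * ((1 + β) / β) * β = R * (1 + β) := by field_simp
    have e2 : (M + (1 + β) * (C + R / 4 / β)) * β = M * β + (1 + β) * (C * β + R / 4) := by
      field_simp
    linarith
  have h7 : (1 + β) * (C * β + R / 4) ≤ 2 * (C * β) + R / 2 := by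
    have : 0 ≤ C * β := by positivity
    nlinarith
  nlinarith

/-- If `g` is at finite distance from `𝒩^(iτ)`, it can be compared with a multiple of `𝒩^(iτ)`, the
multiple being the truncated Euler quotient of `g 𝒩^(-iτ)`. -/
theorem isComparison_twist {g : Ideals K → ℂ} (hg : IsMultiplicative g) (hg1 : ∀ u, ‖g u‖ ≤ 1)
    (h1 : g 1 = 1) {τ : ℝ} (hd : dist g (normPow τ) < ⊤) :
    IsComparison g (normPow τ) (eulerQuotient (twist g τ))
      (fun p => Real.exp (14 * primeSq K) * ‖g p.toIdeals - normPow τ p.toIdeals‖)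
      (Real.exp (14 * primeSq K)) := by
  have hd' := summable_one_sub_re_twist hg1 hd
  have ht1 : ∀ u, ‖twist g τ u‖ ≤ 1 := fun u => (norm_twist g τ u).trans_le (hg1 u)
  have hξ := summable_sq_norm_sub_one ht1 hd'
  refine ⟨hg, isMultiplicative_normPow τ, hg1, fun u => (norm_normPow τ u).le,
    norm_eulerQuotient_le ht1, fun p => by positivity, fun X p => ?_, ?_, fun δ hδ B => ?_⟩
  · exact mul_le_mul_of_nonneg_right (norm_eulerQuotient_le ht1 X) (norm_nonneg _)
  · refine (hξ.mul_left (Real.exp (14 * primeSq K) ^ 2)).congr fun p => ?_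
    rw [norm_twist_sub_one]
    ring
  · have hτ := abs_nonneg τ
    filter_upwards [eventually_norm_dser_sub_le (hg.twist τ) ht1 ((twist_one g τ).trans h1) hξ hd'
      (show 0 < δ / (2 * (1 + |τ|)) by positivity) B,
      tendsto_inv_log_atTop.eventually self_mem_nhdsWithin] with X hX hε β hβ1 hβ2 t
    have hβ : 0 < β := lt_of_lt_of_le hε hβ1
    have h2 := hX β hβ1 hβ2 (t - τ)
    rw [dser_twist, zeta, ← twist_normPow τ, dser_twist] at h2
    refine h2.trans (div_le_div_of_nonneg_right ?_ hβ.le)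
    have h3 := abs_sub t τ
    have h4 := one_le_sqrt_one_add_sq t
    have h5 := abs_le_sqrt_one_add_sq t
    have h6 := abs_nonneg t
    calc δ / (2 * (1 + |τ|)) * (1 + |t - τ|)
        ≤ δ / (2 * (1 + |τ|)) * ((1 + |τ|) * (2 * Real.sqrt (1 + t ^ 2))) := by
          gcongr
          nlinarith
      _ = _ := by field_simp

/-- The zero function is at distance `∑ 1 / 𝒩(p) = ∞` from `𝒩^(iτ)`. -/
theorem map_one_of_dist_lt_top {g : Ideals K → ℂ} (hg : IsMultiplicative g)
    (hg1 : ∀ u, ‖g u‖ ≤ 1) {τ : ℝ} (hd : dist g (normPow τ) < ⊤) : g 1 = 1 := by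
  rcases hg.eq_zero_or_map_one with h0 | h0
  · refine absurd ((summable_one_sub_re_twist hg1 hd).congr fun p => ?_) not_summable_inv_pnorm
    simp [twist, h0]
  · exact h0

theorem sum_sub_eulerQuotient_isLittleO {g : Ideals K → ℂ} (hg : IsMultiplicative g)
    (hg1 : ∀ u, ‖g u‖ ≤ 1) {τ : ℝ} (hd : dist g (normPow τ) < ⊤) :
    (fun x : ℝ => (∑ u ∈ idealsLE K x, g u) - (dedekindZeta_residue K : ℂ) *
      ((x : ℂ) ^ (1 + τ * Complex.I) / (1 + τ * Complex.I)) * eulerQuotient (twist g τ) x)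
      =o[atTop] fun x : ℝ => x := by
  have hC := isComparison_twist hg hg1 (map_one_of_dist_lt_top hg hg1 hd) hd
  have hb : (fun x : ℝ => eulerQuotient (twist g τ) x) =O[atTop] fun _ => (1 : ℝ) :=
    IsBigO.of_bound (Real.exp (14 * primeSq K)) (.of_forall fun x => by
      simpa using hC.factor_le x)
  have h1 := hb.mul_isLittleO (sum_normPow_isLittleO (K := K) τ)
  simp only [one_mul] at h1
  refine (hC.isLittleO.add h1).congr_left fun x => ?_
  rw [Finset.sum_sub_distrib, ← Finset.mul_sum]
  ring

end

end NumberFieldHalasz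

theorem mainTheorem7 (K : Type*) [Field K] [NumberField K]
    (g : NumberFieldHalasz.Ideals K → ℂ) (hg : NumberFieldHalasz.IsMultiplicative g)
    (hg1 : ∀ u, ‖g u‖ ≤ 1) :
    ((⨅ τ : ℝ, NumberFieldHalasz.dist g (NumberFieldHalasz.normPow τ)) = ⊤ →
      Tendsto (fun x : ℝ => NumberFieldHalasz.mean g x) atTop (𝓝 0)) ∧
    (∀ τ : ℝ, NumberFieldHalasz.dist g (NumberFieldHalasz.normPow τ) < ⊤ →
      (fun x : ℝ => (∑ u ∈ NumberFieldHalasz.idealsLE K x, g u) -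
        (NumberField.dedekindZeta_residue K : ℂ) *
          ((x : ℂ) ^ (1 + τ * Complex.I) / (1 + τ * Complex.I)) *
          ∏ p ∈ NumberFieldHalasz.primesLE K x,
            ((1 - 1 / (NumberFieldHalasz.norm p.toIdeals : ℂ)) *
              (1 + NumberFieldHalasz.h g (1 + τ * Complex.I) p)))
        =o[atTop] (fun x : ℝ => x)) := by
  refine ⟨fun hd => NumberFieldHalasz.tendsto_mean_zero hg hg1 (iInf_eq_top.1 hd),
    fun τ hd => ?_⟩
  refine (NumberFieldHalasz.sum_sub_eulerQuotient_isLittleO hg hg1 hd).congr_left fun x => ?_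
  congr 2
  refine Finset.prod_congr rfl fun p _ => ?_
  rw [NumberFieldHalasz.eulerFactor, NumberFieldHalasz.h_twist,
    NumberFieldHalasz.pnorm_cpow_neg_one]
  simp
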